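/- Let $V\in C^2(\mathbb R^d)$ with $Z=\int e^{-V}dx<\infty$, and let $\mu^\star=Z^{-1}e^{-V}dx$. For $\varepsilon>0$ let $k_\varepsilon(x)=Z_\varepsilon^{-1}\exp(-\|x\|^2/(2\varepsilon^2))$ be the normalized Gaussian kernel on $\mathbb R^d$, let $k_\varepsilon\star\mu=\int k_\varepsilon(\cdot-x)\,d\mu(x)$ (a density, and also the measure with this density), and define the mollified relative entropy $$\mathcal F_\varepsilon(\mu)=\int V\,d(k_\varepsilon\star\mu)+\int\log(k_\varepsilon\star\mu)\,d(k_\varepsilon\star\mu),$$ set to $+\infty$ if one of the integrals does not converge absolutely. For a functional $\mathcal F$ on measures with values in $[-\infty,+\infty]$, a measure $\mu$ and $\psi\in C_c^\infty(\mathbb R^d)$, let $$\mathrm{Hess}_\mu\mathcal F(\psi,\psi)=\frac{d^2}{dt^2}\Big|_{t=0}\mathcal F(\rho_t),\qquad \rho_t=(I+t\nabla\psi)_\#\mu,$$ which is said to exist if $\mathcal F(\rho_t)$ is finite and differentiable in $t$ for $t$ in a neighbourhood of $0$ in $\mathbb R$ and twice differentiable at $t=0$. Let $\mu$ be a probability measure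 on $\mathbb R^d$ with finite second moment that is absolutely continuous with respect to Lebesgue measure, and assume that $\int |V|\,d(k_{\varepsilon_0}\star\mu)<\infty$ for some $\varepsilon_0>0$. Let $\psi\in C_c^\infty(\mathbb R^d)$. Then $\mathrm{Hess}_\mu\mathcal F_\varepsilon(\psi,\psi)$ exists for every $0<\varepsilon<\varepsilon_0$, and $$\mathrm{Hess}_\mu\mathcal F_\varepsilon(\psi,\psi)\xrightarrow[\varepsilon\to0^+]{}\int\Big[\langle \mathrm H_V(x)\nabla\psi(x),\nabla\psi(x)\rangle+\|\mathrm H\psi(x)\|_{HS}^2\Big]d\mu(x).$$ If moreover $\mathrm{KL}(\mu|\mu^\star)<\infty$ (so that the Wasserstein Hessian of the KL at $\mu$ makes sense), then $\mathrm{Hess}_\mu\mathrm{KL}(\cdot|\mu^\star)(\psi,\psi)$ exists and equals this limit, so that $\mathrm{Hess}_\mu\mathcal F_\varepsilon(\psi,\psi)\to\mathrm{Hess}_\mu\mathrm{KL}(\cdot|\mu^\star)(\psi,\psi)$. -/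

import Mathlib

open MeasureTheory Filter Set
open scoped Topology ENNReal ContDiff

noncomputable section

/-- The transport path `ρ_t = (I + t ∇ψ)_# μ`. -/
def transportPath {d : ℕ} (μ : Measure (EuclideanSpace ℝ (Fin d)))
    (ψ : EuclideanSpace ℝ (Fin d) → ℝ) (t : ℝ) : Measure (EuclideanSpace ℝ (Fin d)) :=
  μ.map (fun x => x + t • gradient ψ x)

/-- `Hess_μ F (ψ, ψ)` exists and equals `c`: the functional `F` is finite along the path
`ρ_t = (I + t ∇ψ)_# μ` for `t` near `0`, the real function `t ↦ F (ρ_t)` is differentiable near `0`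
and twice differentiable at `0`, and its second derivative at `0` is `c`. -/
def HasWassersteinHessian {d : ℕ} (F : Measure (EuclideanSpace ℝ (Fin d)) → EReal)
    (μ : Measure (EuclideanSpace ℝ (Fin d))) (ψ : EuclideanSpace ℝ (Fin d) → ℝ) (c : ℝ) : Prop :=
  ∃ f : ℝ → ℝ,
    (∀ᶠ t in 𝓝 (0 : ℝ), F (transportPath μ ψ t) = (f t : EReal)) ∧
    (∀ᶠ t in 𝓝 (0 : ℝ), DifferentiableAt ℝ f t) ∧
    HasDerivAt (deriv f) c 0

/-- The normalized Gaussian kernel `k_ε(x) = exp(-‖x‖² / (2 ε²)) / Z_ε`. -/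
def gaussianKernel {d : ℕ} (ε : ℝ) (x : EuclideanSpace ℝ (Fin d)) : ℝ :=
  Real.exp (-‖x‖ ^ 2 / (2 * ε ^ 2)) /
    ∫ y : EuclideanSpace ℝ (Fin d), Real.exp (-‖y‖ ^ 2 / (2 * ε ^ 2))

/-- The density `θ ↦ ∫ k_ε(θ - x) dμ(x)` of `k_ε ⋆ μ`. -/
def mollifiedDensity {d : ℕ} (ε : ℝ) (μ : Measure (EuclideanSpace ℝ (Fin d)))
    (θ : EuclideanSpace ℝ (Fin d)) : ℝ :=
  ∫ x, gaussianKernel ε (θ - x) ∂μ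

/-- The measure `k_ε ⋆ μ`. -/
def mollify {d : ℕ} (ε : ℝ) (μ : Measure (EuclideanSpace ℝ (Fin d))) :
    Measure (EuclideanSpace ℝ (Fin d)) :=
  volume.withDensity (fun θ => ENNReal.ofReal (mollifiedDensity ε μ θ))

open Classical in
/-- The mollified relative entropy
`F_ε(μ) = ∫ V d(k_ε ⋆ μ) + ∫ log(k_ε ⋆ μ) d(k_ε ⋆ μ)`, with the value `⊤` where one of the two
integrals does not converge absolutely. -/
def mollifiedRelEntropy {d : ℕ} (V : EuclideanSpace ℝ (Fin d) → ℝ) (ε : ℝ)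
    (μ : Measure (EuclideanSpace ℝ (Fin d))) : EReal :=
  if Integrable V (mollify ε μ) ∧
      Integrable (fun θ => Real.log (mollifiedDensity ε μ θ)) (mollify ε μ) then
    (((∫ θ, V θ ∂(mollify ε μ)) +
      ∫ θ, Real.log (mollifiedDensity ε μ θ) ∂(mollify ε μ) : ℝ) : EReal)
  else ⊤

/-- The target probability measure `μ⋆ = (e^{-V} / Z) dx`, `Z = ∫ e^{-V} dx`. -/
def targetMeasure {d : ℕ} (V : EuclideanSpace ℝ (Fin d) → ℝ) :
    Measure (EuclideanSpace ℝ (Fin d)) :=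
  volume.tilted (fun x => -V x)

/-- The relative entropy `KL(· | μ⋆)`, with values in `[0, ∞]`. -/
def relEntropy {d : ℕ} (V : EuclideanSpace ℝ (Fin d) → ℝ)
    (μ : Measure (EuclideanSpace ℝ (Fin d))) : EReal :=
  ((InformationTheory.klDiv μ (targetMeasure V) : ℝ≥0∞) : EReal)

/-- The Hessian `H f(x)`, the Jacobian of the gradient. -/
def hessianOp {d : ℕ} (f : EuclideanSpace ℝ (Fin d) → ℝ) (x : EuclideanSpace ℝ (Fin d)) :
    EuclideanSpace ℝ (Fin d) →L[ℝ] EuclideanSpace ℝ (Fin d) :=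
  fderiv ℝ (gradient f) x

/-- The squared Hilbert–Schmidt norm. -/
def hsNormSq {d : ℕ} (A : EuclideanSpace ℝ (Fin d) →L[ℝ] EuclideanSpace ℝ (Fin d)) : ℝ :=
  ∑ i : Fin d, ‖A (EuclideanSpace.basisFun (Fin d) ℝ i)‖ ^ 2

/-- `∫ [⟨H_V ∇ψ, ∇ψ⟩ + ‖Hψ‖²_HS] dμ`. -/
def limitHessian {d : ℕ} (V : EuclideanSpace ℝ (Fin d) → ℝ)
    (μ : Measure (EuclideanSpace ℝ (Fin d))) (ψ : EuclideanSpace ℝ (Fin d) → ℝ) : ℝ :=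
  ∫ x, (inner ℝ (hessianOp V x (gradient ψ x)) (gradient ψ x) + hsNormSq (hessianOp ψ x)) ∂μ

end

/-! ### Differentiation under the integral sign and a weighted Cauchy–Schwarz inequality -/

section TwiceDiff

variable {α : Type*} [MeasurableSpace α] {μ : Measure α}

/-! Write v = ∇ψ, let q_t be the density of k_ε ⋆ ρ_t, and let q', q'' be its time derivatives at 0.
Since ∫ (V + log q_t) q_t is the mollified entropy, two differentiations give the Hessian ∫ [(V +
log q + 1) q'' + q'²/q]. Existence at a fixed ε is a matter of domination. The kernel and its time
derivatives are bounded by a multiple of any wider Gaussian (`pathDensity_derivs`), so V is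
controlled by its integrability at scale ε₀, while |log q_t| grows at most quadratically by Jensen's
inequality (`abs_log_pathDensity_le`), which the second moment pays for.

In the limit the potential part ∫ V q'' is local
(`tendsto_integral_potential_mul_pathDensityDeriv₂`). Near the support of v the potential is
replaced by a compactly supported C² function, two derivatives are moved onto it, and the Gaussians
act as an approximate identity. At distance at least 1 from that support the second derivative of
the kernel is O(ε) times k_{ε₀}.

The entropy part is the hard one: no derivative of μ is available, and the two terms are separately
of order ε⁻². Let X ∼ μ and condition on X + εZ = y with Z standard Gaussian. With E the posterior
expectation and s = E Z, the score is ∇ log q = -s/ε. One integration by parts turns the entropy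
integrand into ε⁻² q {(E⟨Z,v(X)⟩)² - E[⟨Z,v(X)⟩⟨s,v(X)⟩]}. Inserting the Taylor expansion of v(X) =
v(y - εZ) around y, with A = Dv(y), the order ε⁻² cancels, the order ε⁻¹ is E[⟨v,Z⟩⟨AZ,s⟩ -
⟨v,s⟩⟨AZ,Z⟩], and the order 1 is (E⟨AZ,Z⟩)² up to errors (`abs_sq_integral_inner_sub_le`).

Two facts finish the limit. First, for φ of polynomial growth with Gaussian mean zero, E φ(Z) tends
to 0 in L²(q dy) (`tendsto_integral_sq_posterior`): absolute continuity of μ and L¹-continuity of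
translations give L¹ convergence, and fourth moments upgrade it. Hence s → 0 and E[Z_i Z_j] → δ_ij,
so the order 1 term tends to (div v)². Secondly, the singular ε⁻¹ term is, after antisymmetrizing an
exact divergence, equal to integrals of derivatives of v_i ∂_k v_j against q plus quantities
quadratic in s (`integral_mul_noiseMoment_antisymm`). Its limit is ∫ Σ (∂_j v_i ∂_i v_j) - (div v)²
dμ. The sum is ∫ Σ ∂_j v_i ∂_i v_j dμ, which is ∫ ‖Hψ‖²_HS dμ because the Jacobian of a gradient is
symmetric.

For the relative entropy itself, I + t v is a diffeomorphism for small t, and the change of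
variables gives KL(ρ_t) = KL(μ) + ∫ [V(x + t v) - V(x) - log det(I + t Hψ)] dμ
(`toReal_klDiv_map_tilted`). Diagonalizing Hψ(x) makes the log determinant a sum of log(1 + t l_i),
and two differentiations give the same limit. -/

theorem aestronglyMeasurable_of_hasDerivAt {F : ℝ → α → ℝ} {F' : α → ℝ} {t₀ : ℝ}
    (hF : ∀ᶠ t in 𝓝 t₀, AEStronglyMeasurable (F t) μ)
    (hd : ∀ᵐ a ∂μ, HasDerivAt (fun t => F t a) (F' a) t₀) : AEStronglyMeasurable F' μ := by
  obtain ⟨δ, hδ, hball⟩ := Metric.eventually_nhds_iff.1 hF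
  -- The derivative is a limit of difference quotients along a sequence; the factor 1/2 keeps the
  -- first increment strictly below δ.
  have hu0 : ∀ n : ℕ, 0 < (δ / 2) / (n + 1 : ℝ) := fun n => by positivity
  have hu1 : ∀ n : ℕ, (δ / 2) / (n + 1 : ℝ) < δ := fun n => by
    rw [div_lt_iff₀ (by positivity)]
    have : (0 : ℝ) ≤ n := Nat.cast_nonneg n
    nlinarith
  have hulim : Tendsto (fun n : ℕ => (δ / 2) / (n + 1 : ℝ)) atTop (𝓝 0) :=
    by
    simpa using (tendsto_const_nhds (x := δ / 2)).mul
      (tendsto_one_div_add_atTop_nhds_zero_nat (𝕜 := ℝ)) |>.congr fun n => by ring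
  have hulim' : Tendsto (fun n : ℕ => (δ / 2) / (n + 1 : ℝ)) atTop (𝓝[≠] 0) :=
    tendsto_nhdsWithin_iff.2 ⟨hulim, Eventually.of_forall fun n => (hu0 n).ne'⟩
  refine aestronglyMeasurable_of_tendsto_ae (u := atTop)
    (f := fun (n : ℕ) a => ((δ / 2) / (n + 1 : ℝ))⁻¹ * (F (t₀ + (δ / 2) / (n + 1 : ℝ)) a - F t₀ a))
    (fun n => ?_) ?_
  · have h1 : AEStronglyMeasurable (F (t₀ + (δ / 2) / (n + 1 : ℝ))) μ := hball (by
      simp only [dist_self_add_left, Real.norm_eq_abs, abs_of_pos (hu0 n)]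
      exact hu1 n)
    have h2 : AEStronglyMeasurable (F t₀) μ := hball (by rwa [dist_self])
    exact (h1.sub h2).const_mul _
  · filter_upwards [hd] with a ha
    exact (hasDerivAt_iff_tendsto_slope_zero.1 ha).comp hulim'

/-- Differentiating twice under the integral sign. -/
theorem hasDerivAt_integral_twice {F F' F'' : ℝ → α → ℝ} {bound : α → ℝ} {r : ℝ} (hr : 0 < r)
    (hF : ∀ t ∈ Metric.ball (0 : ℝ) r, Integrable (F t) μ)
    (hd : ∀ᵐ a ∂μ, ∀ t ∈ Metric.ball (0 : ℝ) r, HasDerivAt (fun t => F t a) (F' t a) t)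
    (hd' : ∀ᵐ a ∂μ, ∀ t ∈ Metric.ball (0 : ℝ) r, HasDerivAt (fun t => F' t a) (F'' t a) t)
    (hb : ∀ᵐ a ∂μ, ∀ t ∈ Metric.ball (0 : ℝ) r, |F' t a| ≤ bound a)
    (hb' : ∀ᵐ a ∂μ, ∀ t ∈ Metric.ball (0 : ℝ) r, |F'' t a| ≤ bound a)
    (hbound : Integrable bound μ) :
    (∀ t ∈ Metric.ball (0 : ℝ) r, Integrable (F' t) μ ∧ Integrable (F'' t) μ ∧
      HasDerivAt (fun t => ∫ a, F t a ∂μ) (∫ a, F' t a ∂μ) t ∧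
      HasDerivAt (fun t => ∫ a, F' t a ∂μ) (∫ a, F'' t a ∂μ) t) ∧
    HasDerivAt (deriv fun t => ∫ a, F t a ∂μ) (∫ a, F'' 0 a ∂μ) 0 := by
  have hnhds : ∀ t ∈ Metric.ball (0 : ℝ) r, Metric.ball (0 : ℝ) r ∈ 𝓝 t := fun t ht =>
    Metric.isOpen_ball.mem_nhds ht
  have hF'm : ∀ t ∈ Metric.ball (0 : ℝ) r, AEStronglyMeasurable (F' t) μ := fun t ht =>
    aestronglyMeasurable_of_hasDerivAt
      (by filter_upwards [hnhds t ht] with u hu using (hF u hu).aestronglyMeasurable)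
      (hd.mono fun a ha => ha t ht)
  have h1 : ∀ t ∈ Metric.ball (0 : ℝ) r,
      Integrable (F' t) μ ∧ HasDerivAt (fun t => ∫ a, F t a ∂μ) (∫ a, F' t a ∂μ) t := fun t ht =>
    hasDerivAt_integral_of_dominated_loc_of_deriv_le (bound := bound) (hnhds t ht)
      (by filter_upwards [hnhds t ht] with u hu using (hF u hu).aestronglyMeasurable)
      (hF t ht) (hF'm t ht) hb hbound hd
  have h0 : (0 : ℝ) ∈ Metric.ball (0 : ℝ) r := Metric.mem_ball_self hr
  have h2 : ∀ t ∈ Metric.ball (0 : ℝ) r,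
      Integrable (F'' t) μ ∧ HasDerivAt (fun t => ∫ a, F' t a ∂μ) (∫ a, F'' t a ∂μ) t := fun t ht =>
    hasDerivAt_integral_of_dominated_loc_of_deriv_le (bound := bound) (hnhds t ht)
      (by filter_upwards [hnhds t ht] with u hu using hF'm u hu)
      (h1 t ht).1 (aestronglyMeasurable_of_hasDerivAt
      (by filter_upwards [hnhds t ht] with u hu using hF'm u hu)
      (hd'.mono fun a ha => ha t ht)) hb' hbound hd'
  refine ⟨fun t ht => ⟨(h1 t ht).1, (h2 t ht).1, (h1 t ht).2, (h2 t ht).2⟩,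
    (h2 0 h0).2.congr_of_eventuallyEq ?_⟩
  filter_upwards [hnhds 0 h0] with t ht using (h1 t ht).2.deriv

end TwiceDiff

/-- The variance of g under the normalized weight w is nonnegative; expanding it around the weighted
mean c gives Cauchy–Schwarz without square roots. -/
theorem sq_integral_mul_le {α : Type*} [MeasurableSpace α] {μ : Measure α} {w g : α → ℝ}
    (hw : ∀ a, 0 ≤ w a) (hw0 : 0 < ∫ a, w a ∂μ) (h0 : Integrable w μ)
    (h1 : Integrable (fun a => g a * w a) μ) (h2 : Integrable (fun a => g a ^ 2 * w a) μ) :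
    (∫ a, g a * w a ∂μ) ^ 2 ≤ (∫ a, w a ∂μ) * ∫ a, g a ^ 2 * w a ∂μ := by
  set c := (∫ a, g a * w a ∂μ) / ∫ a, w a ∂μ with hc
  have h : 0 ≤ ∫ a, (g a - c) ^ 2 * w a ∂μ :=
    integral_nonneg fun a => mul_nonneg (sq_nonneg _) (hw a)
  have e : ∀ a, (g a - c) ^ 2 * w a = g a ^ 2 * w a - 2 * c * (g a * w a) + c ^ 2 * w a :=
    fun a => by ring
  have h3 : ∫ a, (g a - c) ^ 2 * w a ∂μ = ∫ a, g a ^ 2 * w a ∂μ - 2 * c * ∫ a, g a * w a ∂μ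
      + c ^ 2 * ∫ a, w a ∂μ := by
    have h12 : Integrable (fun a => g a ^ 2 * w a - 2 * c * (g a * w a)) μ := h2.sub (h1.const_mul _)
    simp only [e]
    rw [integral_add h12 (h0.const_mul _), integral_sub h2 (h1.const_mul _),
      integral_const_mul, integral_const_mul]
  have hcw : c * ∫ a, w a ∂μ = ∫ a, g a * w a ∂μ := by rw [hc]; field_simp
  have h4 : 0 ≤ ∫ a, g a ^ 2 * w a ∂μ - c * ∫ a, g a * w a ∂μ := by
    have : c ^ 2 * ∫ a, w a ∂μ = c * ∫ a, g a * w a ∂μ := by rw [← hcw]; ring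
    rw [h3, this] at h; linarith
  rw [hc, div_mul_eq_mul_div, sub_nonneg, div_le_iff₀ hw0] at h4
  linarith [sq (∫ a, g a * w a ∂μ)]

theorem abs_integral_le_of_abs_le {α : Type*} [MeasurableSpace α] {μ : Measure α} {f g : α → ℝ}
    (hg : Integrable g μ) (h : ∀ a, |f a| ≤ g a) : |∫ a, f a ∂μ| ≤ ∫ a, g a ∂μ := by
  rw [← Real.norm_eq_abs]
  exact norm_integral_le_of_norm_le hg (Eventually.of_forall fun a => h a)

/-! ### The Gaussian kernel: scaling, domination by wider Gaussians, derivatives along lines -/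

section GaussianKernel

variable {d : ℕ}

/-- The exponential series gives (1 + r)^n ≤ n! e^{1 + r}, and completing the square gives r - c r²
≤ 1/(4c). -/
theorem one_add_pow_mul_exp_le {c : ℝ} (hc : 0 < c) (n : ℕ) {r : ℝ} (hr : 0 ≤ r) :
    (1 + r) ^ n * Real.exp (-c * r ^ 2) ≤ n.factorial * Real.exp (1 + 1 / (4 * c)) := by
  have h1 := Real.pow_div_factorial_le_exp (1 + r) (by positivity) n
  rw [div_le_iff₀ (by positivity)] at h1
  have h2 : Real.exp (1 + r) * Real.exp (-c * r ^ 2) ≤ Real.exp (1 + 1 / (4 * c)) := by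
    rw [← Real.exp_add]
    refine Real.exp_le_exp.2 ?_
    have : 1 / (4 * c) - r + c * r ^ 2 = c * (r - 1 / (2 * c)) ^ 2 := by field_simp; ring
    nlinarith [mul_nonneg hc.le (sq_nonneg (r - 1 / (2 * c)))]
  calc (1 + r) ^ n * Real.exp (-c * r ^ 2)
      ≤ Real.exp (1 + r) * n.factorial * Real.exp (-c * r ^ 2) := by gcongr
    _ = n.factorial * (Real.exp (1 + r) * Real.exp (-c * r ^ 2)) := by ring
    _ ≤ _ := by gcongr

theorem integrable_exp_neg_mul_norm_sq {b : ℝ} (hb : 0 < b) :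
    Integrable (fun u : EuclideanSpace ℝ (Fin d) => Real.exp (-b * ‖u‖ ^ 2)) := by
  by_contra h
  have h1 := GaussianFourier.integral_rexp_neg_mul_sq_norm (V := EuclideanSpace ℝ (Fin d)) hb
  -- Without integrability the Bochner integral would take its default value 0, whereas the closed
  -- formula is positive.
  rw [integral_undef h] at h1
  have : 0 < (Real.pi / b) ^ (Module.finrank ℝ (EuclideanSpace ℝ (Fin d)) / 2 : ℝ) :=
    Real.rpow_pos_of_pos (div_pos Real.pi_pos hb) _
  linarith

theorem gaussianKernel_eq (ε : ℝ) (u : EuclideanSpace ℝ (Fin d)) :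
    gaussianKernel ε u = (∫ y : EuclideanSpace ℝ (Fin d), Real.exp (-(1 / (2 * ε ^ 2)) * ‖y‖ ^ 2))⁻¹
      * Real.exp (-(1 / (2 * ε ^ 2)) * ‖u‖ ^ 2) := by
  have h : ∀ y : EuclideanSpace ℝ (Fin d),
      -‖y‖ ^ 2 / (2 * ε ^ 2) = -(1 / (2 * ε ^ 2)) * ‖y‖ ^ 2 := fun y => by ring
  simp only [gaussianKernel, h, div_eq_inv_mul]

theorem gaussianMass_pos {ε : ℝ} (hε : 0 < ε) :
    0 < ∫ y : EuclideanSpace ℝ (Fin d), Real.exp (-(1 / (2 * ε ^ 2)) * ‖y‖ ^ 2) := by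
  rw [GaussianFourier.integral_rexp_neg_mul_sq_norm (by positivity)]
  exact Real.rpow_pos_of_pos (div_pos Real.pi_pos (by positivity)) _

theorem gaussianKernel_pos {ε : ℝ} (hε : 0 < ε) (u : EuclideanSpace ℝ (Fin d)) :
    0 < gaussianKernel ε u := by
  rw [gaussianKernel_eq]
  have := gaussianMass_pos (d := d) hε
  positivity

theorem continuous_gaussianKernel (ε : ℝ) :
    Continuous (gaussianKernel ε : EuclideanSpace ℝ (Fin d) → ℝ) := by
  unfold gaussianKernel
  fun_prop

theorem integrable_one_add_norm_pow_mul_gaussianKernel {ε : ℝ} (hε : 0 < ε) (n : ℕ) :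
    Integrable (fun u : EuclideanSpace ℝ (Fin d) => (1 + ‖u‖) ^ n * gaussianKernel ε u) := by
  have hb : 0 < 1 / (4 * ε ^ 2) := by positivity
  set Z := ∫ y : EuclideanSpace ℝ (Fin d), Real.exp (-(1 / (2 * ε ^ 2)) * ‖y‖ ^ 2)
  have hZ : 0 < Z := gaussianMass_pos hε
  refine (((integrable_exp_neg_mul_norm_sq (d := d) hb).const_mul
    (Z⁻¹ * (n.factorial * Real.exp (1 + 1 / (4 * (1 / (4 * ε ^ 2))))))).mono'
    (by have := continuous_gaussianKernel (d := d) ε; fun_prop) (Eventually.of_forall fun u => ?_))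
  rw [Real.norm_of_nonneg (mul_nonneg (by positivity) (gaussianKernel_pos hε u).le),
    gaussianKernel_eq]
  have h := one_add_pow_mul_exp_le hb n (norm_nonneg u)
  have h2 : Real.exp (-(1 / (2 * ε ^ 2)) * ‖u‖ ^ 2) =
      Real.exp (-(1 / (4 * ε ^ 2)) * ‖u‖ ^ 2) * Real.exp (-(1 / (4 * ε ^ 2)) * ‖u‖ ^ 2) := by
    rw [← Real.exp_add]; congr 1; ring
  calc _ = Z⁻¹ * ((1 + ‖u‖) ^ n * Real.exp (-(1 / (4 * ε ^ 2)) * ‖u‖ ^ 2))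
        * Real.exp (-(1 / (4 * ε ^ 2)) * ‖u‖ ^ 2) := by rw [h2]; ring
    _ ≤ _ := by gcongr

theorem integrable_gaussianKernel {ε : ℝ} (hε : 0 < ε) :
    Integrable (gaussianKernel ε : EuclideanSpace ℝ (Fin d) → ℝ) := by
  simpa using integrable_one_add_norm_pow_mul_gaussianKernel (d := d) hε 0

theorem integral_gaussianKernel {ε : ℝ} (hε : 0 < ε) :
    ∫ u : EuclideanSpace ℝ (Fin d), gaussianKernel ε u = 1 := by
  simp only [gaussianKernel_eq]
  rw [integral_const_mul, inv_mul_cancel₀ (gaussianMass_pos hε).ne']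

theorem gaussianKernel_scale {ε : ℝ} (hε : 0 < ε) (u : EuclideanSpace ℝ (Fin d)) :
    gaussianKernel ε u = (ε ^ d)⁻¹ * gaussianKernel 1 (ε⁻¹ • u) := by
  have h : ∀ y : EuclideanSpace ℝ (Fin d), Real.exp (-(1 / (2 * ε ^ 2)) * ‖y‖ ^ 2) =
      Real.exp (-(1 / (2 * 1 ^ 2)) * ‖ε⁻¹ • y‖ ^ 2) := fun y => by
    rw [norm_smul, Real.norm_of_nonneg (by positivity)]
    congr 1; field_simp
  rw [gaussianKernel_eq, gaussianKernel_eq, ← h]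
  simp only [h]
  rw [Measure.integral_comp_smul volume (fun y => Real.exp (-(1 / (2 * 1 ^ 2)) * ‖y‖ ^ 2))]
  simp only [finrank_euclideanSpace, Fintype.card_fin, smul_eq_mul, mul_inv]
  rw [abs_of_nonneg (by positivity)]
  simp only [inv_pow, inv_inv]
  ring

theorem integral_gaussianKernel_mul_comp {ε : ℝ} (hε : 0 < ε) (x : EuclideanSpace ℝ (Fin d))
    (φ : EuclideanSpace ℝ (Fin d) → ℝ) :
    ∫ y, φ (ε⁻¹ • (y - x)) * gaussianKernel ε (y - x) = ∫ z, φ z * gaussianKernel 1 z := by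
  rw [integral_sub_right_eq_self (fun y => φ (ε⁻¹ • y) * gaussianKernel ε y) x]
  simp only [gaussianKernel_scale hε]
  have := Measure.integral_comp_smul (volume : Measure (EuclideanSpace ℝ (Fin d)))
    (fun z => φ z * ((ε ^ d)⁻¹ * gaussianKernel 1 z)) ε⁻¹
  rw [this, ← integral_smul]
  refine integral_congr_ae (Eventually.of_forall fun z => ?_)
  simp only [finrank_euclideanSpace, Fintype.card_fin, smul_eq_mul, inv_pow, inv_inv]
  rw [abs_of_nonneg (by positivity)]
  field_simp

/-- A strictly wider Gaussian absorbs both a polynomial weight and a bounded shift. With rates b <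
a, the rate a is split as (a - b)/2 + (a + b)/2: the first half beats the polynomial, and the second
still exceeds b, which leaves room for the shift by Young's inequality. -/
theorem one_add_pow_mul_gaussianKernel_sub_le {ε ε₁ : ℝ} (hε : 0 < ε) (h1 : ε < ε₁) (M : ℝ)
    (n : ℕ) : ∃ C : ℝ, 0 ≤ C ∧ ∀ u w : EuclideanSpace ℝ (Fin d), ‖w‖ ≤ M →
      (1 + ‖u - w‖) ^ n * gaussianKernel ε (u - w) ≤ C * gaussianKernel ε₁ u := by
  have hε₁ : 0 < ε₁ := hε.trans h1
  set Z := ∫ y : EuclideanSpace ℝ (Fin d), Real.exp (-(1 / (2 * ε ^ 2)) * ‖y‖ ^ 2) with hZd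
  have hZ : 0 < Z := gaussianMass_pos hε
  set Z₁ := ∫ y : EuclideanSpace ℝ (Fin d), Real.exp (-(1 / (2 * ε₁ ^ 2)) * ‖y‖ ^ 2) with hZ1d
  have hZ₁ : 0 < Z₁ := gaussianMass_pos hε₁
  set a := 1 / (2 * ε ^ 2) with ha
  set b := 1 / (2 * ε₁ ^ 2) with hb
  have hb0 : 0 < b := by positivity
  have hab : b < a := by
    rw [ha, hb]
    exact one_div_lt_one_div_of_lt (by positivity) (by gcongr)
  -- Young's parameter is tuned so that b (1 + η) is exactly the midpoint (a + b)/2.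
  set η := (a - b) / (2 * b) with hη
  have hη0 : 0 < η := div_pos (by linarith) (by positivity)
  have hηb : b * (1 + η) = (a + b) / 2 := by rw [hη]; field_simp; ring
  set K := b * ((1 + 1 / η) * M ^ 2)
  set c := (a - b) / 2
  have hc : 0 < c := by simp only [c]; linarith
  refine ⟨Z⁻¹ * (n.factorial * Real.exp (1 + 1 / (4 * c))) * Real.exp K * Z₁, by positivity, ?_⟩
  intro u w hw
  rw [gaussianKernel_eq, gaussianKernel_eq, ← hZd, ← hZ1d]
  have hkey : -(a + b) / 2 * ‖u - w‖ ^ 2 ≤ K + -b * ‖u‖ ^ 2 := by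
    have e1 : ‖u‖ ≤ ‖u - w‖ + ‖w‖ := by simpa using norm_add_le (u - w) w
    have e2 : ‖u‖ ^ 2 ≤ (1 + η) * ‖u - w‖ ^ 2 + (1 + 1 / η) * ‖w‖ ^ 2 := by
      have e3 : ‖u‖ ^ 2 ≤ (‖u - w‖ + ‖w‖) ^ 2 := by gcongr
      have e4 : (1 + η) * ‖u - w‖ ^ 2 + (1 + 1 / η) * ‖w‖ ^ 2 - (‖u - w‖ + ‖w‖) ^ 2
          = (η * ‖u - w‖ - ‖w‖) ^ 2 / η := by field_simp; ring
      have e5 : 0 ≤ (η * ‖u - w‖ - ‖w‖) ^ 2 / η := by positivity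
      linarith
    have e6 : ‖w‖ ^ 2 ≤ M ^ 2 := by gcongr
    have e7 : (1 + 1 / η) * ‖w‖ ^ 2 ≤ (1 + 1 / η) * M ^ 2 := by gcongr
    have e8 : b * ‖u‖ ^ 2 ≤ b * ((1 + η) * ‖u - w‖ ^ 2 + (1 + 1 / η) * M ^ 2) := by
      gcongr; linarith
    have e9 : b * ((1 + η) * ‖u - w‖ ^ 2 + (1 + 1 / η) * M ^ 2) =
      (a + b) / 2 * ‖u - w‖ ^ 2 + K := by rw [← hηb]; simp only [K]; ring
    linarith
  have hsplit : Real.exp (-a * ‖u - w‖ ^ 2) =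
      Real.exp (-c * ‖u - w‖ ^ 2) * Real.exp (-(a + b) / 2 * ‖u - w‖ ^ 2) := by
    rw [← Real.exp_add]; congr 1; simp only [c]; ring
  calc (1 + ‖u - w‖) ^ n * (Z⁻¹ * Real.exp (-a * ‖u - w‖ ^ 2))
      = Z⁻¹ * ((1 + ‖u - w‖) ^ n * Real.exp (-c * ‖u - w‖ ^ 2))
        * Real.exp (-(a + b) / 2 * ‖u - w‖ ^ 2) := by rw [hsplit]; ring
    _ ≤ Z⁻¹ * (n.factorial * Real.exp (1 + 1 / (4 * c))) * Real.exp (K + -b * ‖u‖ ^ 2) := by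
        have := one_add_pow_mul_exp_le hc n (norm_nonneg (u - w))
        gcongr
    _ = _ := by
        rw [Real.exp_add K]
        generalize Real.exp (-b * ‖u‖ ^ 2) = X
        field_simp

theorem one_add_pow_mul_gaussianKernel_bounded {ε : ℝ} (hε : 0 < ε) (n : ℕ) :
    ∃ C : ℝ, 0 ≤ C ∧ ∀ u : EuclideanSpace ℝ (Fin d), (1 + ‖u‖) ^ n * gaussianKernel ε u ≤ C := by
  set Z := ∫ y : EuclideanSpace ℝ (Fin d), Real.exp (-(1 / (2 * ε ^ 2)) * ‖y‖ ^ 2) with hZd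
  have hZ : 0 < Z := gaussianMass_pos hε
  refine ⟨Z⁻¹ * (n.factorial * Real.exp (1 + 1 / (4 * (1 / (2 * ε ^ 2))))), by positivity,
    fun u => ?_⟩
  rw [gaussianKernel_eq, ← hZd]
  have := one_add_pow_mul_exp_le (c := 1 / (2 * ε ^ 2)) (by positivity) n (norm_nonneg u)
  calc _ = Z⁻¹ * ((1 + ‖u‖) ^ n * Real.exp (-(1 / (2 * ε ^ 2)) * ‖u‖ ^ 2)) := by ring
    _ ≤ _ := by gcongr

theorem hasFDerivAt_gaussianKernel (ε : ℝ) (u : EuclideanSpace ℝ (Fin d)) :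
    HasFDerivAt (gaussianKernel ε) (-(gaussianKernel ε u / ε ^ 2) • innerSL ℝ u) u := by
  have h1 : HasFDerivAt (fun u : EuclideanSpace ℝ (Fin d) => ‖u‖ ^ 2) (2 • innerSL ℝ u) u :=
    (hasStrictFDerivAt_norm_sq u).hasFDerivAt
  have h2 := ((h1.const_mul (-(1 / (2 * ε ^ 2)))).exp).const_mul
    (∫ y : EuclideanSpace ℝ (Fin d), Real.exp (-(1 / (2 * ε ^ 2)) * ‖y‖ ^ 2))⁻¹
  have : (gaussianKernel ε : EuclideanSpace ℝ (Fin d) → ℝ) = fun u => _ * _ :=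
    funext fun u => gaussianKernel_eq ε u
  rw [this]
  refine h2.congr_fderiv ?_
  ext w
  simp
  field_simp

/-- The derivative of `t ↦ k_ε (u - t v)`. -/
theorem hasDerivAt_gaussianKernel_line (ε : ℝ) (u v : EuclideanSpace ℝ (Fin d)) (t : ℝ) :
    HasDerivAt (fun t : ℝ => gaussianKernel ε (u - t • v))
      (gaussianKernel ε (u - t • v) * (inner ℝ (u - t • v) v / ε ^ 2)) t := by
  have h1 : HasDerivAt (fun t : ℝ => u - t • v) (-v) t := by
    simpa using ((hasDerivAt_id t).smul_const v).const_sub u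
  have h2 := (hasFDerivAt_gaussianKernel ε (u - t • v)).comp_hasDerivAt t h1
  refine HasDerivAt.congr_deriv h2 ?_
  simp only [smul_apply, innerSL_apply_apply, inner_neg_right, smul_eq_mul]
  ring

/-- The second derivative of `t ↦ k_ε (u - t v)`. -/
theorem hasDerivAt_gaussianKernel_line_twice (ε : ℝ) (u v : EuclideanSpace ℝ (Fin d)) (t : ℝ) :
    HasDerivAt (fun t : ℝ => gaussianKernel ε (u - t • v) * (inner ℝ (u - t • v) v / ε ^ 2))
      (gaussianKernel ε (u - t • v) *
        ((inner ℝ (u - t • v) v / ε ^ 2) ^ 2 - ‖v‖ ^ 2 / ε ^ 2)) t := by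
  have h1 : HasDerivAt (fun t : ℝ => u - t • v) (-v) t := by
    simpa using ((hasDerivAt_id t).smul_const v).const_sub u
  have h2 : HasDerivAt (fun t : ℝ => (inner ℝ (u - t • v) v : ℝ)) (-‖v‖ ^ 2) t := by
    have := h1.inner ℝ (hasDerivAt_const t v)
    simpa [inner_neg_left, real_inner_self_eq_norm_sq] using this
  have h3 := (hasDerivAt_gaussianKernel_line ε u v t).mul (h2.div_const (ε ^ 2))
  refine HasDerivAt.congr_deriv h3 ?_
  ring

end GaussianKernel

/-! ### The mollified density along the transport path and its time derivatives -/

noncomputable section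

section PathDensity

variable {d : ℕ}

/-- The density of the mollification of `(I + t v)_# μ`. -/
def pathDensity (ε : ℝ) (μ : Measure (EuclideanSpace ℝ (Fin d)))
    (v : EuclideanSpace ℝ (Fin d) → EuclideanSpace ℝ (Fin d)) (t : ℝ)
    (y : EuclideanSpace ℝ (Fin d)) : ℝ :=
  ∫ x, gaussianKernel ε (y - x - t • v x) ∂μ

/-- The first time derivative of `pathDensity`. -/
def pathDensityDeriv (ε : ℝ) (μ : Measure (EuclideanSpace ℝ (Fin d)))
    (v : EuclideanSpace ℝ (Fin d) → EuclideanSpace ℝ (Fin d)) (t : ℝ)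
    (y : EuclideanSpace ℝ (Fin d)) : ℝ :=
  ∫ x, gaussianKernel ε (y - x - t • v x) * (inner ℝ (y - x - t • v x) (v x) / ε ^ 2) ∂μ

/-- The second time derivative of `pathDensity`. -/
def pathDensityDeriv₂ (ε : ℝ) (μ : Measure (EuclideanSpace ℝ (Fin d)))
    (v : EuclideanSpace ℝ (Fin d) → EuclideanSpace ℝ (Fin d)) (t : ℝ)
    (y : EuclideanSpace ℝ (Fin d)) : ℝ :=
  ∫ x, gaussianKernel ε (y - x - t • v x) *
    ((inner ℝ (y - x - t • v x) (v x) / ε ^ 2) ^ 2 - ‖v x‖ ^ 2 / ε ^ 2) ∂μ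

theorem mollifiedDensity_transportPath {ψ : EuclideanSpace ℝ (Fin d) → ℝ}
    (hψ : Continuous (gradient ψ)) (ε : ℝ) (μ : Measure (EuclideanSpace ℝ (Fin d))) (t : ℝ)
    (y : EuclideanSpace ℝ (Fin d)) :
    mollifiedDensity ε (transportPath μ ψ t) y = pathDensity ε μ (gradient ψ) t y := by
  unfold mollifiedDensity transportPath pathDensity
  rw [integral_map (by fun_prop)]
  · simp only [sub_sub]
  · exact ((continuous_gaussianKernel ε).comp (by fun_prop)).aestronglyMeasurable

variable {μ : Measure (EuclideanSpace ℝ (Fin d))}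

theorem integrable_mul_kernel_of_integrable [SFinite μ]
    {f g : EuclideanSpace ℝ (Fin d) → ℝ} (hf : Integrable f μ) (hg : Integrable g volume) :
    Integrable (fun p : EuclideanSpace ℝ (Fin d) × EuclideanSpace ℝ (Fin d) =>
      f p.2 * g (p.1 - p.2)) (volume.prod μ) :=
  hf.convolution_integrand (ContinuousLinearMap.mul ℝ ℝ) hg

theorem integrable_gaussianKernel_sub [IsFiniteMeasure μ] {ε : ℝ} (hε : 0 < ε)
    (y : EuclideanSpace ℝ (Fin d)) : Integrable (fun x => gaussianKernel ε (y - x)) μ := by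
  obtain ⟨C, -, hC⟩ := one_add_pow_mul_gaussianKernel_bounded (d := d) hε 0
  refine Integrable.of_bound (C := C)
    ((continuous_gaussianKernel ε).comp (by fun_prop)).aestronglyMeasurable
    (Eventually.of_forall fun x => ?_)
  rw [Real.norm_of_nonneg (gaussianKernel_pos hε _).le]
  simpa using hC (y - x)

theorem continuous_pathDensity [IsFiniteMeasure μ] {ε : ℝ} (hε : 0 < ε)
    {v : EuclideanSpace ℝ (Fin d) → EuclideanSpace ℝ (Fin d)} (hv : Continuous v) (t : ℝ) :
    Continuous (pathDensity ε μ v t) := by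
  obtain ⟨C, -, hC⟩ := one_add_pow_mul_gaussianKernel_bounded (d := d) hε 0
  refine continuous_of_dominated (bound := fun _ => C) (fun y => ?_) (fun y => ?_)
    (integrable_const _) ?_
  · exact ((continuous_gaussianKernel ε).comp (by fun_prop)).aestronglyMeasurable
  · refine Eventually.of_forall fun x => ?_
    rw [Real.norm_of_nonneg (gaussianKernel_pos hε _).le]
    simpa using hC (y - x - t • v x)
  · exact Eventually.of_forall fun x => (continuous_gaussianKernel ε).comp (by fun_prop)

theorem mollifiedDensity_eq_pathDensity (ε : ℝ)
    (v : EuclideanSpace ℝ (Fin d) → EuclideanSpace ℝ (Fin d)) :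
    mollifiedDensity ε μ = pathDensity ε μ v 0 := by
  ext y; simp [mollifiedDensity, pathDensity]

theorem continuous_mollifiedDensity [IsFiniteMeasure μ] {ε : ℝ} (hε : 0 < ε) :
    Continuous (mollifiedDensity ε μ) := by
  rw [mollifiedDensity_eq_pathDensity ε (fun _ => 0)]
  exact continuous_pathDensity hε continuous_const 0

theorem mollifiedDensity_nonneg {ε : ℝ} (hε : 0 < ε) (y : EuclideanSpace ℝ (Fin d)) :
    0 ≤ mollifiedDensity ε μ y :=
  integral_nonneg fun _ => (gaussianKernel_pos hε _).le

/-- Domination of the kernel and its time derivatives by a wider Gaussian. -/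
theorem gaussianKernel_path_bounds {ε ε₁ : ℝ} (hε : 0 < ε) (h1 : ε < ε₁) {M : ℝ} (hM : 0 ≤ M) :
    ∃ C : ℝ, 0 ≤ C ∧ ∀ u v : EuclideanSpace ℝ (Fin d), ‖v‖ ≤ M → ∀ t ∈ Metric.ball (0 : ℝ) 1,
      gaussianKernel ε (u - t • v) ≤ C * gaussianKernel ε₁ u ∧
      |gaussianKernel ε (u - t • v) * (inner ℝ (u - t • v) v / ε ^ 2)| ≤ C * gaussianKernel ε₁ u ∧
      (inner ℝ (u - t • v) v / ε ^ 2) ^ 2 * gaussianKernel ε (u - t • v) ≤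
        C * gaussianKernel ε₁ u ∧
      |gaussianKernel ε (u - t • v) * ((inner ℝ (u - t • v) v / ε ^ 2) ^ 2 - ‖v‖ ^ 2 / ε ^ 2)|
        ≤ C * gaussianKernel ε₁ u := by
  -- Exponent 2 suffices: every prefactor produced by two time derivatives is at most quadratic in
  -- ‖u - t v‖, and B collects their coefficients.
  obtain ⟨C, hC, h⟩ := one_add_pow_mul_gaussianKernel_sub_le (d := d) hε h1 M 2
  set B := 1 + M / ε ^ 2 + (M / ε ^ 2) ^ 2 + M ^ 2 / ε ^ 2 with hB
  have hB1 : 1 ≤ B := by rw [hB]; have : 0 ≤ M / ε ^ 2 + (M / ε ^ 2) ^ 2 + M ^ 2 / ε ^ 2 := by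
                           positivity
                         linarith
  refine ⟨B * C, by positivity, fun u v hv t ht => ?_⟩
  have htv : ‖t • v‖ ≤ M := by
    rw [norm_smul]
    have : ‖t‖ < 1 := by simpa using ht
    nlinarith [norm_nonneg t, norm_nonneg v]
  have hk := gaussianKernel_pos hε (u - t • v)
  have hb := h u (t • v) htv
  set r := ‖u - t • v‖
  have hr : 0 ≤ r := norm_nonneg _
  set k := gaussianKernel ε (u - t • v)
  set K := gaussianKernel ε₁ u
  have hin : |inner ℝ (u - t • v) v / ε ^ 2| ≤ (M / ε ^ 2) * r := by
    rw [abs_div, abs_of_pos (by positivity : 0 < ε ^ 2), div_mul_eq_mul_div]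
    gcongr
    calc _ ≤ r * ‖v‖ := abs_real_inner_le_norm _ _
      _ ≤ _ := by rw [mul_comm]; gcongr
  have hin2 : (inner ℝ (u - t • v) v / ε ^ 2) ^ 2 ≤ (M / ε ^ 2) ^ 2 * r ^ 2 := by
    rw [← mul_pow, ← sq_abs]; gcongr
  have hfac : ∀ s : ℝ, s ≤ B * (1 + r) ^ 2 → s * k ≤ B * C * K := fun s hs => by
    calc s * k ≤ B * (1 + r) ^ 2 * k := by gcongr
      _ = B * ((1 + r) ^ 2 * k) := by ring
      _ ≤ B * (C * K) := by gcongr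
      _ = _ := by ring
  have hr2 : r ^ 2 ≤ (1 + r) ^ 2 := by nlinarith
  have hr1 : r ≤ (1 + r) ^ 2 := by nlinarith
  have hr0 : 1 ≤ (1 + r) ^ 2 := by nlinarith
  have p1 : 0 ≤ M / ε ^ 2 := by positivity
  have p2 : 0 ≤ (M / ε ^ 2) ^ 2 := by positivity
  have p3 : 0 ≤ M ^ 2 / ε ^ 2 := by positivity
  refine ⟨?_, ?_, ?_, ?_⟩
  · simpa using hfac 1 (by nlinarith)
  · rw [abs_mul, abs_of_pos hk, mul_comm]
    refine hfac _ (hin.trans ?_)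
    have : M / ε ^ 2 ≤ B := by linarith
    gcongr
  · refine hfac _ (hin2.trans ?_)
    have : (M / ε ^ 2) ^ 2 ≤ B := by linarith
    gcongr
  · rw [abs_mul, abs_of_pos hk, mul_comm]
    refine hfac _ ?_
    have hv2 : ‖v‖ ^ 2 / ε ^ 2 ≤ M ^ 2 / ε ^ 2 := by gcongr
    calc |(inner ℝ (u - t • v) v / ε ^ 2) ^ 2 - ‖v‖ ^ 2 / ε ^ 2|
        ≤ (inner ℝ (u - t • v) v / ε ^ 2) ^ 2 + ‖v‖ ^ 2 / ε ^ 2 := by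
          refine abs_le.2 ⟨?_, ?_⟩ <;> nlinarith [sq_nonneg (inner ℝ (u - t • v) v / ε ^ 2),
            (by positivity : 0 ≤ ‖v‖ ^ 2 / ε ^ 2)]
      _ ≤ (M / ε ^ 2) ^ 2 * (1 + r) ^ 2 + M ^ 2 / ε ^ 2 * (1 + r) ^ 2 := by
          refine add_le_add (hin2.trans (by gcongr)) (hv2.trans ?_)
          nlinarith
      _ = ((M / ε ^ 2) ^ 2 + M ^ 2 / ε ^ 2) * (1 + r) ^ 2 := by ring
      _ ≤ _ := by gcongr; linarith

theorem pathDensity_pos [IsProbabilityMeasure μ] {ε : ℝ} (hε : 0 < ε)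
    {v : EuclideanSpace ℝ (Fin d) → EuclideanSpace ℝ (Fin d)} (hv : Continuous v)
    (t : ℝ) (y : EuclideanSpace ℝ (Fin d)) : 0 < pathDensity ε μ v t y := by
  obtain ⟨C, -, hC⟩ := one_add_pow_mul_gaussianKernel_bounded (d := d) hε 0
  refine (integral_pos_iff_support_of_nonneg (fun x => (gaussianKernel_pos hε _).le) ?_).2 ?_
  · refine Integrable.of_bound (C := C)
      ((continuous_gaussianKernel ε).comp (by fun_prop)).aestronglyMeasurable
      (Eventually.of_forall fun x => ?_)
    rw [Real.norm_of_nonneg (gaussianKernel_pos hε _).le]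
    simpa using hC (y - x - t • v x)
  · have : Function.support (fun x => gaussianKernel ε (y - x - t • v x)) = univ :=
      eq_univ_of_forall fun x => (gaussianKernel_pos hε _).ne'
    rw [this]; simp

theorem mollifiedDensity_pos [IsProbabilityMeasure μ] {ε : ℝ} (hε : 0 < ε)
    (y : EuclideanSpace ℝ (Fin d)) : 0 < mollifiedDensity ε μ y := by
  rw [mollifiedDensity_eq_pathDensity ε (fun _ => 0)]
  exact pathDensity_pos hε continuous_const 0 y

/-- All bounds are by the same density at a wider scale ε₁, uniformly in t, so one majorant serves
every later application of dominated convergence. The quotient q'²/q needs no lower bound on q,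
because Cauchy–Schwarz in x bounds q'² by q times an integral that is itself dominated. -/
theorem pathDensity_derivs [IsProbabilityMeasure μ] {ε ε₁ : ℝ} (hε : 0 < ε) (h1 : ε < ε₁)
    {v : EuclideanSpace ℝ (Fin d) → EuclideanSpace ℝ (Fin d)} (hv : Continuous v) {M : ℝ}
    (hM : ∀ x, ‖v x‖ ≤ M) :
    ∃ C : ℝ, 0 ≤ C ∧ ∀ y, ∀ t ∈ Metric.ball (0 : ℝ) 1,
      HasDerivAt (fun t => pathDensity ε μ v t y) (pathDensityDeriv ε μ v t y) t ∧
      HasDerivAt (fun t => pathDensityDeriv ε μ v t y) (pathDensityDeriv₂ ε μ v t y) t ∧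
      pathDensity ε μ v t y ≤ C * mollifiedDensity ε₁ μ y ∧
      |pathDensityDeriv ε μ v t y| ≤ C * mollifiedDensity ε₁ μ y ∧
      |pathDensityDeriv₂ ε μ v t y| ≤ C * mollifiedDensity ε₁ μ y ∧
      pathDensityDeriv ε μ v t y ^ 2 / pathDensity ε μ v t y ≤ C * mollifiedDensity ε₁ μ y := by
  have hε₁ := hε.trans h1
  have hM0 : 0 ≤ M := (norm_nonneg _).trans (hM 0)
  obtain ⟨C, hC, h⟩ := gaussianKernel_path_bounds (d := d) hε h1 hM0
  refine ⟨C, hC, fun y t ht => ?_⟩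
  have hQ : Integrable (fun x => C * gaussianKernel ε₁ (y - x)) μ :=
    (integrable_gaussianKernel_sub hε₁ y).const_mul C
  have hcont : ∀ t : ℝ, Continuous (fun x => gaussianKernel ε (y - x - t • v x)) := fun t =>
    (continuous_gaussianKernel ε).comp (by fun_prop)
  have hint : ∀ t ∈ Metric.ball (0 : ℝ) 1,
      Integrable (fun x => gaussianKernel ε (y - x - t • v x)) μ := fun t ht =>
    hQ.mono' (hcont t).aestronglyMeasurable (Eventually.of_forall fun x => by
      rw [Real.norm_of_nonneg (gaussianKernel_pos hε _).le]
      exact (h (y - x) (v x) (hM x) t ht).1)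
  have H := (hasDerivAt_integral_twice (μ := μ) one_pos hint
    (Eventually.of_forall fun x t _ => hasDerivAt_gaussianKernel_line ε (y - x) (v x) t)
    (Eventually.of_forall fun x t _ => hasDerivAt_gaussianKernel_line_twice ε (y - x) (v x) t)
    (Eventually.of_forall fun x t ht => (h (y - x) (v x) (hM x) t ht).2.1)
    (Eventually.of_forall fun x t ht => (h (y - x) (v x) (hM x) t ht).2.2.2) hQ).1 t ht
  have hCQ : C * mollifiedDensity ε₁ μ y = ∫ x, C * gaussianKernel ε₁ (y - x) ∂μ :=
    (integral_const_mul _ _).symm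
  have hi3 : Integrable (fun x => (inner ℝ (y - x - t • v x) (v x) / ε ^ 2) ^ 2 *
      gaussianKernel ε (y - x - t • v x)) μ :=
    hQ.mono' (by have := hcont t; exact Continuous.aestronglyMeasurable (by fun_prop))
      (Eventually.of_forall fun x => by
        rw [Real.norm_of_nonneg (mul_nonneg (sq_nonneg _) (gaussianKernel_pos hε _).le)]
        exact (h (y - x) (v x) (hM x) t ht).2.2.1)
  refine ⟨H.2.2.1, H.2.2.2, ?_, ?_, ?_, ?_⟩
  · rw [hCQ]
    exact integral_mono (hint t ht) hQ fun x => (h (y - x) (v x) (hM x) t ht).1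
  · rw [hCQ]
    exact abs_integral_le_of_abs_le hQ fun x => (h (y - x) (v x) (hM x) t ht).2.1
  · rw [hCQ]
    exact abs_integral_le_of_abs_le hQ fun x => (h (y - x) (v x) (hM x) t ht).2.2.2
  · have hq := pathDensity_pos (μ := μ) hε hv t y
    rw [div_le_iff₀ hq]
    -- The weight is the shifted kernel, whose total mass is q, and g is the logarithmic time
    -- derivative of the kernel.
    have hcs := sq_integral_mul_le (μ := μ) (w := fun x => gaussianKernel ε (y - x - t • v x))
      (g := fun x => inner ℝ (y - x - t • v x) (v x) / ε ^ 2)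
      (fun x => (gaussianKernel_pos hε _).le) hq (hint t ht)
      (by simpa only [mul_comm] using H.1) hi3
    have e1 : pathDensityDeriv ε μ v t y = ∫ x, inner ℝ (y - x - t • v x) (v x) / ε ^ 2 *
        gaussianKernel ε (y - x - t • v x) ∂μ := by
      simp only [pathDensityDeriv, mul_comm]
    rw [e1]
    refine hcs.trans ?_
    rw [mul_comm]
    refine mul_le_mul_of_nonneg_right ?_ hq.le
    rw [hCQ]
    exact integral_mono hi3 hQ fun x => (h (y - x) (v x) (hM x) t ht).2.2.1

end PathDensity

end

/-! ### Existence of the Hessian of the mollified entropy at a fixed scale -/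

section FixedScale

variable {d : ℕ} {μ : Measure (EuclideanSpace ℝ (Fin d))}

theorem integrable_one_add_norm_sq [IsFiniteMeasure μ] (hμ2 : Integrable (fun x => ‖x‖ ^ 2) μ) :
    Integrable (fun x => (1 + ‖x‖) ^ 2) μ := by
  refine (((integrable_const (2 : ℝ)).add (hμ2.const_mul 2))).mono' (by fun_prop)
    (Eventually.of_forall fun x => ?_)
  rw [Real.norm_of_nonneg (by positivity)]
  simp only [Pi.add_apply]
  nlinarith [sq_nonneg (1 - ‖x‖)]

theorem integrable_prod_one_add_norm_sq_mul_gaussianKernel [IsFiniteMeasure μ]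
    (hμ2 : Integrable (fun x => ‖x‖ ^ 2) μ) {ε : ℝ} (hε : 0 < ε) :
    Integrable (fun p : EuclideanSpace ℝ (Fin d) × EuclideanSpace ℝ (Fin d) =>
      (1 + ‖p.1‖) ^ 2 * gaussianKernel ε (p.1 - p.2)) (volume.prod μ) := by
  have h1 := integrable_mul_kernel_of_integrable (integrable_one_add_norm_sq hμ2)
    (integrable_one_add_norm_pow_mul_gaussianKernel (d := d) hε 2)
  have hk := continuous_gaussianKernel (d := d) ε
  refine h1.mono' (Continuous.aestronglyMeasurable (by fun_prop))
    (Eventually.of_forall fun p => ?_)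
  have hkp := gaussianKernel_pos hε (p.1 - p.2)
  rw [Real.norm_of_nonneg (by positivity), ← mul_assoc, ← mul_pow]
  refine mul_le_mul_of_nonneg_right ?_ hkp.le
  have h3 : ‖p.1‖ ≤ ‖p.1 - p.2‖ + ‖p.2‖ := by simpa using norm_add_le (p.1 - p.2) p.2
  -- Submultiplicativity of 1 + ‖·‖ separates the weight into a moment of μ and a moment of the
  -- kernel.
  have h4 : 1 + ‖p.1‖ ≤ (1 + ‖p.2‖) * (1 + ‖p.1 - p.2‖) := by
    nlinarith [norm_nonneg p.2, norm_nonneg (p.1 - p.2),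
      mul_nonneg (norm_nonneg p.2) (norm_nonneg (p.1 - p.2))]
  gcongr

theorem integrable_one_add_norm_sq_mul_mollifiedDensity [IsFiniteMeasure μ]
    (hμ2 : Integrable (fun x => ‖x‖ ^ 2) μ) {ε : ℝ} (hε : 0 < ε) :
    Integrable (fun y => (1 + ‖y‖) ^ 2 * mollifiedDensity ε μ y) := by
  refine (integrable_prod_one_add_norm_sq_mul_gaussianKernel hμ2 hε).integral_prod_left.congr
    (Eventually.of_forall fun y => ?_)
  simp only [mollifiedDensity, integral_const_mul]

theorem integrable_mollify_iff [IsFiniteMeasure μ] {ε : ℝ} (hε : 0 < ε)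
    {f : EuclideanSpace ℝ (Fin d) → ℝ} :
    Integrable f (mollify ε μ) ↔ Integrable (fun y => f y * mollifiedDensity ε μ y) := by
  unfold mollify
  rw [integrable_withDensity_iff (by
    have := continuous_mollifiedDensity (μ := μ) hε; fun_prop) (by simp)]
  simp only [ENNReal.toReal_ofReal (mollifiedDensity_nonneg hε _)]

theorem integral_mollify [IsFiniteMeasure μ] {ε : ℝ} (hε : 0 < ε)
    (f : EuclideanSpace ℝ (Fin d) → ℝ) :
    ∫ y, f y ∂(mollify ε μ) = ∫ y, f y * mollifiedDensity ε μ y := by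
  unfold mollify
  rw [integral_withDensity_eq_integral_toReal_smul (by
    have := continuous_mollifiedDensity (μ := μ) hε; fun_prop) (by simp)]
  simp only [ENNReal.toReal_ofReal (mollifiedDensity_nonneg hε _), smul_eq_mul, mul_comm]

/-- From above q is bounded by the supremum of the kernel. From below, Jensen's inequality for exp
gives q ≥ Z⁻¹ exp(-a ∫ ‖y - x - t v(x)‖² dμ(x)), and the exponent grows quadratically in y because μ
has a second moment. -/
theorem abs_log_pathDensity_le [IsProbabilityMeasure μ] (hμ2 : Integrable (fun x => ‖x‖ ^ 2) μ)
    {ε : ℝ} (hε : 0 < ε) {v : EuclideanSpace ℝ (Fin d) → EuclideanSpace ℝ (Fin d)}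
    (hv : Continuous v) {M : ℝ} (hM : ∀ x, ‖v x‖ ≤ M) :
    ∃ C : ℝ, 0 ≤ C ∧ ∀ y, ∀ t ∈ Metric.ball (0 : ℝ) 1,
      |Real.log (pathDensity ε μ v t y)| ≤ C * (1 + ‖y‖) ^ 2 := by
  obtain ⟨C₀, hC₀, hC⟩ := one_add_pow_mul_gaussianKernel_bounded (d := d) hε 0
  simp only [pow_zero, one_mul] at hC
  set Z := ∫ y : EuclideanSpace ℝ (Fin d), Real.exp (-(1 / (2 * ε ^ 2)) * ‖y‖ ^ 2) with hZd
  have hZ : 0 < Z := gaussianMass_pos hε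
  set a := 1 / (2 * ε ^ 2) with ha
  have ha0 : 0 < a := by positivity
  set m := ∫ x, ‖x‖ ^ 2 ∂μ with hm
  have hm0 : 0 ≤ m := integral_nonneg fun x => by positivity
  -- Using C₀ + 1 instead of C₀ makes the logarithm nonnegative, so it may be multiplied by (1 +
  -- ‖y‖)² ≥ 1.
  have hL0 : 0 ≤ Real.log (C₀ + 1) := Real.log_nonneg (by linarith)
  refine ⟨Real.log (C₀ + 1) + |Real.log Z| + 3 * a * (1 + m + M ^ 2), by positivity,
    fun y t ht => ?_⟩
  have hM0 : 0 ≤ M := (norm_nonneg _).trans (hM 0)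
  have hq := pathDensity_pos (μ := μ) hε hv t y
  have hint : Integrable (fun x => gaussianKernel ε (y - x - t • v x)) μ :=
    Integrable.of_bound (C := C₀) ((continuous_gaussianKernel ε).comp (by fun_prop)).aestronglyMeasurable
      (Eventually.of_forall fun x => by
        rw [Real.norm_of_nonneg (gaussianKernel_pos hε _).le]; exact hC _)
  have hy1 : 1 ≤ (1 + ‖y‖) ^ 2 := by nlinarith [norm_nonneg y]
  have hy2 : ‖y‖ ^ 2 ≤ (1 + ‖y‖) ^ 2 := by nlinarith [norm_nonneg y]
  have hup : Real.log (pathDensity ε μ v t y) ≤ Real.log (C₀ + 1) := by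
    refine Real.log_le_log hq ?_
    have : pathDensity ε μ v t y ≤ ∫ x, C₀ ∂μ := integral_mono hint (integrable_const _) fun x => hC _
    simp at this
    linarith
  have hbd : ∀ x, a * ‖y - x - t • v x‖ ^ 2 ≤ 3 * a * (‖y‖ ^ 2 + ‖x‖ ^ 2 + M ^ 2) := fun x => by
    have h1 : ‖y - x - t • v x‖ ≤ ‖y‖ + ‖x‖ + M := by
      have h2 : ‖t • v x‖ ≤ M := by
        rw [norm_smul]
        have : ‖t‖ < 1 := by simpa using ht
        nlinarith [norm_nonneg t, norm_nonneg (v x), hM x]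
      calc _ ≤ ‖y - x‖ + ‖t • v x‖ := norm_sub_le _ _
        _ ≤ _ := add_le_add (norm_sub_le _ _) h2
    have h3 : ‖y - x - t • v x‖ ^ 2 ≤ (‖y‖ + ‖x‖ + M) ^ 2 := by gcongr
    have h4 : (‖y‖ + ‖x‖ + M) ^ 2 ≤ 3 * (‖y‖ ^ 2 + ‖x‖ ^ 2 + M ^ 2) := by
      nlinarith [sq_nonneg (‖y‖ - ‖x‖), sq_nonneg (‖y‖ - M), sq_nonneg (‖x‖ - M)]
    calc _ ≤ a * (3 * (‖y‖ ^ 2 + ‖x‖ ^ 2 + M ^ 2)) := by gcongr; linarith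
      _ = _ := by ring
  have hbi : Integrable (fun x => 3 * a * (‖y‖ ^ 2 + ‖x‖ ^ 2 + M ^ 2)) μ :=
    (((integrable_const _).add hμ2).add (integrable_const _)).const_mul _
  have hgi : Integrable (fun x => a * ‖y - x - t • v x‖ ^ 2) μ :=
    hbi.mono' (Continuous.aestronglyMeasurable (by fun_prop)) (Eventually.of_forall fun x => by
      rw [Real.norm_of_nonneg (by positivity)]; exact hbd x)
  have hexp : ∀ x, Real.exp (-(a * ‖y - x - t • v x‖ ^ 2)) =
      Z * gaussianKernel ε (y - x - t • v x) := fun x => by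
    rw [gaussianKernel_eq, ← hZd, ← ha, mul_inv_cancel_left₀ hZ.ne']; congr 1; ring
  have hJ := convexOn_exp.map_integral_le (μ := μ) (f := fun x => -(a * ‖y - x - t • v x‖ ^ 2))
    Real.continuous_exp.continuousOn isClosed_univ (by simp) hgi.neg (by
      refine (hint.const_mul Z).congr (Eventually.of_forall fun x => ?_)
      exact (hexp x).symm)
  simp only [hexp] at hJ
  rw [integral_const_mul, integral_neg] at hJ
  change _ ≤ Z * pathDensity ε μ v t y at hJ
  have hJ2 := (Real.le_log_iff_exp_le (by positivity)).2 hJ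
  rw [Real.log_mul hZ.ne' hq.ne'] at hJ2
  have hmom : ∫ x, a * ‖y - x - t • v x‖ ^ 2 ∂μ ≤ 3 * a * (‖y‖ ^ 2 + m + M ^ 2) := by
    refine (integral_mono hgi hbi hbd).trans_eq ?_
    have i1 : Integrable (fun x => ‖y‖ ^ 2 + ‖x‖ ^ 2) μ := (integrable_const _).add hμ2
    rw [integral_const_mul, integral_add i1 (integrable_const _), integral_add (integrable_const _) hμ2]
    simp [hm]
  have hle : 3 * a * (‖y‖ ^ 2 + m + M ^ 2) ≤ 3 * a * (1 + m + M ^ 2) * (1 + ‖y‖) ^ 2 := by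
    have : ‖y‖ ^ 2 + m + M ^ 2 ≤ (1 + m + M ^ 2) * (1 + ‖y‖) ^ 2 := by
      nlinarith [mul_nonneg (add_nonneg hm0 (sq_nonneg M)) (sub_nonneg.2 hy1)]
    calc _ ≤ 3 * a * ((1 + m + M ^ 2) * (1 + ‖y‖) ^ 2) := by gcongr
      _ = _ := by ring
  have hle2 : Real.log (C₀ + 1) + |Real.log Z| ≤ (Real.log (C₀ + 1) + |Real.log Z|) * (1 + ‖y‖) ^ 2 :=
    le_mul_of_one_le_right (by positivity) hy1
  rw [add_mul]
  have hp : 0 ≤ 3 * a * (1 + m + M ^ 2) * (1 + ‖y‖) ^ 2 := by positivity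
  have hlz := le_abs_self (Real.log Z)
  have hlz' := abs_nonneg (Real.log Z)
  exact abs_le.2 ⟨by linarith, by linarith⟩

/-- The second derivative at `0` of the mollified relative entropy along the transport path. -/
noncomputable def mollifiedHessian (V : EuclideanSpace ℝ (Fin d) → ℝ) (ε : ℝ)
    (μ : Measure (EuclideanSpace ℝ (Fin d)))
    (v : EuclideanSpace ℝ (Fin d) → EuclideanSpace ℝ (Fin d)) : ℝ :=
  ∫ y, ((V y + (Real.log (pathDensity ε μ v 0 y) + 1)) * pathDensityDeriv₂ ε μ v 0 y +
    pathDensityDeriv ε μ v 0 y ^ 2 / pathDensity ε μ v 0 y)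

/-- Integrability of the terms entering the second derivative at a fixed scale. -/
theorem integrable_mollifiedHessian_terms [IsProbabilityMeasure μ]
    (hμ2 : Integrable (fun x => ‖x‖ ^ 2) μ) {V : EuclideanSpace ℝ (Fin d) → ℝ}
    {ε ε₁ : ℝ} (hε : 0 < ε) (h1 : ε < ε₁) (hVε : Integrable V (mollify ε₁ μ))
    {v : EuclideanSpace ℝ (Fin d) → EuclideanSpace ℝ (Fin d)} (hv : Continuous v) {M : ℝ}
    (hM : ∀ x, ‖v x‖ ≤ M) :
    ∃ bound : EuclideanSpace ℝ (Fin d) → ℝ, Integrable bound ∧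
      ∀ y, ∀ t ∈ Metric.ball (0 : ℝ) 1,
        |V y * pathDensity ε μ v t y| ≤ bound y ∧
        |Real.log (pathDensity ε μ v t y) * pathDensity ε μ v t y| ≤ bound y ∧
        |(V y + (Real.log (pathDensity ε μ v t y) + 1)) * pathDensityDeriv ε μ v t y| ≤ bound y ∧
        |V y * pathDensityDeriv₂ ε μ v t y| ≤ bound y ∧
        |pathDensityDeriv₂ ε μ v t y| ≤ bound y ∧
        |Real.log (pathDensity ε μ v t y) * pathDensityDeriv₂ ε μ v t y| ≤ bound y ∧
        |pathDensityDeriv ε μ v t y ^ 2 / pathDensity ε μ v t y| ≤ bound y ∧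
        |(V y + (Real.log (pathDensity ε μ v t y) + 1)) * pathDensityDeriv₂ ε μ v t y +
          pathDensityDeriv ε μ v t y ^ 2 / pathDensity ε μ v t y| ≤ bound y := by
  have hε₁ := hε.trans h1
  obtain ⟨C, hC, h⟩ := pathDensity_derivs (μ := μ) hε h1 hv hM
  obtain ⟨L, hL, hlog⟩ := abs_log_pathDensity_le hμ2 hε hv hM
  have hQ2 := integrable_one_add_norm_sq_mul_mollifiedDensity hμ2 hε₁
  have hVQ := (integrable_mollify_iff (μ := μ) hε₁).1 hVε
  -- In L + 2, the L pays for the logarithm, one unit for the constant 1 in log q + 1, and one for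
  -- q'²/q.
  refine ⟨fun y => C * |V y * mollifiedDensity ε₁ μ y| +
    C * (L + 2) * ((1 + ‖y‖) ^ 2 * mollifiedDensity ε₁ μ y),
    (hVQ.abs.const_mul _).add (hQ2.const_mul _), fun y t ht => ?_⟩
  obtain ⟨-, -, h0, h1, h2, h3⟩ := h y t ht
  have hl := hlog y t ht
  have hq := pathDensity_pos (μ := μ) hε hv t y
  have hQ := mollifiedDensity_pos (μ := μ) hε₁ y
  have hy1 : 1 ≤ (1 + ‖y‖) ^ 2 := by nlinarith [norm_nonneg y]
  set Q := mollifiedDensity ε₁ μ y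
  set q := pathDensity ε μ v t y
  set q₁ := pathDensityDeriv ε μ v t y
  set q₂ := pathDensityDeriv₂ ε μ v t y
  set Y := (1 + ‖y‖) ^ 2
  set l := Real.log q
  have hq0 : |q| ≤ C * Q := by rwa [abs_of_pos hq]
  have b1 : ∀ p : ℝ, |p| ≤ C * Q → |V y * p| ≤ C * |V y * Q| := fun p hp => by
    rw [abs_mul, abs_mul, abs_of_pos hQ]
    calc |V y| * |p| ≤ |V y| * (C * Q) := by gcongr
      _ = _ := by ring
  have b2 : ∀ p : ℝ, |p| ≤ C * Q → |l * p| ≤ C * L * (Y * Q) := fun p hp => by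
    rw [abs_mul]
    calc |l| * |p| ≤ (L * Y) * (C * Q) := by gcongr
      _ = _ := by ring
  have b3 : ∀ p : ℝ, |p| ≤ C * Q → |p| ≤ C * (Y * Q) := fun p hp => by
    refine hp.trans ?_
    have : Q ≤ Y * Q := le_mul_of_one_le_left hQ.le hy1
    gcongr
  have hYQ : 0 ≤ C * (Y * Q) := by positivity
  have hLYQ : 0 ≤ C * L * (Y * Q) := by positivity
  have hVQ' : 0 ≤ C * |V y * Q| := by positivity
  have e : C * (L + 2) * (Y * Q) = C * L * (Y * Q) + C * (Y * Q) + C * (Y * Q) := by ring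
  have hsq : |q₁ ^ 2 / q| ≤ C * Q := by rwa [abs_of_nonneg (by positivity)]
  have tri : ∀ p, |(V y + (l + 1)) * p| ≤ |V y * p| + |l * p| + |p| := fun p => by
    have : (V y + (l + 1)) * p = V y * p + l * p + p := by ring
    rw [this]; exact abs_add_three _ _ _
  beta_reduce
  refine ⟨?_, ?_, ?_, ?_, ?_, ?_, ?_, ?_⟩
  · linarith [b1 q hq0]
  · linarith [b2 q hq0]
  · linarith [tri q₁, b1 q₁ h1, b2 q₁ h1, b3 q₁ h1]
  · linarith [b1 q₂ h2]
  · linarith [b3 q₂ h2]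
  · linarith [b2 q₂ h2]
  · linarith [b3 _ hsq]
  · linarith [abs_add_le ((V y + (l + 1)) * q₂) (q₁ ^ 2 / q), tri q₂, b1 q₂ h2, b2 q₂ h2,
      b3 q₂ h2, b3 _ hsq]

/-- The integrand (V + log q) q has time derivative (V + log q + 1) q', since q · (q'/q) = q', and
then (V + log q + 1) q'' + q'²/q. The common majorant on |t| < 1 allows both derivatives under the
integral, and also makes the two integrals in the functional converge absolutely, so the value ⊤ is
never taken there. -/
theorem hasWassersteinHessian_mollifiedRelEntropy [IsProbabilityMeasure μ]
    (hμ2 : Integrable (fun x => ‖x‖ ^ 2) μ) {V : EuclideanSpace ℝ (Fin d) → ℝ} (hV : Continuous V)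
    {ε ε₁ : ℝ} (hε : 0 < ε) (h1 : ε < ε₁) (hVε : Integrable V (mollify ε₁ μ))
    {ψ : EuclideanSpace ℝ (Fin d) → ℝ} (hv : Continuous (gradient ψ)) {M : ℝ}
    (hM : ∀ x, ‖gradient ψ x‖ ≤ M) :
    HasWassersteinHessian (mollifiedRelEntropy V ε) μ ψ
      (mollifiedHessian V ε μ (gradient ψ)) := by
  obtain ⟨bound, hbi, hb⟩ := integrable_mollifiedHessian_terms hμ2 hε h1 hVε hv hM
  obtain ⟨C, -, hder⟩ := pathDensity_derivs (μ := μ) hε h1 hv hM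
  set q := pathDensity ε μ (gradient ψ)
  have hqc : ∀ t, Continuous (q t) := fun t => continuous_pathDensity hε hv t
  have hq0 : ∀ t y, q t y ≠ 0 := fun t y => (pathDensity_pos hε hv t y).ne'
  have hlc : ∀ t, Continuous (fun y => Real.log (q t y)) := fun t => (hqc t).log (hq0 t)
  have i1 : ∀ t ∈ Metric.ball (0 : ℝ) 1, Integrable (fun y => V y * q t y) := fun t ht =>
    hbi.mono' (hV.mul (hqc t)).aestronglyMeasurable
      (Eventually.of_forall fun y => (hb y t ht).1)
  have i2 : ∀ t ∈ Metric.ball (0 : ℝ) 1, Integrable (fun y => Real.log (q t y) * q t y) :=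
    fun t ht => hbi.mono' ((hlc t).mul (hqc t)).aestronglyMeasurable
      (Eventually.of_forall fun y => (hb y t ht).2.1)
  have hF : ∀ t ∈ Metric.ball (0 : ℝ) 1,
      Integrable (fun y => (V y + Real.log (q t y)) * q t y) := fun t ht => by
    simp only [add_mul]; exact (i1 t ht).add (i2 t ht)
  have H := hasDerivAt_integral_twice (μ := volume) (bound := bound) one_pos hF
    (F' := fun t y => (V y + (Real.log (q t y) + 1)) * pathDensityDeriv ε μ (gradient ψ) t y)
    (F'' := fun t y => (V y + (Real.log (q t y) + 1)) * pathDensityDeriv₂ ε μ (gradient ψ) t y +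
      pathDensityDeriv ε μ (gradient ψ) t y ^ 2 / q t y)
    (Eventually.of_forall fun y t ht => by
      have hd := (hder y t ht).1
      refine ((((hd.log (hq0 t y)).const_add (V y))).mul hd).congr_deriv ?_
      have := hq0 t y
      field_simp
      ring)
    (Eventually.of_forall fun y t ht => by
      have hd := (hder y t ht).1
      have hd2 := (hder y t ht).2.1
      refine (((((hd.log (hq0 t y)).add_const 1).const_add (V y))).mul hd2).congr_deriv ?_
      have := hq0 t y
      field_simp
      ring)
    (Eventually.of_forall fun y t ht => (hb y t ht).2.2.1)
    (Eventually.of_forall fun y t ht => (hb y t ht).2.2.2.2.2.2.2) hbi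
  refine ⟨_, ?_, ?_, H.2⟩
  · filter_upwards [Metric.ball_mem_nhds (0 : ℝ) one_pos] with t ht
    have hprob : IsProbabilityMeasure (transportPath μ ψ t) :=
      Measure.isProbabilityMeasure_map (by fun_prop)
    have hmd : mollifiedDensity ε (transportPath μ ψ t) = q t :=
      funext fun y => mollifiedDensity_transportPath hv ε μ t y
    have j1 : Integrable V (mollify ε (transportPath μ ψ t)) := by
      rw [integrable_mollify_iff hε, hmd]; exact i1 t ht
    have j2 : Integrable (fun y => Real.log (mollifiedDensity ε (transportPath μ ψ t) y))
        (mollify ε (transportPath μ ψ t)) := by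
      rw [integrable_mollify_iff hε, hmd]; exact i2 t ht
    rw [mollifiedRelEntropy, if_pos ⟨j1, j2⟩, integral_mollify hε, integral_mollify hε, hmd,
      ← integral_add (i1 t ht) (i2 t ht)]
    simp only [add_mul]
  · filter_upwards [Metric.ball_mem_nhds (0 : ℝ) one_pos] with t ht
    exact (H.1 t ht).2.2.1.differentiableAt

end FixedScale

/-! ### Regularity and support of gradients and Hessians; derivatives along lines -/

section GradientRegularity

variable {d : ℕ}

theorem gradient_eq_toDual_symm_comp (f : EuclideanSpace ℝ (Fin d) → ℝ) :
    gradient f = fun x => (InnerProductSpace.toDual ℝ (EuclideanSpace ℝ (Fin d))).symm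
      (fderiv ℝ f x) := rfl

theorem contDiff_gradient {f : EuclideanSpace ℝ (Fin d) → ℝ} {m n : WithTop ℕ∞}
    (hf : ContDiff ℝ n f) (hmn : m + 1 ≤ n) : ContDiff ℝ m (gradient f) := by
  rw [gradient_eq_toDual_symm_comp]
  exact (InnerProductSpace.toDual ℝ (EuclideanSpace ℝ (Fin d))).symm.contDiff.comp
    (hf.fderiv_right hmn)

theorem hasCompactSupport_gradient {f : EuclideanSpace ℝ (Fin d) → ℝ} (hf : HasCompactSupport f) :
    HasCompactSupport (gradient f) := by
  rw [gradient_eq_toDual_symm_comp]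
  exact (hf.fderiv (𝕜 := ℝ)).comp_left (map_zero _)

theorem continuous_hessianOp {f : EuclideanSpace ℝ (Fin d) → ℝ} (hf : ContDiff ℝ 2 f) :
    Continuous (hessianOp f) :=
  (contDiff_gradient (m := 1) hf (by norm_num)).continuous_fderiv one_ne_zero

theorem hasCompactSupport_hessianOp {f : EuclideanSpace ℝ (Fin d) → ℝ}
    (hf : HasCompactSupport f) : HasCompactSupport (hessianOp f) :=
  (hasCompactSupport_gradient hf).fderiv (𝕜 := ℝ)

theorem hasDerivAt_comp_line {f : EuclideanSpace ℝ (Fin d) → ℝ} (hf : ContDiff ℝ 1 f)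
    (x w : EuclideanSpace ℝ (Fin d)) (t : ℝ) :
    HasDerivAt (fun t : ℝ => f (x + t • w)) (inner ℝ (gradient f (x + t • w)) w) t := by
  have h1 : HasDerivAt (fun t : ℝ => x + t • w) w t := by
    simpa using ((hasDerivAt_id t).smul_const w).const_add x
  have h2 := (hf.differentiable one_ne_zero (x + t • w)).hasFDerivAt.comp_hasDerivAt t h1
  rw [inner_gradient_left]
  exact h2

theorem hasDerivAt_inner_gradient_comp_line {f : EuclideanSpace ℝ (Fin d) → ℝ}
    (hf : ContDiff ℝ 2 f) (x w : EuclideanSpace ℝ (Fin d)) (t : ℝ) :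
    HasDerivAt (fun t : ℝ => (inner ℝ (gradient f (x + t • w)) w : ℝ))
      (inner ℝ (hessianOp f (x + t • w) w) w) t := by
  have h1 : HasDerivAt (fun t : ℝ => x + t • w) w t := by
    simpa using ((hasDerivAt_id t).smul_const w).const_add x
  have h2 := ((contDiff_gradient (m := 1) hf (by norm_num)).differentiable one_ne_zero
    (x + t • w)).hasFDerivAt.comp_hasDerivAt t h1
  refine (h2.inner ℝ (hasDerivAt_const t w)).congr_deriv ?_
  rw [inner_zero_right, zero_add]
  rfl

end GradientRegularity

/-! ### Integration by parts against the Gaussian kernel -/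

section KernelIntegrationByParts

variable {d : ℕ}

/-- Moving y along w is the time displacement with velocity -w, so the space derivatives are read
off the time derivatives at t = 0. -/
theorem hasLineDerivAt_gaussianKernel_sub (ε : ℝ) (x w y : EuclideanSpace ℝ (Fin d)) :
    HasLineDerivAt ℝ (fun y => gaussianKernel ε (y - x))
      (-(gaussianKernel ε (y - x) * (inner ℝ (y - x) w / ε ^ 2))) y w := by
  have h := hasDerivAt_gaussianKernel_line ε (y - x) (-w) 0
  simp only [smul_neg, sub_neg_eq_add, zero_smul, add_zero, inner_neg_right] at h
  refine HasDerivAt.congr_deriv (f := fun t : ℝ => gaussianKernel ε (y + t • w - x)) ?_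
    (by ring : gaussianKernel ε (y - x) * (-inner ℝ (y - x) w / ε ^ 2) = _)
  simpa only [add_sub_right_comm] using h

theorem hasLineDerivAt_gaussianKernel_sub_twice (ε : ℝ) (x w y : EuclideanSpace ℝ (Fin d)) :
    HasLineDerivAt ℝ (fun y => gaussianKernel ε (y - x) * (inner ℝ (y - x) w / ε ^ 2))
      (-(gaussianKernel ε (y - x) * ((inner ℝ (y - x) w / ε ^ 2) ^ 2 - ‖w‖ ^ 2 / ε ^ 2))) y w := by
  have h := (hasDerivAt_gaussianKernel_line_twice ε (y - x) (-w) 0).neg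
  simp only [smul_neg, sub_neg_eq_add, zero_smul, add_zero, inner_neg_right, norm_neg] at h
  refine HasDerivAt.congr_deriv (f := fun t : ℝ => gaussianKernel ε (y + t • w - x) *
    (inner ℝ (y + t • w - x) w / ε ^ 2)) ?_
    (by ring : -(gaussianKernel ε (y - x) * ((-inner ℝ (y - x) w / ε ^ 2) ^ 2 -
      ‖w‖ ^ 2 / ε ^ 2)) = _)
  simp only [add_sub_right_comm]
  refine h.congr_of_eventuallyEq (Eventually.of_forall fun t => ?_)
  simp only [Pi.neg_apply]
  ring

theorem integral_mul_gaussianKernel_deriv {g g' : EuclideanSpace ℝ (Fin d) → ℝ} {ε : ℝ}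
    (x w : EuclideanSpace ℝ (Fin d)) (hg : ∀ y, HasLineDerivAt ℝ g (g' y) y w)
    (h0 : Integrable fun y => g y * gaussianKernel ε (y - x))
    (h1 : Integrable fun y => g y * (gaussianKernel ε (y - x) * (inner ℝ (y - x) w / ε ^ 2)))
    (h2 : Integrable fun y => g' y * gaussianKernel ε (y - x)) :
    ∫ y, g y * (gaussianKernel ε (y - x) * (inner ℝ (y - x) w / ε ^ 2)) =
      ∫ y, g' y * gaussianKernel ε (y - x) := by
  have h := integral_bilinear_hasLineDerivAt_right_eq_neg_left_of_integrable
    (μ := (volume : Measure (EuclideanSpace ℝ (Fin d)))) (B := ContinuousLinearMap.mul ℝ ℝ)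
    (f := g) (f' := g') (v := w) h2
    (by simp only [ContinuousLinearMap.mul_apply', mul_neg]; exact h1.neg) h0 (fun y _ => hg y)
    (fun y _ => hasLineDerivAt_gaussianKernel_sub ε x w y)
  simp only [ContinuousLinearMap.mul_apply', mul_neg, integral_neg] at h
  linarith

theorem integral_mul_gaussianKernel_deriv₂ {g g' : EuclideanSpace ℝ (Fin d) → ℝ} {ε : ℝ}
    (x w : EuclideanSpace ℝ (Fin d)) (hg : ∀ y, HasLineDerivAt ℝ g (g' y) y w)
    (h0 : Integrable fun y => g y * (gaussianKernel ε (y - x) * (inner ℝ (y - x) w / ε ^ 2)))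
    (h1 : Integrable fun y => g y * (gaussianKernel ε (y - x) *
      ((inner ℝ (y - x) w / ε ^ 2) ^ 2 - ‖w‖ ^ 2 / ε ^ 2)))
    (h2 : Integrable fun y => g' y * (gaussianKernel ε (y - x) * (inner ℝ (y - x) w / ε ^ 2))) :
    ∫ y, g y * (gaussianKernel ε (y - x) * ((inner ℝ (y - x) w / ε ^ 2) ^ 2 - ‖w‖ ^ 2 / ε ^ 2)) =
      ∫ y, g' y * (gaussianKernel ε (y - x) * (inner ℝ (y - x) w / ε ^ 2)) := by
  have h := integral_bilinear_hasLineDerivAt_right_eq_neg_left_of_integrable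
    (μ := (volume : Measure (EuclideanSpace ℝ (Fin d)))) (B := ContinuousLinearMap.mul ℝ ℝ)
    (f := g) (f' := g') (v := w) h2
    (by simp only [ContinuousLinearMap.mul_apply', mul_neg]; exact h1.neg) h0 (fun y _ => hg y)
    (fun y _ => hasLineDerivAt_gaussianKernel_sub_twice ε x w y)
  simp only [ContinuousLinearMap.mul_apply', mul_neg, integral_neg] at h
  linarith

/-- Moving two derivatives from the Gaussian kernel to a compactly supported function. -/
theorem integral_mul_gaussianKernel_hessian {W : EuclideanSpace ℝ (Fin d) → ℝ}
    (hW : ContDiff ℝ 2 W) (hWc : HasCompactSupport W) (ε : ℝ) (x w : EuclideanSpace ℝ (Fin d)) :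
    ∫ y, W y * (gaussianKernel ε (y - x) * ((inner ℝ (y - x) w / ε ^ 2) ^ 2 - ‖w‖ ^ 2 / ε ^ 2)) =
      ∫ y, inner ℝ (hessianOp W y w) w * gaussianKernel ε (y - x) := by
  have hk := continuous_gaussianKernel (d := d) ε
  have hg : Continuous (gradient W) := (contDiff_gradient (m := 1) hW (by norm_num)).continuous
  have hh := continuous_hessianOp hW
  have c1 : HasCompactSupport (fun y => (inner ℝ (gradient W y) w : ℝ)) :=
    (hasCompactSupport_gradient hWc).mono fun y hy h0 => hy (by simp only [h0, inner_zero_left])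
  have c2 : HasCompactSupport (fun y => (inner ℝ (hessianOp W y w) w : ℝ)) :=
    (hasCompactSupport_hessianOp hWc).mono fun y hy h0 => hy (by
      simp only [h0, zero_apply, inner_zero_left])
  have l1 : ∀ y, HasLineDerivAt ℝ W (inner ℝ (gradient W y) w) y w := fun y => by
    simpa [HasLineDerivAt] using hasDerivAt_comp_line (hW.of_le (by norm_num)) y w 0
  have l2 : ∀ y, HasLineDerivAt ℝ (fun y => (inner ℝ (gradient W y) w : ℝ))
      (inner ℝ (hessianOp W y w) w) y w := fun y => by
    simpa [HasLineDerivAt] using hasDerivAt_inner_gradient_comp_line hW y w 0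
  have hWcont := hW.continuous
  have i1 : Integrable fun y =>
      W y * (gaussianKernel ε (y - x) * (inner ℝ (y - x) w / ε ^ 2)) :=
    Continuous.integrable_of_hasCompactSupport (by fun_prop) hWc.mul_right
  have i2 : Integrable fun y => W y * (gaussianKernel ε (y - x) *
      ((inner ℝ (y - x) w / ε ^ 2) ^ 2 - ‖w‖ ^ 2 / ε ^ 2)) :=
    Continuous.integrable_of_hasCompactSupport (by fun_prop) hWc.mul_right
  have i3 : Integrable fun y => (inner ℝ (gradient W y) w : ℝ) *
      (gaussianKernel ε (y - x) * (inner ℝ (y - x) w / ε ^ 2)) :=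
    Continuous.integrable_of_hasCompactSupport (by fun_prop) c1.mul_right
  have i4 : Integrable fun y => (inner ℝ (gradient W y) w : ℝ) * gaussianKernel ε (y - x) :=
    Continuous.integrable_of_hasCompactSupport (by fun_prop) c1.mul_right
  have i5 : Integrable fun y => (inner ℝ (hessianOp W y w) w : ℝ) * gaussianKernel ε (y - x) :=
    Continuous.integrable_of_hasCompactSupport (by fun_prop) c2.mul_right
  rw [integral_mul_gaussianKernel_deriv₂ x w l1 i1 i2 i3,
    integral_mul_gaussianKernel_deriv x w l2 i4 i3 i5]

end KernelIntegrationByParts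

/-! ### Gaussian kernels as an approximate identity -/

section ApproximateIdentity

variable {d : ℕ} {μ : Measure (EuclideanSpace ℝ (Fin d))}

theorem integral_mul_gaussianKernel_sub {ε : ℝ} (hε : 0 < ε) (x : EuclideanSpace ℝ (Fin d))
    (g : EuclideanSpace ℝ (Fin d) → ℝ) :
    ∫ y, g y * gaussianKernel ε (y - x) = ∫ z, g (x + ε • z) * gaussianKernel 1 z := by
  rw [← integral_gaussianKernel_mul_comp hε x (fun z => g (x + ε • z))]
  simp [smul_smul, mul_inv_cancel₀ hε.ne']

/-- The Gaussian kernels are an approximate identity. -/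
theorem tendsto_integral_integral_mul_gaussianKernel [IsFiniteMeasure μ]
    {G : EuclideanSpace ℝ (Fin d) → EuclideanSpace ℝ (Fin d) → ℝ}
    (hG : Continuous (Function.uncurry G)) {B : ℝ} (hB : ∀ x y, |G x y| ≤ B) :
    Tendsto (fun ε => ∫ x, ∫ y, G x y * gaussianKernel ε (y - x) ∂volume ∂μ) (𝓝[>] 0)
      (𝓝 (∫ x, G x x ∂μ)) := by
  have hk := continuous_gaussianKernel (d := d) 1
  have hki := integrable_gaussianKernel (d := d) one_pos
  have hkb : Integrable (fun z : EuclideanSpace ℝ (Fin d) => B * gaussianKernel 1 z) :=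
    hki.const_mul B
  have hbd : ∀ (x z : EuclideanSpace ℝ (Fin d)) (ε : ℝ),
      ‖G x (x + ε • z) * gaussianKernel 1 z‖ ≤ B * gaussianKernel 1 z := fun x z ε => by
    rw [norm_mul, Real.norm_of_nonneg (gaussianKernel_pos one_pos z).le]
    exact mul_le_mul_of_nonneg_right (hB _ _) (gaussianKernel_pos one_pos z).le
  have hcz : ∀ x (ε : ℝ), Continuous fun z => G x (x + ε • z) := fun x ε =>
    hG.comp (by fun_prop : Continuous fun z => (x, x + ε • z))
  have hin : ∀ x, Tendsto (fun ε : ℝ => ∫ z, G x (x + ε • z) * gaussianKernel 1 z) (𝓝[>] 0)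
      (𝓝 (G x x)) := fun x => by
    have e : G x x = ∫ z : EuclideanSpace ℝ (Fin d), G x (x + (0 : ℝ) • z) * gaussianKernel 1 z := by
      simp only [zero_smul, add_zero]
      rw [integral_const_mul, integral_gaussianKernel one_pos, mul_one]
    rw [e]
    refine tendsto_integral_filter_of_dominated_convergence _
      (Eventually.of_forall fun ε => ((hcz x ε).mul hk).aestronglyMeasurable)
      (Eventually.of_forall fun ε => Eventually.of_forall fun z => hbd x z ε) hkb
      (Eventually.of_forall fun z => ?_)
    have : Continuous fun ε : ℝ => G x (x + ε • z) * gaussianKernel 1 z :=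
      (hG.comp (by fun_prop : Continuous fun ε : ℝ => (x, x + ε • z))).mul_const _
    exact (this.tendsto 0).mono_left nhdsWithin_le_nhds
  have hout : Tendsto (fun ε : ℝ => ∫ x, ∫ z, G x (x + ε • z) * gaussianKernel 1 z ∂volume ∂μ)
      (𝓝[>] 0) (𝓝 (∫ x, G x x ∂μ)) := by
    refine tendsto_integral_filter_of_dominated_convergence (fun _ => B)
      (Eventually.of_forall fun ε => ?_) (Eventually.of_forall fun ε =>
        Eventually.of_forall fun x => ?_) (integrable_const _) (Eventually.of_forall hin)
    · refine (continuous_of_dominated (bound := fun z => B * gaussianKernel 1 z)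
        (fun x => ((hcz x ε).mul hk).aestronglyMeasurable)
        (fun x => Eventually.of_forall fun z => hbd x z ε) hkb
        (Eventually.of_forall fun z => ?_)).aestronglyMeasurable
      exact (hG.comp (by fun_prop : Continuous fun x => (x, x + ε • z))).mul_const _
    · refine (norm_integral_le_of_norm_le hkb (Eventually.of_forall fun z => hbd x z ε)).trans_eq ?_
      rw [integral_const_mul, integral_gaussianKernel one_pos, mul_one]
  -- The substitution y = x + ε z moves all ε-dependence into a bounded continuous function, against
  -- a fixed Gaussian weight.
  refine hout.congr' ?_
  filter_upwards [self_mem_nhdsWithin] with ε hε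
  simp only [fun x => integral_mul_gaussianKernel_sub (Set.mem_Ioi.1 hε) x (G x)]

end ApproximateIdentity

/-! ### The potential term: derivatives on the potential, and decay away from the diagonal -/

section PotentialLimit

variable {d : ℕ} {μ : Measure (EuclideanSpace ℝ (Fin d))}

theorem pathDensityDeriv₂_zero (ε : ℝ) (v : EuclideanSpace ℝ (Fin d) → EuclideanSpace ℝ (Fin d))
    (y : EuclideanSpace ℝ (Fin d)) :
    pathDensityDeriv₂ ε μ v 0 y = ∫ x, gaussianKernel ε (y - x) *
      ((inner ℝ (y - x) (v x) / ε ^ 2) ^ 2 - ‖v x‖ ^ 2 / ε ^ 2) ∂μ := by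
  simp [pathDensityDeriv₂]

/-- After Fubini the velocity v(x) is a constant vector for the inner integral in y; hence both
derivatives fall on W alone and no derivative of v appears. -/
theorem integral_mul_pathDensityDeriv₂ [IsProbabilityMeasure μ]
    {W : EuclideanSpace ℝ (Fin d) → ℝ} (hW : ContDiff ℝ 2 W) (hWc : HasCompactSupport W)
    {ε : ℝ} (hε : 0 < ε) {v : EuclideanSpace ℝ (Fin d) → EuclideanSpace ℝ (Fin d)}
    (hv : Continuous v) {M : ℝ} (hM : ∀ x, ‖v x‖ ≤ M) :
    ∫ y, W y * pathDensityDeriv₂ ε μ v 0 y =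
      ∫ x, ∫ y, inner ℝ (hessianOp W y (v x)) (v x) * gaussianKernel ε (y - x) ∂volume ∂μ := by
  have hk := continuous_gaussianKernel (d := d) ε
  have hWcont := hW.continuous
  obtain ⟨B, hB⟩ := hWc.exists_bound_of_continuous hWcont
  obtain ⟨C, hC, hb⟩ := gaussianKernel_path_bounds (d := d) hε (lt_add_one ε)
    ((norm_nonneg _).trans (hM 0))
  have hB0 : 0 ≤ B := (norm_nonneg _).trans (hB 0)
  have hi : Integrable (Function.uncurry fun y x => W y * (gaussianKernel ε (y - x) *
      ((inner ℝ (y - x) (v x) / ε ^ 2) ^ 2 - ‖v x‖ ^ 2 / ε ^ 2))) (volume.prod μ) := by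
    refine (integrable_mul_kernel_of_integrable (integrable_const (μ := μ) (B * C))
      (integrable_gaussianKernel (d := d) (by linarith : 0 < ε + 1))).mono'
      (Continuous.aestronglyMeasurable (by unfold Function.uncurry; fun_prop))
      (Eventually.of_forall fun p => ?_)
    have h4 := (hb (p.1 - p.2) (v p.2) (hM _) 0 (by simp)).2.2.2
    simp only [zero_smul, sub_zero] at h4
    simp only [Function.uncurry, mul_assoc B C]
    rw [norm_mul]
    exact mul_le_mul (hB _) h4 (norm_nonneg _) hB0
  simp only [pathDensityDeriv₂_zero, ← integral_const_mul]
  rw [integral_integral_swap hi]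
  simp only [integral_mul_gaussianKernel_hessian hW hWc]

/-- Away from the diagonal the second derivative of the kernel is small. -/
theorem gaussianKernel_second_deriv_far {ε₀ : ℝ} (hε₀ : 0 < ε₀) (M : ℝ) :
    ∃ C : ℝ, 0 ≤ C ∧ ∀ ε, 0 < ε → ε ≤ 1 → ε ≤ ε₀ / 2 → ∀ u w : EuclideanSpace ℝ (Fin d), ‖w‖ ≤ M →
      1 ≤ ‖u‖ → |gaussianKernel ε u * ((inner ℝ u w / ε ^ 2) ^ 2 - ‖w‖ ^ 2 / ε ^ 2)| ≤
        C * ε * gaussianKernel ε₀ u := by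
  set Z := ∫ y : EuclideanSpace ℝ (Fin d), Real.exp (-(1 / (2 * 1 ^ 2)) * ‖y‖ ^ 2) with hZd
  have hZ : 0 < Z := gaussianMass_pos one_pos
  -- Powers of a = ‖u‖/ε: d for the normalization ε^{-d}, 4 for the second-derivative prefactor, and
  -- one more to trade for the gain ε, since a ε = ‖u‖ ≥ 1.
  set D := ((d + 5).factorial : ℝ) * Real.exp (1 + 1 / (4 * (1 / 4)))
  refine ⟨2 * M ^ 2 * D * ε₀ ^ d, by positivity, fun ε hε hε1 hε2 u w hw hu => ?_⟩
  have hk := gaussianKernel_pos hε u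
  set a := ‖u‖ / ε with ha
  have hau : ‖u‖ = a * ε := by rw [ha]; field_simp
  have ha1 : 1 / ε ≤ a := by rw [ha]; gcongr
  have ha0 : 1 ≤ a := le_trans (by rw [le_div_iff₀ hε]; linarith) ha1
  have hapos : 0 < a := by linarith
  have hexp := one_add_pow_mul_exp_le (c := 1 / 4) (by norm_num) (d + 5) hapos.le
  have hpow : a ^ (d + 5) * Real.exp (-(1 / 4) * a ^ 2) ≤ D :=
    le_trans (by gcongr; linarith) hexp
  have hmain : a ^ (d + 4) * Real.exp (-(1 / 4) * a ^ 2) ≤ D * ε := by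
    have h1 : 1 ≤ a * ε := by rwa [← hau]
    calc a ^ (d + 4) * Real.exp (-(1 / 4) * a ^ 2)
        ≤ a ^ (d + 4) * Real.exp (-(1 / 4) * a ^ 2) * (a * ε) :=
          le_mul_of_one_le_right (by positivity) h1
      _ = a ^ (d + 5) * Real.exp (-(1 / 4) * a ^ 2) * ε := by ring
      _ ≤ D * ε := by gcongr
  have hin : |(inner ℝ u w / ε ^ 2) ^ 2 - ‖w‖ ^ 2 / ε ^ 2| ≤ 2 * M ^ 2 * a ^ 4 := by
    have i1 : |(inner ℝ u w : ℝ)| ≤ a * ε * M := by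
      refine (abs_real_inner_le_norm u w).trans ?_
      rw [hau]; gcongr
    have i2 : (inner ℝ u w / ε ^ 2) ^ 2 ≤ M ^ 2 * a ^ 4 := by
      have hie : 1 / ε ^ 2 ≤ a ^ 2 := by
        calc 1 / ε ^ 2 = (1 / ε) ^ 2 := by ring
          _ ≤ a ^ 2 := by gcongr
      calc (inner ℝ u w / ε ^ 2) ^ 2 = |inner ℝ u w| ^ 2 / ε ^ 4 := by rw [div_pow, sq_abs]; ring
        _ ≤ (a * ε * M) ^ 2 / ε ^ 4 := by gcongr
        _ = M ^ 2 * a ^ 2 * (1 / ε ^ 2) := by field_simp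
        _ ≤ M ^ 2 * a ^ 2 * a ^ 2 := by gcongr
        _ = _ := by ring
    have i3 : ‖w‖ ^ 2 / ε ^ 2 ≤ M ^ 2 * a ^ 4 := by
      have hie : 1 / ε ^ 2 ≤ a ^ 2 := by
        calc 1 / ε ^ 2 = (1 / ε) ^ 2 := by ring
          _ ≤ a ^ 2 := by gcongr
      calc ‖w‖ ^ 2 / ε ^ 2 = ‖w‖ ^ 2 * (1 / ε ^ 2) := by ring
        _ ≤ M ^ 2 * a ^ 4 := by
          gcongr
          calc 1 / ε ^ 2 ≤ a ^ 2 := hie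
            _ ≤ a ^ 4 := pow_le_pow_right₀ ha0 (by norm_num)
    exact abs_le.2 ⟨by nlinarith [sq_nonneg (inner ℝ u w / ε ^ 2)],
      by nlinarith [(by positivity : 0 ≤ ‖w‖ ^ 2 / ε ^ 2)]⟩
  have hnorm : ‖ε⁻¹ • u‖ = a := by
    rw [norm_smul, Real.norm_of_nonneg (by positivity), ha]; ring
  have hker : gaussianKernel ε u ≤ a ^ d * Z⁻¹ * (Real.exp (-(1 / 4) * a ^ 2) *
      Real.exp (-(1 / (2 * 1 ^ 2)) * ‖ε₀⁻¹ • u‖ ^ 2)) := by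
    rw [gaussianKernel_scale hε, gaussianKernel_eq, ← hZd, hnorm, ← mul_assoc]
    have e1 : (ε ^ d)⁻¹ ≤ a ^ d := by
      rw [← inv_pow]; gcongr; rwa [← one_div]
    have e2 : Real.exp (-(1 / (2 * 1 ^ 2)) * a ^ 2) ≤ Real.exp (-(1 / 4) * a ^ 2) *
      Real.exp (-(1 / (2 * 1 ^ 2)) * ‖ε₀⁻¹ • u‖ ^ 2) := by
      rw [← Real.exp_add]
      refine Real.exp_le_exp.2 ?_
      -- The condition ε ≤ ε₀/2 makes the Gaussian at scale ε₀ cost at most a²/8 of the exponent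
      -- a²/2, while a²/4 is reserved for the powers of a.
      have e3 : ‖ε₀⁻¹ • u‖ ≤ a / 2 := by
        rw [norm_smul, Real.norm_of_nonneg (by positivity), hau, inv_mul_le_iff₀ hε₀]
        nlinarith
      have e4 : ‖ε₀⁻¹ • u‖ ^ 2 ≤ (a / 2) ^ 2 := by gcongr
      nlinarith
    gcongr
  rw [abs_mul, abs_of_pos hk, gaussianKernel_scale hε₀, gaussianKernel_eq 1, ← hZd]
  calc gaussianKernel ε u * |(inner ℝ u w / ε ^ 2) ^ 2 - ‖w‖ ^ 2 / ε ^ 2|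
      ≤ a ^ d * Z⁻¹ * (Real.exp (-(1 / 4) * a ^ 2) *
      Real.exp (-(1 / (2 * 1 ^ 2)) * ‖ε₀⁻¹ • u‖ ^ 2)) * (2 * M ^ 2 * a ^ 4) := by gcongr
    _ = 2 * M ^ 2 * (a ^ (d + 4) * Real.exp (-(1 / 4) * a ^ 2)) *
        (Z⁻¹ * Real.exp (-(1 / (2 * 1 ^ 2)) * ‖ε₀⁻¹ • u‖ ^ 2)) := by ring
    _ ≤ 2 * M ^ 2 * (D * ε) * (Z⁻¹ * Real.exp (-(1 / (2 * 1 ^ 2)) * ‖ε₀⁻¹ • u‖ ^ 2)) := by gcongr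
    _ = _ := by field_simp

end PotentialLimit

/-! ### The potential term: passage to the limit -/

section PotentialLimitTheorem

variable {d : ℕ} {μ : Measure (EuclideanSpace ℝ (Fin d))}

theorem stronglyMeasurable_pathDensityDeriv₂ [IsFiniteMeasure μ] (ε t : ℝ)
    {v : EuclideanSpace ℝ (Fin d) → EuclideanSpace ℝ (Fin d)} (hv : Continuous v) :
    StronglyMeasurable (pathDensityDeriv₂ ε μ v t) := by
  have hk := continuous_gaussianKernel (d := d) ε
  refine StronglyMeasurable.integral_prod_right' (ν := μ)
    (f := fun p : EuclideanSpace ℝ (Fin d) × EuclideanSpace ℝ (Fin d) =>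
    gaussianKernel ε (p.1 - p.2 - t • v p.2) *
    ((inner ℝ (p.1 - p.2 - t • v p.2) (v p.2) / ε ^ 2) ^ 2 - ‖v p.2‖ ^ 2 / ε ^ 2)) ?_
  exact Continuous.stronglyMeasurable (by fun_prop)

theorem stronglyMeasurable_pathDensityDeriv [IsFiniteMeasure μ] (ε t : ℝ)
    {v : EuclideanSpace ℝ (Fin d) → EuclideanSpace ℝ (Fin d)} (hv : Continuous v) :
    StronglyMeasurable (pathDensityDeriv ε μ v t) := by
  have hk := continuous_gaussianKernel (d := d) ε
  refine StronglyMeasurable.integral_prod_right' (ν := μ)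
    (f := fun p : EuclideanSpace ℝ (Fin d) × EuclideanSpace ℝ (Fin d) =>
    gaussianKernel ε (p.1 - p.2 - t • v p.2) *
    (inner ℝ (p.1 - p.2 - t • v p.2) (v p.2) / ε ^ 2)) ?_
  exact Continuous.stronglyMeasurable (by fun_prop)

theorem hessianOp_congr {f g : EuclideanSpace ℝ (Fin d) → ℝ} {x : EuclideanSpace ℝ (Fin d)}
    (h : f =ᶠ[𝓝 x] g) : hessianOp f x = hessianOp g x :=
  h.gradient.fderiv_eq

/-- Nothing is known about the growth of the derivatives of V, so integration by parts is used only
for a truncation W. The rest V - W vanishes within distance 1 of the support of v, where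
off-diagonal decay is not available; elsewhere it is at most |V|, and the decay factor C ε k_{ε₀}
meets the integrability of V at scale ε₀. -/
theorem tendsto_integral_potential_mul_pathDensityDeriv₂ [IsProbabilityMeasure μ]
    {V : EuclideanSpace ℝ (Fin d) → ℝ} (hV : ContDiff ℝ 2 V) {ε₀ : ℝ} (hε₀ : 0 < ε₀)
    (hVε₀ : Integrable V (mollify ε₀ μ))
    {v : EuclideanSpace ℝ (Fin d) → EuclideanSpace ℝ (Fin d)} (hv : Continuous v)
    (hvc : HasCompactSupport v) :
    Tendsto (fun ε => ∫ y, V y * pathDensityDeriv₂ ε μ v 0 y) (𝓝[>] 0)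
      (𝓝 (∫ x, inner ℝ (hessianOp V x (v x)) (v x) ∂μ)) := by
  obtain ⟨M, hM⟩ := hvc.exists_bound_of_continuous hv
  have hM0 : 0 ≤ M := (norm_nonneg _).trans (hM 0)
  obtain ⟨R, hR0, hR⟩ : ∃ R : ℝ, 0 < R ∧ ∀ x, v x ≠ 0 → ‖x‖ ≤ R := by
    obtain ⟨R, hR⟩ := hvc.isCompact.isBounded.exists_norm_le
    exact ⟨max R 1, by positivity, fun x hx => (hR x (subset_tsupport v hx)).trans (le_max_left _ _)⟩
  -- The inner radius R + 1 gives both needs: W = V on a unit ball around each point where v ≠ 0,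
  -- and ‖y - x‖ ≥ 1 for such x when W may differ from V at y.
  let χ : ContDiffBump (0 : EuclideanSpace ℝ (Fin d)) := ⟨R + 1, R + 2, by linarith, by linarith⟩
  have hχ1 : ∀ y, ‖y‖ ≤ R + 1 → χ y = 1 := fun y hy =>
    χ.one_of_mem_closedBall (by simpa using hy)
  set W : EuclideanSpace ℝ (Fin d) → ℝ := fun y => V y * χ y with hWdef
  have hW : ContDiff ℝ 2 W := hV.mul χ.contDiff
  have hWc : HasCompactSupport W := χ.hasCompactSupport.mul_left
  obtain ⟨C, hC, hfar⟩ := gaussianKernel_second_deriv_far (d := d) hε₀ M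
  have hVQ := (integrable_mollify_iff (μ := μ) hε₀).1 hVε₀
  have hq2m : ∀ ε, AEStronglyMeasurable (pathDensityDeriv₂ ε μ v 0) volume := fun ε =>
    (stronglyMeasurable_pathDensityDeriv₂ ε 0 hv).aestronglyMeasurable
  have hsmall : ∀ᶠ ε : ℝ in 𝓝[>] 0, 0 < ε ∧ ε ≤ 1 ∧ ε ≤ ε₀ / 2 := by
    have : ∀ᶠ ε : ℝ in 𝓝[>] 0, ε ∈ Ioo 0 (min 1 (ε₀ / 2)) :=
      Ioo_mem_nhdsGT (by positivity)
    filter_upwards [this] with ε hε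
    exact ⟨hε.1, hε.2.le.trans (min_le_left _ _), hε.2.le.trans (min_le_right _ _)⟩
  -- the part of the potential near the support of `v`
  have hnear : Tendsto (fun ε => ∫ y, W y * pathDensityDeriv₂ ε μ v 0 y) (𝓝[>] 0)
      (𝓝 (∫ x, inner ℝ (hessianOp V x (v x)) (v x) ∂μ)) := by
    have hhc := continuous_hessianOp hW
    obtain ⟨B, hB⟩ := (hasCompactSupport_hessianOp hWc).exists_bound_of_continuous hhc
    have hlim := tendsto_integral_integral_mul_gaussianKernel (μ := μ)
      (G := fun x y => inner ℝ (hessianOp W y (v x)) (v x)) (B := B * M * M)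
      (by unfold Function.uncurry; fun_prop) (fun x y => by
        refine (abs_real_inner_le_norm _ _).trans ?_
        have h1 : ‖hessianOp W y (v x)‖ ≤ B * M :=
          ((hessianOp W y).le_opNorm (v x)).trans (mul_le_mul (hB y) (hM x) (norm_nonneg _)
            ((norm_nonneg _).trans (hB y)))
        exact mul_le_mul h1 (hM x) (norm_nonneg _) ((norm_nonneg _).trans h1))
    have e : ∀ x, (inner ℝ (hessianOp W x (v x)) (v x) : ℝ) =
        inner ℝ (hessianOp V x (v x)) (v x) := fun x => by
      by_cases hx : v x = 0
      · simp [hx]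
      · have : W =ᶠ[𝓝 x] V := by
          have hxR := hR x hx
          filter_upwards [Metric.ball_mem_nhds x one_pos] with y hy
          have h1 : ‖y - x‖ < 1 := by simpa [dist_eq_norm] using hy
          have h2 : ‖y‖ ≤ R + 1 := by
            have : ‖y‖ ≤ ‖y - x‖ + ‖x‖ := by simpa using norm_add_le (y - x) x
            linarith
          simp [hWdef, hχ1 y h2]
        rw [hessianOp_congr this]
    simp only [e] at hlim
    refine hlim.congr' ?_
    filter_upwards [self_mem_nhdsWithin] with ε hε
    exact (integral_mul_pathDensityDeriv₂ hW hWc (Set.mem_Ioi.1 hε) hv hM).symm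
  -- the part of the potential away from the support of `v`
  have hbd : ∀ ε, 0 < ε → ε ≤ 1 → ε ≤ ε₀ / 2 → ∀ y,
      |(V y - W y) * pathDensityDeriv₂ ε μ v 0 y| ≤ C * ε * |V y * mollifiedDensity ε₀ μ y| := by
    intro ε hε h1 h2 y
    by_cases hy : ‖y‖ ≤ R + 1
    · have : V y - W y = 0 := by simp [hWdef, hχ1 y hy]
      rw [this, zero_mul, abs_zero]; positivity
    push Not at hy
    have hVW : |V y - W y| ≤ |V y| := by
      have : V y - W y = V y * (1 - χ y) := by simp only [hWdef]; ring
      rw [this, abs_mul]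
      refine mul_le_of_le_one_right (abs_nonneg _) (abs_le.2 ⟨?_, ?_⟩)
      · linarith [χ.le_one (x := y)]
      · linarith [χ.nonneg (x := y)]
    have hq2 : |pathDensityDeriv₂ ε μ v 0 y| ≤ C * ε * mollifiedDensity ε₀ μ y := by
      rw [pathDensityDeriv₂_zero, mollifiedDensity, ← integral_const_mul]
      refine abs_integral_le_of_abs_le ((integrable_gaussianKernel_sub hε₀ y).const_mul _)
        fun x => ?_
      by_cases hx : v x = 0
      · have := gaussianKernel_pos hε₀ (y - x)
        simp only [hx, inner_zero_right, norm_zero]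
        norm_num
        positivity
      · refine hfar ε hε h1 h2 (y - x) (v x) (hM x) ?_
        have h3 : ‖y‖ ≤ ‖y - x‖ + ‖x‖ := by simpa using norm_add_le (y - x) x
        linarith [hR x hx]
    rw [abs_mul, abs_mul, abs_of_nonneg (mollifiedDensity_nonneg hε₀ y)]
    calc |V y - W y| * |pathDensityDeriv₂ ε μ v 0 y|
        ≤ |V y| * (C * ε * mollifiedDensity ε₀ μ y) := by gcongr
      _ = _ := by ring
  have hfar0 : Tendsto (fun ε => ∫ y, (V y - W y) * pathDensityDeriv₂ ε μ v 0 y) (𝓝[>] 0)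
      (𝓝 0) := by
    have hz : Tendsto (fun ε : ℝ => C * ε * ∫ y, |V y * mollifiedDensity ε₀ μ y|) (𝓝[>] 0)
        (𝓝 0) := by
      have : Continuous fun ε : ℝ => C * ε * ∫ y, |V y * mollifiedDensity ε₀ μ y| := by fun_prop
      simpa using (this.tendsto 0).mono_left nhdsWithin_le_nhds
    refine squeeze_zero_norm' ?_ hz
    filter_upwards [hsmall] with ε hε
    rw [Real.norm_eq_abs, ← integral_const_mul]
    exact abs_integral_le_of_abs_le (hVQ.abs.const_mul _) (hbd ε hε.1 hε.2.1 hε.2.2)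
  have hsum := hnear.add hfar0
  rw [add_zero] at hsum
  refine hsum.congr' ?_
  filter_upwards [hsmall] with ε hε
  obtain ⟨K, hK, hder⟩ := pathDensity_derivs (μ := μ) hε.1
    (by linarith [hε.2.2] : ε < ε₀) hv hM
  have iV : Integrable fun y => V y * pathDensityDeriv₂ ε μ v 0 y := by
    refine (hVQ.abs.const_mul K).mono' (hV.continuous.aestronglyMeasurable.mul (hq2m ε))
      (Eventually.of_forall fun y => ?_)
    rw [norm_mul, abs_mul, abs_of_nonneg (mollifiedDensity_nonneg hε₀ y), Real.norm_eq_abs,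
      Real.norm_eq_abs]
    calc |V y| * |pathDensityDeriv₂ ε μ v 0 y| ≤ |V y| * (K * mollifiedDensity ε₀ μ y) := by
          gcongr; exact (hder y 0 (by simp)).2.2.2.2.1
      _ = _ := by ring
  have iU : Integrable fun y => (V y - W y) * pathDensityDeriv₂ ε μ v 0 y :=
    (hVQ.abs.const_mul (C * ε)).mono'
      ((hV.continuous.sub hW.continuous).aestronglyMeasurable.mul (hq2m ε))
      (Eventually.of_forall (hbd ε hε.1 hε.2.1 hε.2.2))
  have iW : Integrable fun y => W y * pathDensityDeriv₂ ε μ v 0 y := by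
    refine (iV.sub iU).congr (Eventually.of_forall fun y => ?_)
    simp only [Pi.sub_apply]; ring
  rw [← integral_add iW iU]
  exact integral_congr_ae (Eventually.of_forall fun y => by simp only; ring)

end PotentialLimitTheorem

/-! ### Continuity of translations in L¹ -/

section Translation

variable {d : ℕ}

/-- Translations act continuously on `L¹`. -/
theorem tendsto_integral_abs_sub_translate {f : EuclideanSpace ℝ (Fin d) → ℝ}
    (hf : Integrable f) :
    Tendsto (fun h : EuclideanSpace ℝ (Fin d) => ∫ y, |f (y - h) - f y|) (𝓝 0) (𝓝 0) := by
  have hfm : MemLp f 1 volume := memLp_one_iff_integrable.2 hf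
  set F := hfm.toLp f
  let T : EuclideanSpace ℝ (Fin d) → C(EuclideanSpace ℝ (Fin d), EuclideanSpace ℝ (Fin d)) :=
    fun h => ⟨fun y => y - h, by fun_prop⟩
  have hT : Continuous T := ContinuousMap.continuous_of_continuous_uncurry _ (by
    simp only [T]
    exact continuous_snd.sub continuous_fst)
  have hTm : ∀ h, MeasurePreserving (T h) (volume : Measure (EuclideanSpace ℝ (Fin d))) volume :=
    fun h => measurePreserving_sub_right volume h
  have hcont : Continuous fun h => Lp.compMeasurePreserving (T h) (hTm h) F :=
    continuous_const.compMeasurePreservingLp hT hTm (by norm_num)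
  have hn : Continuous fun h => ‖Lp.compMeasurePreserving (T h) (hTm h) F - F‖ :=
    (hcont.sub continuous_const).norm
  have e : ∀ h, ‖Lp.compMeasurePreserving (T h) (hTm h) F - F‖ = ∫ y, |f (y - h) - f y| := by
    intro h
    rw [L1.norm_eq_integral_norm]
    refine integral_congr_ae ?_
    have h1 := Lp.coeFn_sub (Lp.compMeasurePreserving (T h) (hTm h) F) F
    have h2 := Lp.coeFn_compMeasurePreserving F (hTm h)
    have h3 : F =ᵐ[volume] f := hfm.coeFn_toLp
    have h4 := (hTm h).quasiMeasurePreserving.ae_eq_comp h3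
    filter_upwards [h1, h2, h3, h4] with y e1 e2 e3 e4
    rw [e1, Pi.sub_apply, e2, e3, Real.norm_eq_abs]
    simp only [Function.comp_apply] at e4 ⊢
    rw [e4]
    rfl
  have := hn.tendsto 0
  simp only [e] at this
  simpa using this

end Translation

/-! ### The posterior law of the signal given the noisy observation -/

section Posterior

variable {d : ℕ} {μ : Measure (EuclideanSpace ℝ (Fin d))}

theorem norm_inv_smul_le {ε : ℝ} (hε : 0 < ε) (n : ℕ) (u : EuclideanSpace ℝ (Fin d)) :
    (1 + ‖ε⁻¹ • u‖) ^ n ≤ (1 + ε⁻¹) ^ n * (1 + ‖u‖) ^ n := by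
  rw [← mul_pow, norm_smul, Real.norm_of_nonneg (by positivity)]
  have : 0 < ε⁻¹ := by positivity
  gcongr
  nlinarith [norm_nonneg u]

theorem integrable_one_add_norm_inv_smul_pow_mul_gaussianKernel {ε : ℝ} (hε : 0 < ε) (n : ℕ) :
    Integrable (fun u : EuclideanSpace ℝ (Fin d) => (1 + ‖ε⁻¹ • u‖) ^ n * gaussianKernel ε u) := by
  have hk := continuous_gaussianKernel (d := d) ε
  refine ((integrable_one_add_norm_pow_mul_gaussianKernel (d := d) hε n).const_mul
    ((1 + ε⁻¹) ^ n)).mono' (Continuous.aestronglyMeasurable (by fun_prop))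
    (Eventually.of_forall fun u => ?_)
  have hku := gaussianKernel_pos hε u
  rw [Real.norm_of_nonneg (by positivity), ← mul_assoc]
  exact mul_le_mul_of_nonneg_right (norm_inv_smul_le hε n u) hku.le

theorem integrable_prod_mul_gaussianKernel [IsFiniteMeasure μ] {ε : ℝ} (hε : 0 < ε)
    {Φ : EuclideanSpace ℝ (Fin d) × EuclideanSpace ℝ (Fin d) → ℝ}
    (hΦ : AEStronglyMeasurable Φ (volume.prod μ)) {C : ℝ} {n : ℕ}
    (hb : ∀ p, |Φ p| ≤ C * (1 + ‖ε⁻¹ • (p.1 - p.2)‖) ^ n) :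
    Integrable (fun p : EuclideanSpace ℝ (Fin d) × EuclideanSpace ℝ (Fin d) =>
      Φ p * gaussianKernel ε (p.1 - p.2)) (volume.prod μ) := by
  have hk := continuous_gaussianKernel (d := d) ε
  refine (integrable_mul_kernel_of_integrable (integrable_const (μ := μ) C)
    (integrable_one_add_norm_inv_smul_pow_mul_gaussianKernel (d := d) hε n)).mono'
    (hΦ.mul (Continuous.aestronglyMeasurable (by fun_prop))) (Eventually.of_forall fun p => ?_)
  have hkp := gaussianKernel_pos hε (p.1 - p.2)
  rw [norm_mul, Real.norm_of_nonneg hkp.le, ← mul_assoc]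
  exact mul_le_mul_of_nonneg_right (hb p) hkp.le

theorem integrable_mul_gaussianKernel_left [IsFiniteMeasure μ] {ε : ℝ} (hε : 0 < ε)
    {y : EuclideanSpace ℝ (Fin d)} {φ : EuclideanSpace ℝ (Fin d) → ℝ}
    (hφ : AEStronglyMeasurable φ μ) {C : ℝ} {n : ℕ}
    (hb : ∀ x, |φ x| ≤ C * (1 + ‖ε⁻¹ • (y - x)‖) ^ n) :
    Integrable (fun x => φ x * gaussianKernel ε (y - x)) μ := by
  have hk := continuous_gaussianKernel (d := d) ε
  obtain ⟨B, hB, hBb⟩ := one_add_pow_mul_gaussianKernel_bounded (d := d) hε n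
  have hC : 0 ≤ C := by
    have := (abs_nonneg _).trans (hb y)
    simpa using this
  refine Integrable.of_bound (C := C * ((1 + ε⁻¹) ^ n * B))
    (hφ.mul (Continuous.aestronglyMeasurable (by fun_prop))) (Eventually.of_forall fun x => ?_)
  have hkp := gaussianKernel_pos hε (y - x)
  rw [norm_mul, Real.norm_of_nonneg hkp.le, Real.norm_eq_abs]
  calc |φ x| * gaussianKernel ε (y - x)
      ≤ C * ((1 + ε⁻¹) ^ n * (1 + ‖y - x‖) ^ n) * gaussianKernel ε (y - x) := by
        refine mul_le_mul_of_nonneg_right ((hb x).trans ?_) hkp.le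
        exact mul_le_mul_of_nonneg_left (norm_inv_smul_le hε n _) hC
    _ = C * ((1 + ε⁻¹) ^ n * ((1 + ‖y - x‖) ^ n * gaussianKernel ε (y - x))) := by ring
    _ ≤ _ := by have := hBb (y - x); gcongr

/-- The conditional law of `X ∼ μ` given `X + ε Z = y`, with `Z` standard Gaussian. -/
noncomputable def posterior (ε : ℝ) (μ : Measure (EuclideanSpace ℝ (Fin d)))
    (y : EuclideanSpace ℝ (Fin d)) : Measure (EuclideanSpace ℝ (Fin d)) :=
  μ.withDensity fun x => ENNReal.ofReal (gaussianKernel ε (y - x) / mollifiedDensity ε μ y)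

theorem integral_posterior {ε : ℝ} (hε : 0 < ε)
    (y : EuclideanSpace ℝ (Fin d)) (φ : EuclideanSpace ℝ (Fin d) → ℝ) :
    ∫ x, φ x ∂(posterior ε μ y) =
      (∫ x, φ x * gaussianKernel ε (y - x) ∂μ) / mollifiedDensity ε μ y := by
  have hk := continuous_gaussianKernel (d := d) ε
  unfold posterior
  rw [integral_withDensity_eq_integral_toReal_smul (by fun_prop) (by simp), ← integral_div]
  refine integral_congr_ae (Eventually.of_forall fun x => ?_)
  have : 0 ≤ gaussianKernel ε (y - x) / mollifiedDensity ε μ y :=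
    div_nonneg (gaussianKernel_pos hε _).le (mollifiedDensity_nonneg hε y)
  simp only [ENNReal.toReal_ofReal this, smul_eq_mul]
  ring

theorem mollifiedDensity_mul_integral_posterior [IsProbabilityMeasure μ] {ε : ℝ} (hε : 0 < ε)
    (y : EuclideanSpace ℝ (Fin d)) (φ : EuclideanSpace ℝ (Fin d) → ℝ) :
    mollifiedDensity ε μ y * ∫ x, φ x ∂(posterior ε μ y) =
      ∫ x, φ x * gaussianKernel ε (y - x) ∂μ := by
  rw [integral_posterior hε, mul_div_cancel₀ _ (mollifiedDensity_pos hε y).ne']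

theorem integrable_posterior [IsFiniteMeasure μ] {ε : ℝ} (hε : 0 < ε)
    {y : EuclideanSpace ℝ (Fin d)} {φ : EuclideanSpace ℝ (Fin d) → ℝ}
    (hφ : AEStronglyMeasurable φ μ) {C : ℝ} {n : ℕ}
    (hb : ∀ x, |φ x| ≤ C * (1 + ‖ε⁻¹ • (y - x)‖) ^ n) : Integrable φ (posterior ε μ y) := by
  have hk := continuous_gaussianKernel (d := d) ε
  unfold posterior
  rw [integrable_withDensity_iff (by fun_prop) (by simp)]
  refine ((integrable_mul_gaussianKernel_left hε hφ hb).div_const (mollifiedDensity ε μ y)).congr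
    (Eventually.of_forall fun x => ?_)
  have : 0 ≤ gaussianKernel ε (y - x) / mollifiedDensity ε μ y :=
    div_nonneg (gaussianKernel_pos hε _).le (mollifiedDensity_nonneg hε y)
  simp only [ENNReal.toReal_ofReal this]
  ring

theorem isProbabilityMeasure_posterior [IsProbabilityMeasure μ] {ε : ℝ} (hε : 0 < ε)
    (y : EuclideanSpace ℝ (Fin d)) : IsProbabilityMeasure (posterior ε μ y) := by
  have h1 : Integrable (fun _ => (1 : ℝ)) (posterior ε μ y) :=
    integrable_posterior (C := 1) (n := 0) hε aestronglyMeasurable_const (by simp)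
  have hfin : IsFiniteMeasure (posterior ε μ y) := by
    rw [integrable_const_iff] at h1
    simpa using h1
  have h2 := integral_posterior (μ := μ) hε y (fun _ => 1)
  simp only [one_mul, integral_const, smul_eq_mul, mul_one] at h2
  have h3 : (∫ x, gaussianKernel ε (y - x) ∂μ) / mollifiedDensity ε μ y = 1 :=
    div_self (mollifiedDensity_pos (μ := μ) hε y).ne'
  rw [h3] at h2
  exact ⟨by rw [← ENNReal.toReal_eq_one_iff]; exact h2⟩

/-- Averages of functions of the noise. -/
theorem integral_integral_noise [IsProbabilityMeasure μ] {ε : ℝ} (hε : 0 < ε)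
    {φ : EuclideanSpace ℝ (Fin d) → ℝ} (hφ : Continuous φ) {C : ℝ} {n : ℕ}
    (hb : ∀ z, |φ z| ≤ C * (1 + ‖z‖) ^ n) :
    Integrable (fun y => ∫ x, φ (ε⁻¹ • (y - x)) * gaussianKernel ε (y - x) ∂μ) ∧
    ∫ y, ∫ x, φ (ε⁻¹ • (y - x)) * gaussianKernel ε (y - x) ∂μ = ∫ z, φ z * gaussianKernel 1 z := by
  have hi := integrable_prod_mul_gaussianKernel (μ := μ) hε
    (Φ := fun p => φ (ε⁻¹ • (p.1 - p.2)))
    (Continuous.aestronglyMeasurable (by fun_prop)) (fun p => hb _)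
  refine ⟨hi.integral_prod_left, ?_⟩
  rw [integral_integral_swap hi]
  simp only [fun x => integral_gaussianKernel_mul_comp hε x φ]
  simp

/-- Absolute continuity enters here. With f the density of μ, the unnormalized posterior average is
∫ f(y - ε z) φ(z) k₁(z) dz. The zero Gaussian mean of φ allows f(y) to be subtracted, and Fubini
bounds the L¹ norm by the average of ‖f(· - ε z) - f‖₁ against |φ| k₁, which vanishes by continuity
of translations and domination by 2‖f‖₁. -/
theorem tendsto_integral_abs_noise [IsProbabilityMeasure μ] (hμ : μ ≪ volume)
    {φ : EuclideanSpace ℝ (Fin d) → ℝ} (hφ : Continuous φ) {C : ℝ} {n : ℕ}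
    (hb : ∀ z, |φ z| ≤ C * (1 + ‖z‖) ^ n) (h0 : ∫ z, φ z * gaussianKernel 1 z = 0) :
    Tendsto (fun ε => ∫ y, |∫ x, φ (ε⁻¹ • (y - x)) * gaussianKernel ε (y - x) ∂μ|)
      (𝓝[>] 0) (𝓝 0) := by
  have hk := continuous_gaussianKernel (d := d) 1
  set f : EuclideanSpace ℝ (Fin d) → ℝ := fun x => (μ.rnDeriv volume x).toReal
  have hf : Integrable f := Measure.integrable_toReal_rnDeriv
  have hw : Integrable (fun z => φ z * gaussianKernel 1 z) := by
    refine ((integrable_one_add_norm_pow_mul_gaussianKernel (d := d) one_pos n).const_mul C).mono'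
      (Continuous.aestronglyMeasurable (by fun_prop)) (Eventually.of_forall fun z => ?_)
    have hkz := gaussianKernel_pos one_pos z
    rw [norm_mul, Real.norm_of_nonneg hkz.le, ← mul_assoc]
    exact mul_le_mul_of_nonneg_right (hb z) hkz.le
  set w : EuclideanSpace ℝ (Fin d) → ℝ := fun z => φ z * gaussianKernel 1 z with hwdef
  set TV : EuclideanSpace ℝ (Fin d) → ℝ := fun h => ∫ y, |f (y - h) - f y| with hTVdef
  have hTV := tendsto_integral_abs_sub_translate hf
  have hTVb : ∀ h, TV h ≤ 2 * ∫ y, |f y| := fun h => by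
    have h1 : Integrable fun y => |f (y - h)| := (hf.comp_sub_right h).abs
    calc TV h ≤ ∫ y, (|f (y - h)| + |f y|) :=
          integral_mono ((hf.comp_sub_right h).sub hf).abs (h1.add hf.abs) fun y => abs_sub _ _
      _ = _ := by
          rw [integral_add h1 hf.abs, integral_sub_right_eq_self (fun y => |f y|) h]; ring
  have hTV0 : ∀ h, 0 ≤ TV h := fun h => integral_nonneg fun y => abs_nonneg _
  have hjoint : ∀ ε : ℝ, Integrable (fun p : EuclideanSpace ℝ (Fin d) × EuclideanSpace ℝ (Fin d) =>
      (f (p.1 - ε • p.2) - f p.1) * w p.2) (volume.prod volume) := fun ε => by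
    have i1 : Integrable (fun p : EuclideanSpace ℝ (Fin d) × EuclideanSpace ℝ (Fin d) =>
        f p.1 * w p.2) (volume.prod volume) := hf.mul_prod hw
    -- The shear (y, z) ↦ (y - ε z, z) preserves Lebesgue measure, so joint integrability transfers
    -- from the product f ⊗ w.
    have mp : MeasurePreserving (fun p : EuclideanSpace ℝ (Fin d) × EuclideanSpace ℝ (Fin d) =>
        (p.1 - ε • p.2, p.2)) (volume.prod volume) (volume.prod volume) := by
      have h1 := MeasurePreserving.skew_product (g := fun (z y : EuclideanSpace ℝ (Fin d)) => y - ε • z)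
        (MeasurePreserving.id (volume : Measure (EuclideanSpace ℝ (Fin d))))
        (μc := volume) (μd := volume) (Measurable.sub measurable_snd (measurable_fst.const_smul ε))
        (Eventually.of_forall fun z => (measurePreserving_sub_right volume (ε • z)).map_eq)
      exact (Measure.measurePreserving_swap.comp h1).comp Measure.measurePreserving_swap
    have i2 := mp.integrable_comp_of_integrable i1
    simp only [sub_mul]
    exact i2.sub i1
  have hmain : ∀ ε : ℝ, 0 < ε →
      ∫ y, |∫ x, φ (ε⁻¹ • (y - x)) * gaussianKernel ε (y - x) ∂μ| ≤ ∫ z, TV (ε • z) * |w z| := by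
    intro ε hε
    have e1 : ∀ y, ∫ x, φ (ε⁻¹ • (y - x)) * gaussianKernel ε (y - x) ∂μ =
        ∫ z, f (y - ε • z) * w z := fun y => by
      rw [← integral_rnDeriv_smul hμ]
      simp only [smul_eq_mul]
      have h1 := integral_sub_left_eq_self (μ := (volume : Measure (EuclideanSpace ℝ (Fin d))))
        (fun u => f (y - u) * (φ (ε⁻¹ • u) * gaussianKernel ε u)) y
      simp only [sub_sub_cancel] at h1
      rw [h1]
      have h2 := integral_gaussianKernel_mul_comp hε 0 (fun z => f (y - ε • z) * φ z)
      simp only [sub_zero, smul_smul, mul_inv_cancel₀ hε.ne', one_smul] at h2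
      simp only [← mul_assoc, hwdef]
      exact h2
    have hswap := (hjoint ε).abs
    have e2 : ∀ᵐ y, |∫ x, φ (ε⁻¹ • (y - x)) * gaussianKernel ε (y - x) ∂μ| ≤
        ∫ z, |(f (y - ε • z) - f y) * w z| := by
      filter_upwards [(hjoint ε).prod_right_ae] with y hy
      have h3 : ∫ z, f (y - ε • z) * w z = ∫ z, (f (y - ε • z) - f y) * w z := by
        have h4 : Integrable fun z => f (y - ε • z) * w z := by
          refine (hy.add (hw.const_mul (f y))).congr (Eventually.of_forall fun z => ?_)
          simp only [Pi.add_apply]; ring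
        simp only [sub_mul]
        rw [integral_sub h4 (hw.const_mul _), integral_const_mul, h0, mul_zero, sub_zero]
      rw [e1, h3]
      exact abs_integral_le_integral_abs
    calc _ ≤ ∫ y, ∫ z, |(f (y - ε • z) - f y) * w z| :=
          integral_mono_of_nonneg (Eventually.of_forall fun y => abs_nonneg _)
            hswap.integral_prod_left e2
      _ = ∫ z, ∫ y, |(f (y - ε • z) - f y) * w z| := integral_integral_swap hswap
      _ = _ := by
          refine integral_congr_ae (Eventually.of_forall fun z => ?_)
          simp only [abs_mul, integral_mul_const, hTVdef]
  have hlim : Tendsto (fun ε : ℝ => ∫ z, TV (ε • z) * |w z|) (𝓝[>] 0) (𝓝 0) := by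
    have e : (0 : ℝ) = ∫ z : EuclideanSpace ℝ (Fin d), 0 := by simp
    rw [e]
    refine tendsto_integral_filter_of_dominated_convergence
      (fun z => (2 * ∫ y, |f y|) * |w z|) (Eventually.of_forall fun ε => ?_)
      (Eventually.of_forall fun ε => Eventually.of_forall fun z => ?_) (hw.abs.const_mul _)
      (Eventually.of_forall fun z => ?_)
    -- Measurability of z ↦ TV(ε z)|w z| comes for free from the joint integrability.
    · have h1 := (hjoint ε).abs.integral_prod_right.aestronglyMeasurable
      simpa only [abs_mul, integral_mul_const] using h1
    · rw [norm_mul, Real.norm_of_nonneg (hTV0 _), Real.norm_of_nonneg (abs_nonneg _)]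
      exact mul_le_mul_of_nonneg_right (hTVb _) (abs_nonneg _)
    · have h1 : Tendsto (fun ε : ℝ => ε • z) (𝓝[>] 0) (𝓝 0) := by
        have : Continuous fun ε : ℝ => ε • z := by fun_prop
        simpa using (this.tendsto 0).mono_left nhdsWithin_le_nhds
      simpa using (hTV.comp h1).mul_const |w z|
  refine squeeze_zero' (Eventually.of_forall fun ε => integral_nonneg fun y => abs_nonneg _) ?_ hlim
  filter_upwards [self_mem_nhdsWithin] with ε hε using hmain ε hε

end Posterior

/-! ### Convergence of posterior moments, and low Gaussian moments -/

section PosteriorLimits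

variable {d : ℕ} {μ : Measure (EuclideanSpace ℝ (Fin d))}

theorem stronglyMeasurable_integral_mul_gaussianKernel [IsFiniteMeasure μ] (ε : ℝ)
    {Φ : EuclideanSpace ℝ (Fin d) × EuclideanSpace ℝ (Fin d) → ℝ} (hΦ : Continuous Φ) :
    StronglyMeasurable fun y => ∫ x, Φ (y, x) * gaussianKernel ε (y - x) ∂μ := by
  have hk := continuous_gaussianKernel (d := d) ε
  refine StronglyMeasurable.integral_prod_right' (ν := μ)
    (f := fun p : EuclideanSpace ℝ (Fin d) × EuclideanSpace ℝ (Fin d) =>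
    Φ p * gaussianKernel ε (p.1 - p.2)) ?_
  exact Continuous.stronglyMeasurable (by fun_prop)

theorem stronglyMeasurable_integral_posterior [IsProbabilityMeasure μ] {ε : ℝ} (hε : 0 < ε)
    {Φ : EuclideanSpace ℝ (Fin d) × EuclideanSpace ℝ (Fin d) → ℝ} (hΦ : Continuous Φ) :
    StronglyMeasurable fun y => ∫ x, Φ (y, x) ∂(posterior ε μ y) := by
  simp only [fun y => integral_posterior (μ := μ) hε y (fun x => Φ (y, x))]
  exact (stronglyMeasurable_integral_mul_gaussianKernel ε hΦ).div
    (continuous_mollifiedDensity hε).stronglyMeasurable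

theorem abs_pow_le_const_mul {φ : EuclideanSpace ℝ (Fin d) → ℝ} {C : ℝ} {n : ℕ}
    (hb : ∀ z, |φ z| ≤ C * (1 + ‖z‖) ^ n) (m : ℕ) (z : EuclideanSpace ℝ (Fin d)) :
    |φ z ^ m| ≤ C ^ m * (1 + ‖z‖) ^ (n * m) := by
  rw [abs_pow, pow_mul, ← mul_pow]
  exact pow_le_pow_left₀ (abs_nonneg _) (hb z) m

/-- Jensen's inequality for the posterior law. After integration in y the right side becomes a
Gaussian moment that does not depend on ε, which is the uniform moment bound needed later. -/
theorem mollifiedDensity_mul_pow_integral_posterior_le [IsProbabilityMeasure μ]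
    {ε : ℝ} (hε : 0 < ε) (y : EuclideanSpace ℝ (Fin d))
    {φ : EuclideanSpace ℝ (Fin d) → ℝ} (hφ : Continuous φ) {C : ℝ} {n : ℕ}
    (hb : ∀ z, |φ z| ≤ C * (1 + ‖z‖) ^ n) {m : ℕ} (hm : Even m) :
    mollifiedDensity ε μ y * (∫ x, φ (ε⁻¹ • (y - x)) ∂(posterior ε μ y)) ^ m ≤
      ∫ x, φ (ε⁻¹ • (y - x)) ^ m * gaussianKernel ε (y - x) ∂μ := by
  have := isProbabilityMeasure_posterior (μ := μ) hε y
  rw [← mollifiedDensity_mul_integral_posterior hε y (fun x => φ (ε⁻¹ • (y - x)) ^ m)]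
  refine mul_le_mul_of_nonneg_left ?_ (mollifiedDensity_nonneg hε y)
  exact (hm.convexOn_pow).map_integral_le (by fun_prop) isClosed_univ (by simp)
    (integrable_posterior hε (Continuous.aestronglyMeasurable (by fun_prop)) fun x => hb _)
    (integrable_posterior hε (Continuous.aestronglyMeasurable (by fun_prop)) fun x =>
      abs_pow_le_const_mul hb m _)

theorem integrable_mollifiedDensity_mul_sq_integral_posterior [IsProbabilityMeasure μ]
    {ε : ℝ} (hε : 0 < ε) {φ : EuclideanSpace ℝ (Fin d) → ℝ} (hφ : Continuous φ) {C : ℝ} {n : ℕ}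
    (hb : ∀ z, |φ z| ≤ C * (1 + ‖z‖) ^ n) :
    Integrable fun y =>
      mollifiedDensity ε μ y * (∫ x, φ (ε⁻¹ • (y - x)) ∂(posterior ε μ y)) ^ 2 := by
  refine (integral_integral_noise (μ := μ) hε (φ := fun z => φ z ^ 2) (by fun_prop)
    (abs_pow_le_const_mul hb 2)).1.mono' ?_ (Eventually.of_forall fun y => ?_)
  · exact (continuous_mollifiedDensity hε).aestronglyMeasurable.mul
      ((stronglyMeasurable_integral_posterior hε (Φ := fun p => φ (ε⁻¹ • (p.1 - p.2)))
        (by fun_prop)).aestronglyMeasurable.pow 2)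
  · rw [Real.norm_of_nonneg (mul_nonneg (mollifiedDensity_nonneg hε y) (sq_nonneg _))]
    exact mollifiedDensity_mul_pow_integral_posterior_le hε y hφ hb even_two

theorem sq_le_mul_abs_add {L : ℝ} (hL : 0 < L) (t : ℝ) : t ^ 2 ≤ L * |t| + t ^ 4 / L ^ 2 := by
  rcases le_total |t| L with h | h
  · have : t ^ 2 ≤ L * |t| := by rw [← sq_abs, sq]; gcongr
    have : 0 ≤ t ^ 4 / L ^ 2 := by positivity
    linarith
  · have h1 : t ^ 2 ≤ t ^ 4 / L ^ 2 := by
      rw [le_div_iff₀ (by positivity)]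
      have : L ^ 2 ≤ t ^ 2 := by rw [← sq_abs t]; gcongr
      nlinarith [sq_nonneg t]
    have : 0 ≤ L * |t| := by positivity
    linarith

/-- L¹ convergence plus a bounded fourth moment gives L² convergence: t² ≤ L|t| + t⁴/L² leaves L
times a vanishing quantity and K/L², with K a fixed Gaussian moment. -/
theorem tendsto_integral_sq_posterior [IsProbabilityMeasure μ] (hμ : μ ≪ volume)
    {φ : EuclideanSpace ℝ (Fin d) → ℝ} (hφ : Continuous φ) {C : ℝ} {n : ℕ}
    (hb : ∀ z, |φ z| ≤ C * (1 + ‖z‖) ^ n) (h0 : ∫ z, φ z * gaussianKernel 1 z = 0) :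
    Tendsto (fun ε => ∫ y, mollifiedDensity ε μ y *
      (∫ x, φ (ε⁻¹ • (y - x)) ∂(posterior ε μ y)) ^ 2) (𝓝[>] 0) (𝓝 0) := by
  have hL1 := tendsto_integral_abs_noise hμ hφ hb h0
  set K := ∫ z, φ z ^ 4 * gaussianKernel 1 z
  have hK : 0 ≤ K := integral_nonneg fun z => mul_nonneg (by positivity)
    (gaussianKernel_pos one_pos z).le
  have hmain : ∀ ε : ℝ, 0 < ε → ∀ L : ℝ, 0 < L → ∫ y, mollifiedDensity ε μ y *
      (∫ x, φ (ε⁻¹ • (y - x)) ∂(posterior ε μ y)) ^ 2 ≤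
      L * (∫ y, |∫ x, φ (ε⁻¹ • (y - x)) * gaussianKernel ε (y - x) ∂μ|) + K / L ^ 2 := by
    intro ε hε L hL
    obtain ⟨j1, -⟩ := integral_integral_noise (μ := μ) hε hφ hb
    obtain ⟨j2, e2⟩ := integral_integral_noise (μ := μ) hε (φ := fun z => φ z ^ 4) (by fun_prop)
      (abs_pow_le_const_mul hb 4)
    rw [show K / L ^ 2 = ∫ y, (∫ x, φ (ε⁻¹ • (y - x)) ^ 4 * gaussianKernel ε (y - x) ∂μ) / L ^ 2 by
      rw [integral_div, e2], ← integral_const_mul, ← integral_add (j1.abs.const_mul L)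
      (j2.div_const _)]
    refine integral_mono (integrable_mollifiedDensity_mul_sq_integral_posterior hε hφ hb)
      ((j1.abs.const_mul L).add (j2.div_const _)) fun y => ?_
    have hq := mollifiedDensity_pos (μ := μ) hε y
    have h1 := sq_le_mul_abs_add hL (∫ x, φ (ε⁻¹ • (y - x)) ∂(posterior ε μ y))
    have h2 := mollifiedDensity_mul_pow_integral_posterior_le (μ := μ) hε y hφ hb
      (by decide : Even 4)
    have h3 := mollifiedDensity_mul_integral_posterior (μ := μ) hε y
      (fun x => φ (ε⁻¹ • (y - x)))
    beta_reduce
    rw [← h3, abs_mul, abs_of_pos hq]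
    set t := ∫ x, φ (ε⁻¹ • (y - x)) ∂(posterior ε μ y)
    calc mollifiedDensity ε μ y * t ^ 2 ≤ mollifiedDensity ε μ y * (L * |t| + t ^ 4 / L ^ 2) := by
          gcongr
      _ = L * (mollifiedDensity ε μ y * |t|) + mollifiedDensity ε μ y * t ^ 4 / L ^ 2 := by ring
      _ ≤ _ := by gcongr
  rw [Metric.tendsto_nhds]
  intro η hη
  obtain ⟨L, hL0, hL⟩ : ∃ L : ℝ, 0 < L ∧ K / L ^ 2 < η / 2 := by
    -- Since L ≥ 1, (η/2) L² ≥ (η/2) L = K + η/2 > K.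
    refine ⟨2 * K / η + 1, by positivity, ?_⟩
    have h1 : (1 : ℝ) ≤ 2 * K / η + 1 := by have : 0 ≤ 2 * K / η := by positivity
                                            linarith
    rw [div_lt_iff₀ (by positivity)]
    have h2 : η / 2 * (2 * K / η + 1) = K + η / 2 := by field_simp
    nlinarith
  have hev := (Metric.tendsto_nhds.1 hL1) (η / (2 * L)) (by positivity)
  filter_upwards [hev, self_mem_nhdsWithin] with ε h1 hε
  have hε : 0 < ε := hε
  rw [Real.dist_0_eq_abs, abs_of_nonneg (integral_nonneg fun y => abs_nonneg _),
    lt_div_iff₀ (by positivity)] at h1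
  rw [Real.dist_0_eq_abs, abs_of_nonneg (integral_nonneg fun y =>
    mul_nonneg (mollifiedDensity_nonneg hε y) (sq_nonneg _))]
  linarith [hmain ε hε L hL0]

theorem tendsto_integral_mul_mollifiedDensity [IsProbabilityMeasure μ]
    {h : EuclideanSpace ℝ (Fin d) → ℝ} (hh : Continuous h) {B : ℝ} (hB : ∀ y, |h y| ≤ B) :
    Tendsto (fun ε => ∫ y, h y * mollifiedDensity ε μ y) (𝓝[>] 0) (𝓝 (∫ x, h x ∂μ)) := by
  have hlim := tendsto_integral_integral_mul_gaussianKernel (μ := μ) (G := fun _ y => h y)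
    (by unfold Function.uncurry; fun_prop) (fun _ y => hB y)
  refine hlim.congr' ?_
  filter_upwards [self_mem_nhdsWithin] with ε hε
  have hi := integrable_prod_mul_gaussianKernel (μ := μ) (Set.mem_Ioi.1 hε) (n := 0)
    (Φ := fun p => h p.1) (Continuous.aestronglyMeasurable (by fun_prop)) (C := B)
    (fun p => by simpa using hB p.1)
  rw [← integral_integral_swap hi]
  simp only [integral_const_mul, mollifiedDensity]

theorem inner_single_one_right (u : EuclideanSpace ℝ (Fin d)) (i : Fin d) :
    (inner ℝ u (EuclideanSpace.single i (1 : ℝ)) : ℝ) = u i := by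
  simp [EuclideanSpace.inner_single_right]

theorem abs_apply_le_one_add_norm (z : EuclideanSpace ℝ (Fin d)) (i : Fin d) :
    |z i| ≤ 1 * (1 + ‖z‖) ^ 1 := by
  have := PiLp.norm_apply_le z i
  rw [Real.norm_eq_abs] at this
  linarith

theorem hasLineDerivAt_apply (i : Fin d) (y w : EuclideanSpace ℝ (Fin d)) :
    HasLineDerivAt ℝ (fun y : EuclideanSpace ℝ (Fin d) => y i) (w i) y w := by
  unfold HasLineDerivAt
  simp only [PiLp.add_apply, PiLp.smul_apply, smul_eq_mul]
  simpa using ((hasDerivAt_id (0 : ℝ)).mul_const (w i)).const_add (y i)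

theorem integrable_mul_gaussianKernel_one {φ : EuclideanSpace ℝ (Fin d) → ℝ} (hφ : Continuous φ)
    {C : ℝ} {n : ℕ} (hb : ∀ z, |φ z| ≤ C * (1 + ‖z‖) ^ n) :
    Integrable fun z => φ z * gaussianKernel 1 z := by
  have hk := continuous_gaussianKernel (d := d) 1
  refine ((integrable_one_add_norm_pow_mul_gaussianKernel (d := d) one_pos n).const_mul C).mono'
    (Continuous.aestronglyMeasurable (by fun_prop)) (Eventually.of_forall fun z => ?_)
  have hkz := gaussianKernel_pos one_pos z
  rw [norm_mul, Real.norm_of_nonneg hkz.le, ← mul_assoc]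
  exact mul_le_mul_of_nonneg_right (hb z) hkz.le

theorem abs_apply_mul_apply_le (z : EuclideanSpace ℝ (Fin d)) (i j : Fin d) :
    |z i * z j| ≤ 1 * (1 + ‖z‖) ^ 2 := by
  have h1 := abs_apply_le_one_add_norm z i
  have h2 := abs_apply_le_one_add_norm z j
  rw [abs_mul]
  calc |z i| * |z j| ≤ (1 * (1 + ‖z‖) ^ 1) * (1 * (1 + ‖z‖) ^ 1) := by gcongr
    _ = _ := by ring

theorem integral_apply_mul_gaussianKernel (i : Fin d) :
    ∫ z : EuclideanSpace ℝ (Fin d), z i * gaussianKernel 1 z = 0 := by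
  have hi := integrable_mul_gaussianKernel_one (d := d) (φ := fun z => z i) (by fun_prop)
    (fun z => abs_apply_le_one_add_norm z i)
  have h := integral_mul_gaussianKernel_deriv (d := d) (ε := 1) (g := fun _ => 1) (g' := fun _ => 0)
    0 (EuclideanSpace.single i (1 : ℝ)) (fun y => by simpa [HasLineDerivAt] using hasDerivAt_const _ _)
    (by simpa using integrable_gaussianKernel (d := d) one_pos)
    (by simpa [inner_single_one_right, mul_comm] using hi) (by simp)
  simpa [inner_single_one_right, mul_comm] using h

/-- Stein's identity: z_j k₁ is minus the j-th derivative of k₁, so integration by parts leaves the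
constant ∂_j z_i. -/
theorem integral_apply_mul_apply_mul_gaussianKernel (i j : Fin d) :
    ∫ z : EuclideanSpace ℝ (Fin d), (z i * z j) * gaussianKernel 1 z = if i = j then 1 else 0 := by
  have hi := integrable_mul_gaussianKernel_one (d := d) (φ := fun z => z i) (by fun_prop)
    (fun z => abs_apply_le_one_add_norm z i)
  have hij := integrable_mul_gaussianKernel_one (d := d) (φ := fun z => z i * z j) (by fun_prop)
    (fun z => abs_apply_mul_apply_le z i j)
  have e : ∀ z : EuclideanSpace ℝ (Fin d), z i * (gaussianKernel 1 z * z j) =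
    z i * z j * gaussianKernel 1 z := fun z => by ring
  have h := integral_mul_gaussianKernel_deriv (d := d) (ε := 1) (g := fun z => z i)
    (g' := fun _ => (EuclideanSpace.single j (1 : ℝ) : EuclideanSpace ℝ (Fin d)) i)
    0 (EuclideanSpace.single j (1 : ℝ)) (fun y => hasLineDerivAt_apply i y _)
    (by simpa using hi) (by simpa [inner_single_one_right, e] using hij)
    (by simpa only [sub_zero] using (integrable_gaussianKernel (d := d) one_pos).const_mul _)
  simp only [sub_zero, inner_single_one_right, one_pow, div_one, e, integral_const_mul,
    integral_gaussianKernel one_pos, mul_one] at h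
  rw [h]
  simp

end PosteriorLimits

/-! ### Space derivatives of the density and of the unnormalized posterior moments -/

section MomentDerivatives

variable {d : ℕ} {μ : Measure (EuclideanSpace ℝ (Fin d))}

theorem continuous_integral_comp_sub [IsFiniteMeasure μ] {F : EuclideanSpace ℝ (Fin d) → ℝ}
    (hF : Continuous F) {B : ℝ} (hB : ∀ u, |F u| ≤ B) :
    Continuous fun y => ∫ x, F (y - x) ∂μ :=
  continuous_of_dominated (bound := fun _ => B)
    (fun y => Continuous.aestronglyMeasurable (by fun_prop))
    (fun y => Eventually.of_forall fun x => hB _) (integrable_const _)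
    (Eventually.of_forall fun x => by fun_prop)

theorem HasLineDerivAt.hasDerivAt_line {F : EuclideanSpace ℝ (Fin d) → ℝ} {F' : ℝ}
    {u w : EuclideanSpace ℝ (Fin d)} {t : ℝ} (h : HasLineDerivAt ℝ F F' (u + t • w) w) :
    HasDerivAt (fun t : ℝ => F (u + t • w)) F' t := by
  have h1 : HasDerivAt (fun s : ℝ => F (u + t • w + s • w)) F' (t - t) := by
    rw [sub_self]; exact h
  have h2 := h1.comp_sub_const t t
  refine h2.congr_of_eventuallyEq (Eventually.of_forall fun s => ?_)
  simp only [add_assoc, ← add_smul, add_sub_cancel]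

theorem hasLineDerivAt_integral_comp_sub [IsFiniteMeasure μ] {F F' : EuclideanSpace ℝ (Fin d) → ℝ}
    (hF : Continuous F) (hF' : Continuous F') {B B' : ℝ} (hB : ∀ u, |F u| ≤ B)
    (hB' : ∀ u, |F' u| ≤ B') {w : EuclideanSpace ℝ (Fin d)}
    (hd : ∀ u, HasLineDerivAt ℝ F (F' u) u w) (y : EuclideanSpace ℝ (Fin d)) :
    HasLineDerivAt ℝ (fun y => ∫ x, F (y - x) ∂μ) (∫ x, F' (y - x) ∂μ) y w := by
  have h := (hasDerivAt_integral_of_dominated_loc_of_deriv_le (μ := μ) (x₀ := (0 : ℝ)) (s := univ)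
    (F := fun t x => F (y - x + t • w)) (F' := fun t x => F' (y - x + t • w))
    (bound := fun _ => B') univ_mem
    (Eventually.of_forall fun t => Continuous.aestronglyMeasurable (by fun_prop))
    (Integrable.of_bound (C := B) (Continuous.aestronglyMeasurable (by fun_prop))
      (Eventually.of_forall fun x => hB _))
    (Continuous.aestronglyMeasurable (by fun_prop))
    (Eventually.of_forall fun x t _ => hB' _) (integrable_const _)
    (Eventually.of_forall fun x t _ => (hd _).hasDerivAt_line)).2
  simp only [zero_smul, add_zero] at h
  simpa only [HasLineDerivAt, add_sub_right_comm] using h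

/-- The unnormalized first posterior moments of the noise. -/
noncomputable def noiseMoment (ε : ℝ) (μ : Measure (EuclideanSpace ℝ (Fin d))) (i : Fin d)
    (y : EuclideanSpace ℝ (Fin d)) : ℝ :=
  ∫ x, (ε⁻¹ • (y - x)) i * gaussianKernel ε (y - x) ∂μ

/-- The unnormalized second posterior moments of the noise. -/
noncomputable def noiseMoment₂ (ε : ℝ) (μ : Measure (EuclideanSpace ℝ (Fin d))) (i j : Fin d)
    (y : EuclideanSpace ℝ (Fin d)) : ℝ :=
  ∫ x, ((ε⁻¹ • (y - x)) i * (ε⁻¹ • (y - x)) j) * gaussianKernel ε (y - x) ∂μ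

theorem abs_mul_gaussianKernel_bounded {ε : ℝ} (hε : 0 < ε) {φ : EuclideanSpace ℝ (Fin d) → ℝ}
    {C : ℝ} {n : ℕ} (hb : ∀ z, |φ z| ≤ C * (1 + ‖z‖) ^ n) :
    ∃ B : ℝ, ∀ u, |φ (ε⁻¹ • u) * gaussianKernel ε u| ≤ B := by
  obtain ⟨B, hB, hBb⟩ := one_add_pow_mul_gaussianKernel_bounded (d := d) hε n
  have hC : 0 ≤ C := by simpa using (abs_nonneg _).trans (hb 0)
  refine ⟨C * ((1 + ε⁻¹) ^ n * B), fun u => ?_⟩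
  have hku := gaussianKernel_pos hε u
  rw [abs_mul, abs_of_pos hku]
  calc |φ (ε⁻¹ • u)| * gaussianKernel ε u
      ≤ C * ((1 + ε⁻¹) ^ n * (1 + ‖u‖) ^ n) * gaussianKernel ε u := by
        refine mul_le_mul_of_nonneg_right ((hb _).trans ?_) hku.le
        exact mul_le_mul_of_nonneg_left (norm_inv_smul_le hε n _) hC
    _ = C * ((1 + ε⁻¹) ^ n * ((1 + ‖u‖) ^ n * gaussianKernel ε u)) := by ring
    _ ≤ _ := by have := hBb u; gcongr

theorem hasLineDerivAt_gaussianKernel_single {ε : ℝ} (hε : 0 < ε) (u : EuclideanSpace ℝ (Fin d))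
    (i : Fin d) : HasLineDerivAt ℝ (gaussianKernel ε)
      (-ε⁻¹ * ((ε⁻¹ • u) i * gaussianKernel ε u)) u (EuclideanSpace.single i (1 : ℝ)) := by
  have h := hasLineDerivAt_gaussianKernel_sub ε 0 (EuclideanSpace.single i (1 : ℝ)) u
  simp only [sub_zero, inner_single_one_right] at h
  refine HasDerivAt.congr_deriv h ?_
  simp only [PiLp.smul_apply, smul_eq_mul]
  field_simp

theorem hasLineDerivAt_apply_mul_gaussianKernel_single {ε : ℝ} (hε : 0 < ε)
    (u : EuclideanSpace ℝ (Fin d)) (i j : Fin d) :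
    HasLineDerivAt ℝ (fun u => (ε⁻¹ • u) j * gaussianKernel ε u)
      (ε⁻¹ * ((if i = j then 1 else 0) * gaussianKernel ε u -
        ((ε⁻¹ • u) i * (ε⁻¹ • u) j) * gaussianKernel ε u)) u
      (EuclideanSpace.single i (1 : ℝ)) := by
  have h1 := hasLineDerivAt_gaussianKernel_single hε u i
  have h2 := hasLineDerivAt_apply j u (EuclideanSpace.single i (1 : ℝ))
  unfold HasLineDerivAt at h1 h2 ⊢
  have h3 := (h2.const_mul ε⁻¹).mul h1
  simp only [zero_smul, add_zero] at h3
  refine HasDerivAt.congr_deriv (f := fun t : ℝ => (ε⁻¹ • (u + t • EuclideanSpace.single i (1 : ℝ))) j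
    * gaussianKernel ε (u + t • EuclideanSpace.single i (1 : ℝ))) h3 ?_
  have e : (EuclideanSpace.single i (1 : ℝ) : EuclideanSpace ℝ (Fin d)) j = if i = j then 1 else 0 := by
    simp [eq_comm]
  rw [e]
  simp only [PiLp.smul_apply, smul_eq_mul]
  ring

theorem continuous_noiseMoment [IsFiniteMeasure μ] {ε : ℝ} (hε : 0 < ε) (i : Fin d) :
    Continuous (noiseMoment ε μ i) := by
  obtain ⟨B, hB⟩ := abs_mul_gaussianKernel_bounded hε (fun z => abs_apply_le_one_add_norm z i)
  have hk := continuous_gaussianKernel (d := d) ε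
  exact continuous_integral_comp_sub (F := fun u => (ε⁻¹ • u) i * gaussianKernel ε u)
    (by fun_prop) hB

theorem continuous_noiseMoment₂ [IsFiniteMeasure μ] {ε : ℝ} (hε : 0 < ε) (i j : Fin d) :
    Continuous (noiseMoment₂ ε μ i j) := by
  obtain ⟨B, hB⟩ := abs_mul_gaussianKernel_bounded hε (fun z => abs_apply_mul_apply_le z i j)
  have hk := continuous_gaussianKernel (d := d) ε
  exact continuous_integral_comp_sub
    (F := fun u => ((ε⁻¹ • u) i * (ε⁻¹ • u) j) * gaussianKernel ε u) (by fun_prop) hB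

theorem hasLineDerivAt_mollifiedDensity [IsFiniteMeasure μ] {ε : ℝ} (hε : 0 < ε) (i : Fin d)
    (y : EuclideanSpace ℝ (Fin d)) :
    HasLineDerivAt ℝ (mollifiedDensity ε μ) (-ε⁻¹ * noiseMoment ε μ i y) y
      (EuclideanSpace.single i (1 : ℝ)) := by
  have hk := continuous_gaussianKernel (d := d) ε
  obtain ⟨B, hB⟩ := abs_mul_gaussianKernel_bounded (d := d) hε (φ := fun _ => 1) (C := 1) (n := 0)
    (by simp)
  obtain ⟨B', hB'⟩ := abs_mul_gaussianKernel_bounded hε (fun z => abs_apply_le_one_add_norm z i)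
  have h := hasLineDerivAt_integral_comp_sub (μ := μ) (F := gaussianKernel ε)
    (F' := fun u => -ε⁻¹ * ((ε⁻¹ • u) i * gaussianKernel ε u)) (B' := ε⁻¹ * B')
    hk (by fun_prop) (by simpa only [one_mul] using hB)
    (fun u => by
      rw [abs_mul, abs_neg, abs_of_pos (by positivity : 0 < ε⁻¹)]
      exact mul_le_mul_of_nonneg_left (hB' u) (by positivity))
    (fun u => hasLineDerivAt_gaussianKernel_single hε u i) y
  rw [integral_const_mul] at h
  exact h

theorem hasLineDerivAt_noiseMoment [IsFiniteMeasure μ] {ε : ℝ} (hε : 0 < ε) (i j : Fin d)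
    (y : EuclideanSpace ℝ (Fin d)) :
    HasLineDerivAt ℝ (noiseMoment ε μ j)
      (ε⁻¹ * ((if i = j then 1 else 0) * mollifiedDensity ε μ y - noiseMoment₂ ε μ i j y)) y
      (EuclideanSpace.single i (1 : ℝ)) := by
  have hk := continuous_gaussianKernel (d := d) ε
  obtain ⟨B, hB⟩ := abs_mul_gaussianKernel_bounded hε (fun z => abs_apply_le_one_add_norm z j)
  obtain ⟨B', hB'⟩ := abs_mul_gaussianKernel_bounded (d := d) hε
    (φ := fun z => (if i = j then 1 else 0) - z i * z j) (C := 2) (n := 2) (fun z => by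
      have h1 := abs_apply_mul_apply_le z i j
      have h2 : |(if i = j then (1 : ℝ) else 0)| ≤ 1 := by split_ifs <;> simp
      have h3 : (1 : ℝ) ≤ (1 + ‖z‖) ^ 2 := by nlinarith [norm_nonneg z]
      linarith [abs_sub (if i = j then (1 : ℝ) else 0) (z i * z j)])
  have h := hasLineDerivAt_integral_comp_sub (μ := μ)
    (F := fun u => (ε⁻¹ • u) j * gaussianKernel ε u)
    (F' := fun u => ε⁻¹ * ((if i = j then 1 else 0) * gaussianKernel ε u -
        ((ε⁻¹ • u) i * (ε⁻¹ • u) j) * gaussianKernel ε u)) (B' := ε⁻¹ * B')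
    (by fun_prop) (by fun_prop) hB
    (fun u => by
      rw [abs_mul, abs_of_pos (by positivity : 0 < ε⁻¹), ← sub_mul]
      exact mul_le_mul_of_nonneg_left (hB' u) (by positivity))
    (fun u => hasLineDerivAt_apply_mul_gaussianKernel_single hε u i j) y
  have i1 : Integrable (fun x => (if i = j then (1 : ℝ) else 0) * gaussianKernel ε (y - x)) μ :=
    (integrable_gaussianKernel_sub hε y).const_mul _
  have i2 : Integrable (fun x => ((ε⁻¹ • (y - x)) i * (ε⁻¹ • (y - x)) j) *
      gaussianKernel ε (y - x)) μ :=
    integrable_mul_gaussianKernel_left hε (Continuous.aestronglyMeasurable (by fun_prop))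
      (fun x => abs_apply_mul_apply_le (ε⁻¹ • (y - x)) i j)
  rw [integral_const_mul, integral_sub i1 i2, integral_const_mul] at h
  exact h

/-- Integration by parts against the constant function 1. -/
theorem integral_lineDeriv_eq_zero {h h' : EuclideanSpace ℝ (Fin d) → ℝ}
    {w : EuclideanSpace ℝ (Fin d)} (hh : Continuous h) (hc : HasCompactSupport h)
    (hi : Integrable h') (hd : ∀ y, HasLineDerivAt ℝ h (h' y) y w) : ∫ y, h' y = 0 := by
  have H := integral_bilinear_hasLineDerivAt_right_eq_neg_left_of_integrable
    (μ := (volume : Measure (EuclideanSpace ℝ (Fin d)))) (B := ContinuousLinearMap.mul ℝ ℝ)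
    (f := h) (f' := h') (g := fun _ => 1) (g' := fun _ => 0) (v := w)
    (by simpa using hi) (by simp) (by simpa using hh.integrable_of_hasCompactSupport hc)
    (fun y _ => hd y) (fun y _ => by simpa [HasLineDerivAt] using hasDerivAt_const _ _)
  simpa using H

/-- The partial derivative of `c` in the `i`-th coordinate direction. -/
noncomputable def partialDeriv (i : Fin d) (c : EuclideanSpace ℝ (Fin d) → ℝ)
    (y : EuclideanSpace ℝ (Fin d)) : ℝ :=
  fderiv ℝ c y (EuclideanSpace.single i (1 : ℝ))

theorem hasLineDerivAt_partialDeriv {c : EuclideanSpace ℝ (Fin d) → ℝ} (hc : ContDiff ℝ 1 c)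
    (i : Fin d) (y : EuclideanSpace ℝ (Fin d)) :
    HasLineDerivAt ℝ c (partialDeriv i c y) y (EuclideanSpace.single i (1 : ℝ)) :=
  (hc.differentiable one_ne_zero y).hasFDerivAt.hasLineDerivAt _

theorem continuous_partialDeriv {c : EuclideanSpace ℝ (Fin d) → ℝ} (hc : ContDiff ℝ 1 c)
    (i : Fin d) : Continuous (partialDeriv i c) :=
  (hc.continuous_fderiv one_ne_zero).clm_apply continuous_const

theorem hasCompactSupport_partialDeriv {c : EuclideanSpace ℝ (Fin d) → ℝ}
    (hc : HasCompactSupport c) (i : Fin d) : HasCompactSupport (partialDeriv i c) :=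
  (hc.fderiv (𝕜 := ℝ)).mono fun y hy h0 => hy (by simp only [partialDeriv, h0, zero_apply])

/-- The divergence of a quadratic expression in the score. -/
theorem integral_partialDeriv_moments_eq_zero [IsProbabilityMeasure μ] {ε : ℝ} (hε : 0 < ε)
    {c : EuclideanSpace ℝ (Fin d) → ℝ} (hc : ContDiff ℝ 1 c) (hcc : HasCompactSupport c)
    (i j k : Fin d) :
    Integrable (fun y => partialDeriv i c y * (noiseMoment ε μ j y * noiseMoment ε μ k y) /
        mollifiedDensity ε μ y + ε⁻¹ * (c y * ((if i = j then 1 else 0) * noiseMoment ε μ k y +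
        (if i = k then 1 else 0) * noiseMoment ε μ j y)) +
      ε⁻¹ * (c y * ((noiseMoment ε μ i y * noiseMoment ε μ j y * noiseMoment ε μ k y) /
        mollifiedDensity ε μ y ^ 2 - (noiseMoment₂ ε μ i j y * noiseMoment ε μ k y +
        noiseMoment₂ ε μ i k y * noiseMoment ε μ j y) / mollifiedDensity ε μ y))) ∧
    ∫ y, (partialDeriv i c y * (noiseMoment ε μ j y * noiseMoment ε μ k y) /
        mollifiedDensity ε μ y + ε⁻¹ * (c y * ((if i = j then 1 else 0) * noiseMoment ε μ k y +
        (if i = k then 1 else 0) * noiseMoment ε μ j y)) +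
      ε⁻¹ * (c y * ((noiseMoment ε μ i y * noiseMoment ε μ j y * noiseMoment ε μ k y) /
        mollifiedDensity ε μ y ^ 2 - (noiseMoment₂ ε μ i j y * noiseMoment ε μ k y +
        noiseMoment₂ ε μ i k y * noiseMoment ε μ j y) / mollifiedDensity ε μ y))) = 0 := by
  have hq := continuous_mollifiedDensity (μ := μ) hε
  have hq0 : ∀ y, mollifiedDensity ε μ y ≠ 0 := fun y => (mollifiedDensity_pos hε y).ne'
  have hq02 : ∀ y, mollifiedDensity ε μ y ^ 2 ≠ 0 := fun y => pow_ne_zero 2 (hq0 y)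
  have h1 := fun i => continuous_noiseMoment (μ := μ) hε i
  have h2 := fun i j => continuous_noiseMoment₂ (μ := μ) hε i j
  have hpc := continuous_partialDeriv hc i
  have hcont := hc.continuous
  have hi : Integrable (fun y => partialDeriv i c y * (noiseMoment ε μ j y * noiseMoment ε μ k y) /
        mollifiedDensity ε μ y + ε⁻¹ * (c y * ((if i = j then 1 else 0) * noiseMoment ε μ k y +
        (if i = k then 1 else 0) * noiseMoment ε μ j y)) +
      ε⁻¹ * (c y * ((noiseMoment ε μ i y * noiseMoment ε μ j y * noiseMoment ε μ k y) /
        mollifiedDensity ε μ y ^ 2 - (noiseMoment₂ ε μ i j y * noiseMoment ε μ k y +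
        noiseMoment₂ ε μ i k y * noiseMoment ε μ j y) / mollifiedDensity ε μ y))) := by
    refine ((Continuous.integrable_of_hasCompactSupport ?_ ?_).add
      (Continuous.integrable_of_hasCompactSupport ?_ ?_)).add
      (Continuous.integrable_of_hasCompactSupport ?_ ?_)
    · exact (hpc.mul ((h1 j).mul (h1 k))).div hq hq0
    · simp only [mul_div_assoc]
      exact (hasCompactSupport_partialDeriv hcc i).mul_right
    · fun_prop
    · exact hcc.mul_right.mul_left
    · refine continuous_const.mul (hcont.mul (((((h1 i).mul (h1 j)).mul (h1 k)).div (hq.pow 2)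
        hq02).sub ((((h2 i j).mul (h1 k)).add ((h2 i k).mul (h1 j))).div hq hq0)))
    · exact hcc.mul_right.mul_left
  -- The integrand is ∂_i of c m_j m_k / q, where ∂_i q = -ε⁻¹ m_i and ∂_i m_j = ε⁻¹ (δ_ij q -
  -- M_ij). No regularity of μ is needed, all derivatives falling on c or on the kernel.
  refine ⟨hi, integral_lineDeriv_eq_zero (w := EuclideanSpace.single i (1 : ℝ))
    (h := fun y => c y * (noiseMoment ε μ j y * noiseMoment ε μ k y / mollifiedDensity ε μ y))
    (hcont.mul (((h1 j).mul (h1 k)).div hq hq0)) hcc.mul_right hi fun y => ?_⟩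
  have d1 := hasLineDerivAt_partialDeriv hc i y
  have d2 := hasLineDerivAt_noiseMoment (μ := μ) hε i j y
  have d3 := hasLineDerivAt_noiseMoment (μ := μ) hε i k y
  have d4 := hasLineDerivAt_mollifiedDensity (μ := μ) hε i y
  unfold HasLineDerivAt at d1 d2 d3 d4 ⊢
  have d5 := d1.mul ((d2.mul d3).div d4 (by simpa using hq0 y))
  refine HasDerivAt.congr_deriv d5 ?_
  simp only [zero_smul, add_zero, Pi.mul_apply, Pi.div_apply]
  have := hq0 y
  have := hε.ne'
  field_simp
  ring

end MomentDerivatives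

/-! ### The score, and integration by parts for the entropy term -/

section EntropyIntegrationByParts

variable {d : ℕ} {μ : Measure (EuclideanSpace ℝ (Fin d))}

/-- The posterior mean of the noise. -/
noncomputable def posteriorMean (ε : ℝ) (μ : Measure (EuclideanSpace ℝ (Fin d)))
    (y : EuclideanSpace ℝ (Fin d)) : EuclideanSpace ℝ (Fin d) :=
  WithLp.toLp 2 fun i => noiseMoment ε μ i y / mollifiedDensity ε μ y

theorem continuous_posteriorMean [IsProbabilityMeasure μ] {ε : ℝ} (hε : 0 < ε) :
    Continuous (posteriorMean ε μ) := by
  unfold posteriorMean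
  refine (PiLp.continuous_toLp 2 _).comp (continuous_pi fun i => ?_)
  exact (continuous_noiseMoment hε i).div (continuous_mollifiedDensity hε)
    fun y => (mollifiedDensity_pos hε y).ne'

theorem posteriorMean_apply {ε : ℝ} (hε : 0 < ε) (y : EuclideanSpace ℝ (Fin d)) (i : Fin d) :
    posteriorMean ε μ y i = ∫ x, (ε⁻¹ • (y - x)) i ∂(posterior ε μ y) := by
  rw [integral_posterior hε]
  rfl

theorem inner_eq_sum_apply (u w : EuclideanSpace ℝ (Fin d)) :
    (inner ℝ u w : ℝ) = ∑ i, u i * w i := by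
  simp [PiLp.inner_apply, mul_comm]

theorem inner_posteriorMean [IsProbabilityMeasure μ] {ε : ℝ} (hε : 0 < ε)
    (y w : EuclideanSpace ℝ (Fin d)) :
    inner ℝ (posteriorMean ε μ y) w = ∫ x, inner ℝ (ε⁻¹ • (y - x)) w ∂(posterior ε μ y) := by
  simp only [inner_eq_sum_apply, posteriorMean_apply hε]
  rw [integral_finsetSum]
  · simp only [integral_mul_const]
  · intro i _
    exact (integrable_posterior hε (Continuous.aestronglyMeasurable (by fun_prop))
      (fun x => abs_apply_le_one_add_norm (ε⁻¹ • (y - x)) i)).mul_const _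

theorem norm_sq_eq_sum_apply (u : EuclideanSpace ℝ (Fin d)) : ‖u‖ ^ 2 = ∑ i, u i ^ 2 := by
  rw [EuclideanSpace.norm_sq_eq]; simp

theorem integrable_mollifiedDensity_mul_norm_sq_posteriorMean [IsProbabilityMeasure μ] {ε : ℝ}
    (hε : 0 < ε) : Integrable fun y => mollifiedDensity ε μ y * ‖posteriorMean ε μ y‖ ^ 2 := by
  simp only [norm_sq_eq_sum_apply, Finset.mul_sum, posteriorMean_apply hε]
  exact integrable_finsetSum _ fun i _ =>
    integrable_mollifiedDensity_mul_sq_integral_posterior hε (φ := fun z => z i) (by fun_prop)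
      (fun z => abs_apply_le_one_add_norm z i)

/-- Tweedie's formula: the gradient of the kernel is -ε⁻¹ times the noise times the kernel, so the
score of q is -ε⁻¹ times the posterior mean of the noise. The added 1 matches the factor in the
Hessian. -/
theorem hasLineDerivAt_log_mollifiedDensity [IsProbabilityMeasure μ] {ε : ℝ} (hε : 0 < ε)
    (w y : EuclideanSpace ℝ (Fin d)) :
    HasLineDerivAt ℝ (fun y => Real.log (mollifiedDensity ε μ y) + 1)
      (-ε⁻¹ * inner ℝ (posteriorMean ε μ y) w) y w := by
  have hk := continuous_gaussianKernel (d := d) ε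
  have hin : ∀ z : EuclideanSpace ℝ (Fin d), |(inner ℝ z w : ℝ)| ≤ ‖w‖ * (1 + ‖z‖) ^ 1 := fun z => by
    refine (abs_real_inner_le_norm z w).trans ?_
    nlinarith [norm_nonneg z, norm_nonneg w]
  obtain ⟨B, hB⟩ := abs_mul_gaussianKernel_bounded (d := d) hε (φ := fun _ => 1) (C := 1) (n := 0)
    (by simp)
  obtain ⟨B', hB'⟩ := abs_mul_gaussianKernel_bounded hε hin
  have h := hasLineDerivAt_integral_comp_sub (μ := μ) (F := gaussianKernel ε)
    (F' := fun u => -ε⁻¹ * (inner ℝ (ε⁻¹ • u) w * gaussianKernel ε u)) (B' := ε⁻¹ * B')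
    hk (by fun_prop) (by simpa only [one_mul] using hB)
    (fun u => by
      rw [abs_mul, abs_neg, abs_of_pos (by positivity : 0 < ε⁻¹)]
      exact mul_le_mul_of_nonneg_left (hB' u) (by positivity))
    (w := w)
    (fun u => by
      have h := hasLineDerivAt_gaussianKernel_sub ε 0 w u
      simp only [sub_zero] at h
      refine HasDerivAt.congr_deriv h ?_
      rw [real_inner_smul_left]
      field_simp) y
  rw [integral_const_mul, ← mollifiedDensity_mul_integral_posterior hε y
    (fun x => inner ℝ (ε⁻¹ • (y - x)) w), ← inner_posteriorMean hε] at h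
  change HasLineDerivAt ℝ (mollifiedDensity ε μ) _ y w at h
  unfold HasLineDerivAt at h ⊢
  have hq := (mollifiedDensity_pos (μ := μ) hε y).ne'
  refine ((h.log (by simpa using hq)).add_const 1).congr_deriv ?_
  simp only [zero_smul, add_zero]
  field_simp

/-- The product is at most M² (‖s‖² + ‖z‖²). The second square is a Gaussian moment; the first
depends on y only and is integrable against q by Jensen's inequality. -/
theorem integrable_prod_score_mul [IsProbabilityMeasure μ] {ε : ℝ} (hε : 0 < ε)
    {v : EuclideanSpace ℝ (Fin d) → EuclideanSpace ℝ (Fin d)} (hv : Continuous v) {M : ℝ}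
    (hM : ∀ x, ‖v x‖ ≤ M) :
    Integrable (fun p : EuclideanSpace ℝ (Fin d) × EuclideanSpace ℝ (Fin d) =>
      (inner ℝ (posteriorMean ε μ p.1) (v p.2) * inner ℝ (ε⁻¹ • (p.1 - p.2)) (v p.2)) *
        gaussianKernel ε (p.1 - p.2)) (volume.prod μ) := by
  have hk := continuous_gaussianKernel (d := d) ε
  have hs := continuous_posteriorMean (μ := μ) hε
  have hM0 : 0 ≤ M := (norm_nonneg _).trans (hM 0)
  have i1 : Integrable (fun p : EuclideanSpace ℝ (Fin d) × EuclideanSpace ℝ (Fin d) =>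
      ‖posteriorMean ε μ p.1‖ ^ 2 * gaussianKernel ε (p.1 - p.2)) (volume.prod μ) := by
    refine (integrable_prod_iff (Continuous.aestronglyMeasurable (by fun_prop))).2
      ⟨Eventually.of_forall fun y =>
        (integrable_gaussianKernel_sub hε y).const_mul (‖posteriorMean ε μ y‖ ^ 2), ?_⟩
    refine (integrable_mollifiedDensity_mul_norm_sq_posteriorMean (μ := μ) hε).congr
      (Eventually.of_forall fun y => ?_)
    have : ∀ x, ‖‖posteriorMean ε μ y‖ ^ 2 * gaussianKernel ε (y - x)‖ =
        ‖posteriorMean ε μ y‖ ^ 2 * gaussianKernel ε (y - x) := fun x =>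
      Real.norm_of_nonneg (mul_nonneg (by positivity) (gaussianKernel_pos hε _).le)
    simp only [this, integral_const_mul]
    rw [mul_comm]; rfl
  have i2 : Integrable (fun p : EuclideanSpace ℝ (Fin d) × EuclideanSpace ℝ (Fin d) =>
      ‖ε⁻¹ • (p.1 - p.2)‖ ^ 2 * gaussianKernel ε (p.1 - p.2)) (volume.prod μ) :=
    integrable_prod_mul_gaussianKernel hε (Φ := fun p => ‖ε⁻¹ • (p.1 - p.2)‖ ^ 2) (C := 1) (n := 2)
      (Continuous.aestronglyMeasurable (by fun_prop)) fun p => by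
        rw [abs_of_nonneg (by positivity)]
        nlinarith [norm_nonneg (ε⁻¹ • (p.1 - p.2))]
  refine ((i1.add i2).const_mul (M ^ 2)).mono' (Continuous.aestronglyMeasurable (by fun_prop))
    (Eventually.of_forall fun p => ?_)
  have hkp := gaussianKernel_pos hε (p.1 - p.2)
  rw [norm_mul, Real.norm_of_nonneg hkp.le, Pi.add_apply, ← add_mul, ← mul_assoc]
  refine mul_le_mul_of_nonneg_right ?_ hkp.le
  rw [norm_mul, Real.norm_eq_abs, Real.norm_eq_abs]
  set s := posteriorMean ε μ p.1
  set z := ε⁻¹ • (p.1 - p.2)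
  calc |inner ℝ s (v p.2)| * |inner ℝ z (v p.2)| ≤ (‖s‖ * M) * (‖z‖ * M) := by
        refine mul_le_mul ((abs_real_inner_le_norm _ _).trans ?_)
          ((abs_real_inner_le_norm _ _).trans ?_) (abs_nonneg _) (by positivity)
        · have := hM p.2; gcongr
        · have := hM p.2; gcongr
    _ = M ^ 2 * (‖s‖ * ‖z‖) := by ring
    _ ≤ _ := by gcongr; nlinarith [sq_nonneg (‖s‖ - ‖z‖), sq_nonneg ‖s‖, sq_nonneg ‖z‖]

theorem inner_sub_div_eq {ε : ℝ} (hε : 0 < ε) (u w : EuclideanSpace ℝ (Fin d)) :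
    (inner ℝ u w : ℝ) / ε ^ 2 = ε⁻¹ * inner ℝ (ε⁻¹ • u) w := by
  rw [real_inner_smul_left]; field_simp

/-- Integration by parts for the entropy part of the second derivative. -/
theorem integral_log_mul_pathDensityDeriv₂ [IsProbabilityMeasure μ]
    (hμ2 : Integrable (fun x => ‖x‖ ^ 2) μ) {ε : ℝ} (hε : 0 < ε)
    {v : EuclideanSpace ℝ (Fin d) → EuclideanSpace ℝ (Fin d)} (hv : Continuous v) {M : ℝ}
    (hM : ∀ x, ‖v x‖ ≤ M) :
    Integrable (fun y => mollifiedDensity ε μ y * ∫ x, inner ℝ (posteriorMean ε μ y) (v x) *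
        inner ℝ (ε⁻¹ • (y - x)) (v x) ∂(posterior ε μ y)) ∧
    ∫ y, (Real.log (mollifiedDensity ε μ y) + 1) * pathDensityDeriv₂ ε μ v 0 y =
      -(ε⁻¹ ^ 2 * ∫ y, mollifiedDensity ε μ y * ∫ x, inner ℝ (posteriorMean ε μ y) (v x) *
        inner ℝ (ε⁻¹ • (y - x)) (v x) ∂(posterior ε μ y)) := by
  have hk := continuous_gaussianKernel (d := d) ε
  have hs := continuous_posteriorMean (μ := μ) hε
  have hq := continuous_mollifiedDensity (μ := μ) hε
  have hlog : Continuous fun y => Real.log (mollifiedDensity ε μ y) + 1 :=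
    (hq.log fun y => (mollifiedDensity_pos hε y).ne').add continuous_const
  obtain ⟨C, hC, hb⟩ := gaussianKernel_path_bounds (d := d) hε (lt_add_one ε)
    ((norm_nonneg _).trans (hM 0))
  obtain ⟨L, hL, hlb⟩ := abs_log_pathDensity_le hμ2 hε hv hM
  have hlb' : ∀ y, |Real.log (mollifiedDensity ε μ y) + 1| ≤ (L + 1) * (1 + ‖y‖) ^ 2 := fun y => by
    have h1 := hlb y 0 (by simp)
    rw [← mollifiedDensity_eq_pathDensity] at h1
    have h2 : 1 ≤ (1 + ‖y‖) ^ 2 := by nlinarith [norm_nonneg y]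
    calc _ ≤ |Real.log (mollifiedDensity ε μ y)| + |1| := abs_add_le _ _
      _ ≤ _ := by rw [abs_one]; linarith
  have hdom := (integrable_prod_one_add_norm_sq_mul_gaussianKernel hμ2
    (by linarith : 0 < ε + 1)).const_mul ((L + 1) * C)
  have hprod : ∀ κ : EuclideanSpace ℝ (Fin d) × EuclideanSpace ℝ (Fin d) → ℝ, Continuous κ →
      (∀ p, |κ p| ≤ C * gaussianKernel (ε + 1) (p.1 - p.2)) →
      Integrable (fun p : EuclideanSpace ℝ (Fin d) × EuclideanSpace ℝ (Fin d) =>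
        (Real.log (mollifiedDensity ε μ p.1) + 1) * κ p) (volume.prod μ) := fun κ hκ hκb => by
    refine hdom.mono' ((hlog.comp continuous_fst).mul hκ).aestronglyMeasurable
      (Eventually.of_forall fun p => ?_)
    rw [norm_mul, Real.norm_eq_abs, Real.norm_eq_abs]
    calc _ ≤ ((L + 1) * (1 + ‖p.1‖) ^ 2) * (C * gaussianKernel (ε + 1) (p.1 - p.2)) :=
          mul_le_mul (hlb' _) (hκb p) (abs_nonneg _) (by positivity)
      _ = _ := by ring
  have j2 := hprod (fun p => gaussianKernel ε (p.1 - p.2) *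
    ((inner ℝ (p.1 - p.2) (v p.2) / ε ^ 2) ^ 2 - ‖v p.2‖ ^ 2 / ε ^ 2)) (by fun_prop) fun p => by
      simpa using (hb (p.1 - p.2) (v p.2) (hM _) 0 (by simp)).2.2.2
  have j1 := hprod (fun p => gaussianKernel ε (p.1 - p.2) *
    (inner ℝ (p.1 - p.2) (v p.2) / ε ^ 2)) (by fun_prop) fun p => by
      simpa using (hb (p.1 - p.2) (v p.2) (hM _) 0 (by simp)).2.1
  have j0 := integrable_prod_score_mul (μ := μ) hε hv hM
  have j3 : Integrable (fun p : EuclideanSpace ℝ (Fin d) × EuclideanSpace ℝ (Fin d) =>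
      (-ε⁻¹ * inner ℝ (posteriorMean ε μ p.1) (v p.2)) * (gaussianKernel ε (p.1 - p.2) *
        (inner ℝ (p.1 - p.2) (v p.2) / ε ^ 2))) (volume.prod μ) := by
    refine (j0.const_mul (-ε⁻¹ ^ 2)).congr (Eventually.of_forall fun p => ?_)
    simp only [inner_sub_div_eq hε]
    ring
  -- Only almost every x: Fubini provides integrable sections in y for almost all x, which the outer
  -- integral tolerates.
  have hibp : ∀ᵐ x ∂μ, ∫ y, (Real.log (mollifiedDensity ε μ y) + 1) * (gaussianKernel ε (y - x) *
      ((inner ℝ (y - x) (v x) / ε ^ 2) ^ 2 - ‖v x‖ ^ 2 / ε ^ 2)) =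
      ∫ y, (-ε⁻¹ * inner ℝ (posteriorMean ε μ y) (v x)) * (gaussianKernel ε (y - x) *
        (inner ℝ (y - x) (v x) / ε ^ 2)) := by
    filter_upwards [j1.prod_left_ae, j2.prod_left_ae, j3.prod_left_ae] with x h1 h2 h3
    exact integral_mul_gaussianKernel_deriv₂ x (v x)
      (fun y => hasLineDerivAt_log_mollifiedDensity hε (v x) y) h1 h2 h3
  have e0 : ∀ y, ∫ x, (inner ℝ (posteriorMean ε μ y) (v x) * inner ℝ (ε⁻¹ • (y - x)) (v x)) *
      gaussianKernel ε (y - x) ∂μ = mollifiedDensity ε μ y *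
      ∫ x, inner ℝ (posteriorMean ε μ y) (v x) *
        inner ℝ (ε⁻¹ • (y - x)) (v x) ∂(posterior ε μ y) := fun y =>
    (mollifiedDensity_mul_integral_posterior hε y _).symm
  refine ⟨by simpa only [e0] using j0.integral_prod_left, ?_⟩
  have e1 : ∫ y, (Real.log (mollifiedDensity ε μ y) + 1) * pathDensityDeriv₂ ε μ v 0 y =
      ∫ y, ∫ x, (Real.log (mollifiedDensity ε μ y) + 1) * (gaussianKernel ε (y - x) *
        ((inner ℝ (y - x) (v x) / ε ^ 2) ^ 2 - ‖v x‖ ^ 2 / ε ^ 2)) ∂μ := by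
    simp only [pathDensityDeriv₂_zero, ← integral_const_mul]
  rw [e1, integral_integral_swap j2, integral_congr_ae hibp, ← integral_integral_swap j3,
    ← integral_const_mul, ← integral_neg]
  refine integral_congr_ae (Eventually.of_forall fun y => ?_)
  beta_reduce
  rw [← e0, ← integral_const_mul, ← integral_neg]
  refine integral_congr_ae (Eventually.of_forall fun x => ?_)
  simp only [inner_sub_div_eq hε]
  ring

/-- Since q' = ε⁻¹ q E⟨Z, v⟩, the Fisher-type term carries the same factor ε⁻² q as the
integrated-by-parts logarithmic term, and the two can be compared under the same posterior law. -/
theorem sq_pathDensityDeriv_div [IsProbabilityMeasure μ] {ε : ℝ} (hε : 0 < ε)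
    (v : EuclideanSpace ℝ (Fin d) → EuclideanSpace ℝ (Fin d)) (y : EuclideanSpace ℝ (Fin d)) :
    pathDensityDeriv ε μ v 0 y ^ 2 / mollifiedDensity ε μ y = ε⁻¹ ^ 2 * (mollifiedDensity ε μ y *
      (∫ x, inner ℝ (ε⁻¹ • (y - x)) (v x) ∂(posterior ε μ y)) ^ 2) := by
  have e : pathDensityDeriv ε μ v 0 y = ε⁻¹ * (mollifiedDensity ε μ y *
      ∫ x, inner ℝ (ε⁻¹ • (y - x)) (v x) ∂(posterior ε μ y)) := by
    rw [mollifiedDensity_mul_integral_posterior hε, ← integral_const_mul]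
    refine integral_congr_ae (Eventually.of_forall fun x => ?_)
    simp only [zero_smul, sub_zero, inner_sub_div_eq hε]
    ring
  have hq := (mollifiedDensity_pos (μ := μ) hε y).ne'
  rw [e]
  field_simp

end EntropyIntegrationByParts

/-! ### Second-order expansion under the posterior law -/

section PosteriorExpansion

/-- With D = a0 - τ - ε a1, the left side is D² + 2τD - γ - β + p. The smallness available, of S and
of a0 - τ, is only in mean square, so each product is split by 2xy ≤ lam x² + lam⁻¹ y²: the bounded
moment J gets the small factor lam, and the vanishing squares get lam⁻¹. The parameter is sent to 0
only after ε. -/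
theorem abs_expansion_remainder_le {lam S J J3 C C' a0 a1 τ γ β p ε : ℝ} (hl : 0 < lam)
    (hl1 : lam ≤ 1) (hJ : J3 ^ 2 ≤ J) (hJ1 : 1 ≤ J)
    (hγ : |γ| ≤ C ^ 2 * (S * J3)) (hβ : |β| ≤ C ^ 2 * (S * J3)) (hp : |p| ≤ C ^ 2 * (S * J3))
    (ha1 : |a1| ≤ C * J3) (hτ : |τ| ≤ C') :
    |(a0 - ε * a1) ^ 2 - τ ^ 2 - γ - β + p| ≤
      (7 * C ^ 2 + C' ^ 2 + 4) * (lam * J + lam⁻¹ * (S ^ 2 + (a0 - τ) ^ 2 + ε ^ 2 * J)) := by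
  have hli : 1 ≤ lam⁻¹ := (one_le_inv₀ hl).2 hl1
  have hm : lam * lam⁻¹ = 1 := mul_inv_cancel₀ hl.ne'
  have amgm : ∀ x y : ℝ, 2 * (x * y) ≤ lam * x ^ 2 + lam⁻¹ * y ^ 2 := fun x y => by
    have h : lam * x ^ 2 + lam⁻¹ * y ^ 2 - 2 * (x * y) = lam⁻¹ * (lam * x - y) ^ 2 := by
      linear_combination (-lam * x ^ 2 + 2 * x * y) * hm
    have : 0 ≤ lam⁻¹ * (lam * x - y) ^ 2 := by positivity
    linarith
  set D := a0 - τ - ε * a1 with hD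
  have ha1' : a1 ^ 2 ≤ C ^ 2 * J := by
    calc a1 ^ 2 = |a1| ^ 2 := (sq_abs _).symm
      _ ≤ (C * J3) ^ 2 := pow_le_pow_left₀ (abs_nonneg _) ha1 2
      _ = C ^ 2 * J3 ^ 2 := by ring
      _ ≤ C ^ 2 * J := mul_le_mul_of_nonneg_left hJ (sq_nonneg _)
  have hD2 : D ^ 2 ≤ 2 * (a0 - τ) ^ 2 + 2 * (C ^ 2 * (ε ^ 2 * J)) := by
    have h1 : D ^ 2 ≤ 2 * (a0 - τ) ^ 2 + 2 * (ε * a1) ^ 2 := by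
      nlinarith [sq_nonneg (a0 - τ + ε * a1)]
    have h2 : (ε * a1) ^ 2 ≤ C ^ 2 * (ε ^ 2 * J) := by
      calc (ε * a1) ^ 2 = ε ^ 2 * a1 ^ 2 := by ring
        _ ≤ ε ^ 2 * (C ^ 2 * J) := mul_le_mul_of_nonneg_left ha1' (sq_nonneg _)
        _ = _ := by ring
    linarith
  have hτ2 : τ ^ 2 ≤ C' ^ 2 := by
    rw [← sq_abs τ]
    exact pow_le_pow_left₀ (abs_nonneg _) hτ 2
  have hSJ : 2 * (S * J3) ≤ lam * J + lam⁻¹ * S ^ 2 := by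
    have := amgm J3 S
    nlinarith
  have hτD : |2 * (τ * D)| ≤ lam * (C' ^ 2 * J) + lam⁻¹ * D ^ 2 := by
    have h1 := amgm τ D
    have h2 := amgm (-τ) D
    have h3 : lam * τ ^ 2 ≤ lam * (C' ^ 2 * J) :=
      mul_le_mul_of_nonneg_left (hτ2.trans (le_mul_of_one_le_right (sq_nonneg _) hJ1)) hl.le
    rw [abs_le]
    constructor <;> nlinarith
  have hDl : D ^ 2 ≤ lam⁻¹ * D ^ 2 := le_mul_of_one_le_left (sq_nonneg _) hli
  have hexp : (a0 - ε * a1) ^ 2 - τ ^ 2 - γ - β + p = D ^ 2 + 2 * (τ * D) - γ - β + p := by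
    rw [hD]; ring
  have htri : |D ^ 2 + 2 * (τ * D) - γ - β + p| ≤ D ^ 2 + |2 * (τ * D)| + |γ| + |β| + |p| := by
    rw [abs_le]
    constructor <;> linarith [neg_abs_le (2 * (τ * D)), neg_abs_le γ, neg_abs_le β, neg_abs_le p,
      le_abs_self (2 * (τ * D)), le_abs_self γ, le_abs_self β, le_abs_self p, sq_nonneg D]
  have hlD : lam⁻¹ * D ^ 2 ≤ lam⁻¹ * (2 * (a0 - τ) ^ 2 + 2 * (C ^ 2 * (ε ^ 2 * J))) :=
    mul_le_mul_of_nonneg_left hD2 (by positivity)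
  have h3C : 3 * C ^ 2 * (2 * (S * J3)) ≤ 3 * C ^ 2 * (lam * J + lam⁻¹ * S ^ 2) :=
    mul_le_mul_of_nonneg_left hSJ (by positivity)
  have hJ0 : 0 ≤ J := by linarith
  have q1 : 0 ≤ lam * J := by positivity
  have q2 : 0 ≤ lam⁻¹ * S ^ 2 := by positivity
  have q3 : 0 ≤ lam⁻¹ * (a0 - τ) ^ 2 := by positivity
  have q4 : 0 ≤ lam⁻¹ * (ε ^ 2 * J) := by positivity
  rw [hexp]
  have e1 : 0 ≤ C ^ 2 * (lam * J) := by positivity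
  have e2 : 0 ≤ C ^ 2 * (lam⁻¹ * S ^ 2) := by positivity
  have e3 : 0 ≤ C ^ 2 * (lam⁻¹ * (a0 - τ) ^ 2) := by positivity
  have e4 : 0 ≤ C ^ 2 * (lam⁻¹ * (ε ^ 2 * J)) := by positivity
  have f2 : 0 ≤ C' ^ 2 * (lam⁻¹ * S ^ 2) := by positivity
  have f3 : 0 ≤ C' ^ 2 * (lam⁻¹ * (a0 - τ) ^ 2) := by positivity
  have f4 : 0 ≤ C' ^ 2 * (lam⁻¹ * (ε ^ 2 * J)) := by positivity
  linarith

variable {E Ω : Type*} [NormedAddCommGroup E] [InnerProductSpace ℝ E] [MeasurableSpace Ω]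
  {P : Measure Ω} [IsProbabilityMeasure P]

/-- Second-order expansion of the difference between the squared mean of `⟪Z, U⟫` and the mean of
`⟪Z, U⟫ ⟪s, U⟫` for a perturbation `U = b - ε (A Z - ε r)` of a constant vector `b`, where `s` is
the mean of `Z`. -/
theorem abs_sq_integral_inner_sub_le {Z r : Ω → E} {A : E →L[ℝ] E} {b s : E}
    (hZm : AEStronglyMeasurable Z P) (hrm : AEStronglyMeasurable r P)
    (hJ : Integrable (fun x => (1 + ‖Z x‖) ^ 6) P)
    (hs : ∀ w, ∫ x, inner ℝ (Z x) w ∂P = inner ℝ s w)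
    {ε C C' lam τ : ℝ} (hε : 0 < ε) (hl : 0 < lam) (hl1 : lam ≤ 1)
    (hr : ∀ x, ‖r x‖ ≤ C * ‖Z x‖ ^ 2) (hη : ∀ x, ‖A (Z x) - ε • r x‖ ≤ C * ‖Z x‖)
    (hb : ‖b‖ ≤ C) (hτ : |τ| ≤ C') :
    |ε⁻¹ ^ 2 * ((∫ x, inner ℝ (Z x) (b - ε • (A (Z x) - ε • r x)) ∂P) ^ 2 -
        ∫ x, inner ℝ (Z x) (b - ε • (A (Z x) - ε • r x)) *
          inner ℝ s (b - ε • (A (Z x) - ε • r x)) ∂P) - τ ^ 2 -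
        ε⁻¹ * ∫ x, (inner ℝ b (Z x) * inner ℝ (A (Z x)) s -
          inner ℝ b s * inner ℝ (A (Z x)) (Z x)) ∂P| ≤
      (7 * C ^ 2 + C' ^ 2 + 4) * (lam * (∫ x, (1 + ‖Z x‖) ^ 6 ∂P) +
        lam⁻¹ * (‖s‖ ^ 2 + ((∫ x, inner ℝ (A (Z x)) (Z x) ∂P) - τ) ^ 2 +
          ε ^ 2 * ∫ x, (1 + ‖Z x‖) ^ 6 ∂P)) := by
  have hC : 0 ≤ C := (norm_nonneg _).trans hb
  have h1Z : ∀ x, 1 ≤ 1 + ‖Z x‖ := fun x => by linarith [norm_nonneg (Z x)]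
  have hJ3 : Integrable (fun x => (1 + ‖Z x‖) ^ 3) P := by
    refine hJ.mono' (by fun_prop) (Eventually.of_forall fun x => ?_)
    rw [Real.norm_of_nonneg (by positivity)]
    exact pow_le_pow_right₀ (h1Z x) (by norm_num)
  have hint : ∀ (f : Ω → ℝ) (K : ℝ), AEStronglyMeasurable f P →
      (∀ x, |f x| ≤ K * (1 + ‖Z x‖) ^ 3) → Integrable f P := fun f K hf hb =>
    (hJ3.const_mul K).mono' hf (Eventually.of_forall hb)
  have hAZ : AEStronglyMeasurable (fun x => A (Z x)) P := A.continuous.comp_aestronglyMeasurable hZm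
  have hin : ∀ {f g : Ω → E}, AEStronglyMeasurable f P → AEStronglyMeasurable g P →
      AEStronglyMeasurable (fun x => (inner ℝ (f x) (g x) : ℝ)) P := fun hf hg => hf.inner hg
  have hc : ∀ e : E, AEStronglyMeasurable (fun _ : Ω => e) P := fun e => aestronglyMeasurable_const
  have hI : ∀ x y : E, |(inner ℝ x y : ℝ)| ≤ ‖x‖ * ‖y‖ := abs_real_inner_le_norm
  have hpw : ∀ x, ∀ n ≤ 3, ‖Z x‖ ^ n ≤ (1 + ‖Z x‖) ^ 3 := fun x n hn =>
    (pow_le_pow_left₀ (norm_nonneg _) (by linarith) n).trans (pow_le_pow_right₀ (h1Z x) hn)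
  have hAZn : ∀ x, ‖A (Z x)‖ ≤ ‖A‖ * ‖Z x‖ := fun x => A.le_opNorm _
  set η : Ω → E := fun x => A (Z x) - ε • r x with hηdef
  have hηm : AEStronglyMeasurable η P := hAZ.sub (hrm.const_smul ε)
  have hη' : ∀ x, ‖η x‖ ≤ C * ‖Z x‖ := hη
  set S := ‖s‖
  have hS : 0 ≤ S := norm_nonneg s
  have b_a1 : ∀ x, |(inner ℝ (Z x) (r x) : ℝ)| ≤ C * (1 + ‖Z x‖) ^ 3 := fun x => by
    calc |(inner ℝ (Z x) (r x) : ℝ)| ≤ ‖Z x‖ * ‖r x‖ := hI _ _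
      _ ≤ ‖Z x‖ * (C * ‖Z x‖ ^ 2) := by gcongr; exact hr x
      _ = C * ‖Z x‖ ^ 3 := by ring
      _ ≤ _ := by exact mul_le_mul_of_nonneg_left (hpw x 3 le_rfl) (by positivity)
  have b_γ : ∀ x, |(inner ℝ (Z x) (η x) : ℝ) * inner ℝ s (η x)| ≤
      C ^ 2 * S * (1 + ‖Z x‖) ^ 3 := fun x => by
    rw [abs_mul]
    calc |(inner ℝ (Z x) (η x) : ℝ)| * |(inner ℝ s (η x) : ℝ)|
        ≤ (‖Z x‖ * ‖η x‖) * (S * ‖η x‖) := by gcongr <;> exact hI _ _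
      _ ≤ (‖Z x‖ * (C * ‖Z x‖)) * (S * (C * ‖Z x‖)) := by gcongr <;> exact hη' x
      _ = C ^ 2 * S * ‖Z x‖ ^ 3 := by ring
      _ ≤ _ := by exact mul_le_mul_of_nonneg_left (hpw x 3 le_rfl) (by positivity)
  have b_β : ∀ x, |(inner ℝ b (Z x) : ℝ) * inner ℝ (r x) s| ≤
      C ^ 2 * S * (1 + ‖Z x‖) ^ 3 := fun x => by
    rw [abs_mul]
    calc |(inner ℝ b (Z x) : ℝ)| * |(inner ℝ (r x) s : ℝ)|
        ≤ (‖b‖ * ‖Z x‖) * (‖r x‖ * S) := by gcongr <;> exact hI _ _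
      _ ≤ (C * ‖Z x‖) * ((C * ‖Z x‖ ^ 2) * S) := by gcongr; exact hr x
      _ = C ^ 2 * S * ‖Z x‖ ^ 3 := by ring
      _ ≤ _ := by exact mul_le_mul_of_nonneg_left (hpw x 3 le_rfl) (by positivity)
  have b_AZ : ∀ x, |(inner ℝ (A (Z x)) (Z x) : ℝ)| ≤ ‖A‖ * (1 + ‖Z x‖) ^ 3 := fun x => by
    calc |(inner ℝ (A (Z x)) (Z x) : ℝ)| ≤ ‖A (Z x)‖ * ‖Z x‖ := hI _ _
      _ ≤ (‖A‖ * ‖Z x‖) * ‖Z x‖ := by gcongr; exact hAZn x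
      _ = ‖A‖ * ‖Z x‖ ^ 2 := by ring
      _ ≤ _ := by gcongr; exact hpw x 2 (by norm_num)
  have b_bA : ∀ x, |(inner ℝ b (Z x) : ℝ) * inner ℝ (A (Z x)) s| ≤
      ‖b‖ * ‖A‖ * S * (1 + ‖Z x‖) ^ 3 := fun x => by
    rw [abs_mul]
    calc |(inner ℝ b (Z x) : ℝ)| * |(inner ℝ (A (Z x)) s : ℝ)|
        ≤ (‖b‖ * ‖Z x‖) * (‖A (Z x)‖ * S) := by gcongr <;> exact hI _ _
      _ ≤ (‖b‖ * ‖Z x‖) * ((‖A‖ * ‖Z x‖) * S) := by gcongr; exact hAZn x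
      _ = ‖b‖ * ‖A‖ * S * ‖Z x‖ ^ 2 := by ring
      _ ≤ _ := by gcongr; exact hpw x 2 (by norm_num)
  have b_Zb : ∀ x, |(inner ℝ (Z x) b : ℝ)| ≤ ‖b‖ * (1 + ‖Z x‖) ^ 3 := fun x => by
    calc |(inner ℝ (Z x) b : ℝ)| ≤ ‖Z x‖ * ‖b‖ := hI _ _
      _ = ‖b‖ * ‖Z x‖ ^ 1 := by ring
      _ ≤ _ := by gcongr; exact hpw x 1 (by norm_num)
  have i_a1 := hint _ _ (hin hZm hrm) b_a1
  have i_γ : Integrable (fun x => inner ℝ (Z x) (η x) * inner ℝ s (η x)) P := hint _ _ ((hin hZm hηm).mul (hin (hc s) hηm)) b_γ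
  have i_β : Integrable (fun x => inner ℝ b (Z x) * inner ℝ (r x) s) P := hint _ _ ((hin (hc b) hZm).mul (hin hrm (hc s))) b_β
  have i_AZ := hint _ _ (hin hAZ hZm) b_AZ
  have i_bA : Integrable (fun x => inner ℝ b (Z x) * inner ℝ (A (Z x)) s) P := hint _ _ ((hin (hc b) hZm).mul (hin hAZ (hc s))) b_bA
  have i_Zb := hint _ _ (hin hZm (hc b)) b_Zb
  set a0 := ∫ x, inner ℝ (A (Z x)) (Z x) ∂P
  set a1 := ∫ x, inner ℝ (Z x) (r x) ∂P
  set γ := ∫ x, inner ℝ (Z x) (η x) * inner ℝ s (η x) ∂P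
  set β := ∫ x, inner ℝ b (Z x) * inner ℝ (r x) s ∂P
  set β0 := ∫ x, inner ℝ b (Z x) * inner ℝ (A (Z x)) s ∂P
  set J := ∫ x, (1 + ‖Z x‖) ^ 6 ∂P
  set J3 := ∫ x, (1 + ‖Z x‖) ^ 3 ∂P
  set sb : ℝ := inner ℝ s b with hsb
  have hsb' : |sb| ≤ C * S := by
    calc |sb| ≤ S * ‖b‖ := hI _ _
      _ ≤ S * C := by gcongr
      _ = _ := mul_comm _ _
  -- Square of this minus the integral below: sb² cancels, the coefficient of ε is β0 - sb·a0, and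
  -- that of ε² is (a0 - ε a1)² - γ - β + sb·a1.
  have e1 : ∫ x, inner ℝ (Z x) (b - ε • η x) ∂P = sb - ε * (a0 - ε * a1) := by
    have : ∀ x, (inner ℝ (Z x) (b - ε • η x) : ℝ) = inner ℝ (Z x) b -
        (ε * inner ℝ (A (Z x)) (Z x) - ε ^ 2 * inner ℝ (Z x) (r x)) := fun x => by
      simp only [hηdef, inner_sub_right, inner_smul_right, real_inner_comm (Z x) (A (Z x))]
      ring
    simp only [this]
    have j1 : Integrable (fun x => ε * inner ℝ (A (Z x)) (Z x) - ε ^ 2 * inner ℝ (Z x) (r x)) P :=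
      (i_AZ.const_mul ε).sub (i_a1.const_mul (ε ^ 2))
    rw [integral_sub i_Zb j1, integral_sub (i_AZ.const_mul ε) (i_a1.const_mul (ε ^ 2)),
      integral_const_mul, integral_const_mul, hs]
    ring
  have e2 : ∫ x, inner ℝ (Z x) (b - ε • η x) * inner ℝ s (b - ε • η x) ∂P =
      sb ^ 2 - (ε * β0 - ε ^ 2 * β) - (ε * sb * a0 - ε ^ 2 * sb * a1) + ε ^ 2 * γ := by
    have : ∀ x, (inner ℝ (Z x) (b - ε • η x) * inner ℝ s (b - ε • η x) : ℝ) =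
        sb * inner ℝ (Z x) b - (ε * (inner ℝ b (Z x) * inner ℝ (A (Z x)) s) -
          ε ^ 2 * (inner ℝ b (Z x) * inner ℝ (r x) s)) -
          (ε * sb * inner ℝ (A (Z x)) (Z x) - ε ^ 2 * sb * inner ℝ (Z x) (r x)) +
          ε ^ 2 * (inner ℝ (Z x) (η x) * inner ℝ s (η x)) := fun x => by
      simp only [hηdef, hsb, inner_sub_right, inner_smul_right, real_inner_comm (Z x) (A (Z x)),
        real_inner_comm s (A (Z x)), real_inner_comm s (r x), real_inner_comm (Z x) b]
      ring
    simp only [this]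
    have j1 : Integrable (fun x => ε * (inner ℝ b (Z x) * inner ℝ (A (Z x)) s) -
          ε ^ 2 * (inner ℝ b (Z x) * inner ℝ (r x) s)) P :=
      (i_bA.const_mul ε).sub (i_β.const_mul (ε ^ 2))
    have j2 : Integrable (fun x => ε * sb * inner ℝ (A (Z x)) (Z x) -
          ε ^ 2 * sb * inner ℝ (Z x) (r x)) P :=
      (i_AZ.const_mul (ε * sb)).sub (i_a1.const_mul (ε ^ 2 * sb))
    have j3 : Integrable (fun x => sb * inner ℝ (Z x) b -
        (ε * (inner ℝ b (Z x) * inner ℝ (A (Z x)) s) -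
          ε ^ 2 * (inner ℝ b (Z x) * inner ℝ (r x) s))) P := (i_Zb.const_mul sb).sub j1
    have j4 : Integrable (fun x => sb * inner ℝ (Z x) b -
        (ε * (inner ℝ b (Z x) * inner ℝ (A (Z x)) s) -
          ε ^ 2 * (inner ℝ b (Z x) * inner ℝ (r x) s)) -
        (ε * sb * inner ℝ (A (Z x)) (Z x) - ε ^ 2 * sb * inner ℝ (Z x) (r x))) P := j3.sub j2
    rw [integral_add j4 (i_γ.const_mul (ε ^ 2)), integral_sub j3 j2,
      integral_sub (i_Zb.const_mul sb) j1, integral_sub (i_bA.const_mul ε) (i_β.const_mul (ε ^ 2)),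
      integral_sub (i_AZ.const_mul (ε * sb)) (i_a1.const_mul (ε ^ 2 * sb))]
    simp only [integral_const_mul, hs]
    ring
  have e3 : ∫ x, (inner ℝ b (Z x) * inner ℝ (A (Z x)) s -
      inner ℝ b s * inner ℝ (A (Z x)) (Z x)) ∂P = β0 - sb * a0 := by
    rw [integral_sub i_bA (i_AZ.const_mul _), integral_const_mul, hsb, real_inner_comm b s]
  -- Cauchy–Schwarz for a probability measure, with constant weight 1; this is why sixth moments are
  -- carried along.
  have hJsq : J3 ^ 2 ≤ J := by
    have h := sq_integral_mul_le (μ := P) (w := fun _ => 1) (g := fun x => (1 + ‖Z x‖) ^ 3)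
      (fun _ => zero_le_one) (by simp) (integrable_const _) (by simpa using hJ3)
      (by simpa [← pow_mul] using hJ)
    simpa [← pow_mul] using h
  have hJ1 : 1 ≤ J := by
    have : ∫ _, (1 : ℝ) ∂P ≤ J :=
      integral_mono (integrable_const _) hJ fun x => one_le_pow₀ (h1Z x)
    simpa using this
  have hJ30 : 0 ≤ J3 := integral_nonneg fun x => by positivity
  have hγ : |γ| ≤ C ^ 2 * (S * J3) := by
    have := abs_integral_le_of_abs_le (hJ3.const_mul (C ^ 2 * S)) b_γ
    rwa [integral_const_mul, mul_assoc] at this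
  have hβ : |β| ≤ C ^ 2 * (S * J3) := by
    have := abs_integral_le_of_abs_le (hJ3.const_mul (C ^ 2 * S)) b_β
    rwa [integral_const_mul, mul_assoc] at this
  have ha1 : |a1| ≤ C * J3 := by
    have := abs_integral_le_of_abs_le (hJ3.const_mul C) b_a1
    rwa [integral_const_mul] at this
  have hp : |sb * a1| ≤ C ^ 2 * (S * J3) := by
    rw [abs_mul]
    calc |sb| * |a1| ≤ (C * S) * (C * J3) := by gcongr
      _ = _ := by ring
  have key := abs_expansion_remainder_le (a0 := a0) (ε := ε) hl hl1 hJsq hJ1 hγ hβ hp ha1 hτ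
  refine le_trans (le_of_eq ?_) key
  rw [e1, e2, e3]
  congr 1
  field_simp
  ring

end PosteriorExpansion

/-! ### The singular ε⁻¹ term as an antisymmetrized divergence -/

section ScoreDivergence

variable {d : ℕ} {μ : Measure (EuclideanSpace ℝ (Fin d))}

theorem integrable_mul_of_hasCompactSupport {c g : EuclideanSpace ℝ (Fin d) → ℝ}
    (hc : Continuous c) (hcc : HasCompactSupport c) (hg : Continuous g) :
    Integrable fun y => c y * g y :=
  (hc.mul hg).integrable_of_hasCompactSupport (hcc.mul_right (f' := g))

theorem integral_partialDeriv_mul_mollifiedDensity [IsProbabilityMeasure μ] {ε : ℝ} (hε : 0 < ε)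
    {c : EuclideanSpace ℝ (Fin d) → ℝ} (hc : ContDiff ℝ 1 c) (hcc : HasCompactSupport c)
    (i : Fin d) : ∫ y, partialDeriv i c y * mollifiedDensity ε μ y =
      ε⁻¹ * ∫ y, c y * noiseMoment ε μ i y := by
  have hq := continuous_mollifiedDensity (μ := μ) hε
  have i1 := integrable_mul_of_hasCompactSupport (continuous_partialDeriv hc i)
    (hasCompactSupport_partialDeriv hcc i) hq
  have i2 := integrable_mul_of_hasCompactSupport hc.continuous hcc
    (continuous_noiseMoment (μ := μ) hε i)
  have h := integral_lineDeriv_eq_zero (h := fun y => c y * mollifiedDensity ε μ y)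
    (h' := fun y => partialDeriv i c y * mollifiedDensity ε μ y - ε⁻¹ * (c y * noiseMoment ε μ i y))
    (w := EuclideanSpace.single i (1 : ℝ)) (hc.continuous.mul hq)
    (hcc.mul_right (f' := mollifiedDensity ε μ)) (i1.sub (i2.const_mul _)) fun y => by
      have h1 := hasLineDerivAt_partialDeriv hc i y
      have h2 := hasLineDerivAt_mollifiedDensity (μ := μ) hε i y
      unfold HasLineDerivAt at h1 h2 ⊢
      refine (h1.mul h2).congr_deriv ?_
      simp only [zero_smul, add_zero]
      ring
  rw [integral_sub i1 (i2.const_mul _), integral_const_mul] at h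
  linarith

theorem noiseMoment₂_comm (ε : ℝ) (i j : Fin d) (y : EuclideanSpace ℝ (Fin d)) :
    noiseMoment₂ ε μ i j y = noiseMoment₂ ε μ j i y := by
  simp only [noiseMoment₂, mul_comm ((ε⁻¹ • (y - _)) i)]

/-- Subtracting the divergence identities for (i, j, k) and (j, i, k) cancels what is symmetric in i
and j: the cubic term, the M_ij term and the δ_ij term. The survivor is the required ε⁻¹ expression.
The remaining ε⁻¹ δ m terms become derivatives of c against q by one more integration by parts, so
the right side has no negative power of ε. -/
theorem integral_mul_noiseMoment_antisymm [IsProbabilityMeasure μ] {ε : ℝ} (hε : 0 < ε)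
    {c : EuclideanSpace ℝ (Fin d) → ℝ} (hc : ContDiff ℝ 1 c) (hcc : HasCompactSupport c)
    (i j k : Fin d) :
    ε⁻¹ * ∫ y, c y * ((noiseMoment₂ ε μ i k y * noiseMoment ε μ j y -
        noiseMoment ε μ i y * noiseMoment₂ ε μ j k y) / mollifiedDensity ε μ y) =
      (∫ y, ((if i = k then 1 else 0) * partialDeriv j c y -
        (if j = k then 1 else 0) * partialDeriv i c y) * mollifiedDensity ε μ y) +
      ((∫ y, partialDeriv i c y *
          (noiseMoment ε μ j y * noiseMoment ε μ k y / mollifiedDensity ε μ y)) -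
        ∫ y, partialDeriv j c y *
          (noiseMoment ε μ i y * noiseMoment ε μ k y / mollifiedDensity ε μ y)) := by
  have hq := continuous_mollifiedDensity (μ := μ) hε
  have hq0 : ∀ y, mollifiedDensity ε μ y ≠ 0 := fun y => (mollifiedDensity_pos hε y).ne'
  have hm := fun i => continuous_noiseMoment (μ := μ) hε i
  have hm2 := fun i j => continuous_noiseMoment₂ (μ := μ) hε i j
  have hI := fun (g : EuclideanSpace ℝ (Fin d) → ℝ) (hg : Continuous g) =>
    integrable_mul_of_hasCompactSupport hc.continuous hcc hg
  have hID := fun (i : Fin d) (g : EuclideanSpace ℝ (Fin d) → ℝ) (hg : Continuous g) =>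
    integrable_mul_of_hasCompactSupport (continuous_partialDeriv hc i)
    (hasCompactSupport_partialDeriv hcc i) hg
  obtain ⟨a1, b1⟩ := integral_partialDeriv_moments_eq_zero (μ := μ) hε hc hcc i j k
  obtain ⟨a2, b2⟩ := integral_partialDeriv_moments_eq_zero (μ := μ) hε hc hcc j i k
  have h := integral_sub a1 a2
  rw [b1, b2, sub_zero] at h
  have e : ∀ y, (partialDeriv i c y * (noiseMoment ε μ j y * noiseMoment ε μ k y) /
        mollifiedDensity ε μ y + ε⁻¹ * (c y * ((if i = j then 1 else 0) * noiseMoment ε μ k y +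
        (if i = k then 1 else 0) * noiseMoment ε μ j y)) +
      ε⁻¹ * (c y * ((noiseMoment ε μ i y * noiseMoment ε μ j y * noiseMoment ε μ k y) /
        mollifiedDensity ε μ y ^ 2 - (noiseMoment₂ ε μ i j y * noiseMoment ε μ k y +
        noiseMoment₂ ε μ i k y * noiseMoment ε μ j y) / mollifiedDensity ε μ y))) -
      (partialDeriv j c y * (noiseMoment ε μ i y * noiseMoment ε μ k y) /
        mollifiedDensity ε μ y + ε⁻¹ * (c y * ((if j = i then 1 else 0) * noiseMoment ε μ k y +
        (if j = k then 1 else 0) * noiseMoment ε μ i y)) +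
      ε⁻¹ * (c y * ((noiseMoment ε μ j y * noiseMoment ε μ i y * noiseMoment ε μ k y) /
        mollifiedDensity ε μ y ^ 2 - (noiseMoment₂ ε μ j i y * noiseMoment ε μ k y +
        noiseMoment₂ ε μ j k y * noiseMoment ε μ i y) / mollifiedDensity ε μ y))) =
      partialDeriv i c y * (noiseMoment ε μ j y * noiseMoment ε μ k y / mollifiedDensity ε μ y) -
      partialDeriv j c y * (noiseMoment ε μ i y * noiseMoment ε μ k y / mollifiedDensity ε μ y) +
      ((if i = k then 1 else 0) * ε⁻¹ * (c y * noiseMoment ε μ j y) -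
        (if j = k then 1 else 0) * ε⁻¹ * (c y * noiseMoment ε μ i y)) -
      ε⁻¹ * (c y * ((noiseMoment₂ ε μ i k y * noiseMoment ε μ j y -
        noiseMoment ε μ i y * noiseMoment₂ ε μ j k y) / mollifiedDensity ε μ y)) := fun y => by
    rw [noiseMoment₂_comm ε j i, if_congr (eq_comm : j = i ↔ i = j) rfl rfl]
    ring
  rw [integral_congr_ae (Eventually.of_forall e)] at h
  have i1 := hID i (fun y => noiseMoment ε μ j y * noiseMoment ε μ k y / mollifiedDensity ε μ y)
    (((hm j).mul (hm k)).div hq hq0)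
  have i2 := hID j (fun y => noiseMoment ε μ i y * noiseMoment ε μ k y / mollifiedDensity ε μ y)
    (((hm i).mul (hm k)).div hq hq0)
  have i3 := (hI _ (hm j)).const_mul ((if i = k then 1 else 0) * ε⁻¹)
  have i4 := (hI _ (hm i)).const_mul ((if j = k then 1 else 0) * ε⁻¹)
  have i5 := hI (fun y => (noiseMoment₂ ε μ i k y * noiseMoment ε μ j y -
    noiseMoment ε μ i y * noiseMoment₂ ε μ j k y) / mollifiedDensity ε μ y)
    ((((hm2 i k).mul (hm j)).sub ((hm i).mul (hm2 j k))).div hq hq0)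
  have i12 : Integrable fun y => partialDeriv i c y *
        (noiseMoment ε μ j y * noiseMoment ε μ k y / mollifiedDensity ε μ y) -
      partialDeriv j c y * (noiseMoment ε μ i y * noiseMoment ε μ k y / mollifiedDensity ε μ y) :=
    i1.sub i2
  have i34 : Integrable fun y => (if i = k then 1 else 0) * ε⁻¹ * (c y * noiseMoment ε μ j y) -
        (if j = k then 1 else 0) * ε⁻¹ * (c y * noiseMoment ε μ i y) := i3.sub i4
  have i14 : Integrable fun y => partialDeriv i c y *
        (noiseMoment ε μ j y * noiseMoment ε μ k y / mollifiedDensity ε μ y) -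
      partialDeriv j c y * (noiseMoment ε μ i y * noiseMoment ε μ k y / mollifiedDensity ε μ y) +
      ((if i = k then 1 else 0) * ε⁻¹ * (c y * noiseMoment ε μ j y) -
        (if j = k then 1 else 0) * ε⁻¹ * (c y * noiseMoment ε μ i y)) := i12.add i34
  rw [integral_sub i14 (i5.const_mul _), integral_add i12 i34, integral_sub i1 i2,
    integral_sub i3 i4, integral_const_mul, integral_const_mul, integral_const_mul] at h
  have e2 : ∀ y, ((if i = k then 1 else 0) * partialDeriv j c y -
        (if j = k then 1 else 0) * partialDeriv i c y) * mollifiedDensity ε μ y =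
      (if i = k then 1 else 0) * (partialDeriv j c y * mollifiedDensity ε μ y) -
        (if j = k then 1 else 0) * (partialDeriv i c y * mollifiedDensity ε μ y) := fun y => by ring
  simp only [e2]
  rw [integral_sub ((hID j _ hq).const_mul _) ((hID i _ hq).const_mul _), integral_const_mul,
    integral_const_mul, integral_partialDeriv_mul_mollifiedDensity hε hc hcc,
    integral_partialDeriv_mul_mollifiedDensity hε hc hcc]
  linarith

theorem noiseMoment_eq [IsProbabilityMeasure μ] {ε : ℝ} (hε : 0 < ε) (i : Fin d)
    (y : EuclideanSpace ℝ (Fin d)) : noiseMoment ε μ i y =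
      mollifiedDensity ε μ y * ∫ x, (ε⁻¹ • (y - x)) i ∂(posterior ε μ y) :=
  (mollifiedDensity_mul_integral_posterior hε y _).symm

theorem noiseMoment₂_eq [IsProbabilityMeasure μ] {ε : ℝ} (hε : 0 < ε) (i j : Fin d)
    (y : EuclideanSpace ℝ (Fin d)) : noiseMoment₂ ε μ i j y =
      mollifiedDensity ε μ y *
        ∫ x, (ε⁻¹ • (y - x)) i * (ε⁻¹ • (y - x)) j ∂(posterior ε μ y) :=
  (mollifiedDensity_mul_integral_posterior hε y _).symm

/-- Here m_i m_j / q = q s_i s_j with s the posterior mean of the noise, and s tends to 0 in L²(q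
dy). -/
theorem tendsto_integral_mul_noiseMoment_mul_noiseMoment [IsProbabilityMeasure μ]
    (hμ : μ ≪ volume) {h : EuclideanSpace ℝ (Fin d) → ℝ} {B : ℝ}
    (hB : ∀ y, |h y| ≤ B) (i j : Fin d) :
    Tendsto (fun ε => ∫ y, h y *
      (noiseMoment ε μ i y * noiseMoment ε μ j y / mollifiedDensity ε μ y)) (𝓝[>] 0) (𝓝 0) := by
  have hlim := fun i : Fin d => tendsto_integral_sq_posterior hμ (φ := fun z => z i) (by fun_prop)
    (fun z => abs_apply_le_one_add_norm z i) (integral_apply_mul_gaussianKernel i)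
  have hs := ((hlim i).add (hlim j)).const_mul B
  simp only [add_zero, mul_zero] at hs
  refine squeeze_zero_norm' ?_ hs
  filter_upwards [self_mem_nhdsWithin] with ε hε
  have hε : 0 < ε := hε
  have hint := fun i : Fin d => integrable_mollifiedDensity_mul_sq_integral_posterior (μ := μ) hε
    (φ := fun z => z i) (by fun_prop) (fun z => abs_apply_le_one_add_norm z i)
  rw [← integral_add (hint i) (hint j), ← integral_const_mul]
  refine abs_integral_le_of_abs_le (((hint i).add (hint j)).const_mul B) fun y => ?_
  have hq := mollifiedDensity_pos (μ := μ) hε y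
  rw [noiseMoment_eq hε, noiseMoment_eq hε, abs_mul]
  beta_reduce
  set a := ∫ x, (ε⁻¹ • (y - x)) i ∂(posterior ε μ y)
  set b := ∫ x, (ε⁻¹ • (y - x)) j ∂(posterior ε μ y)
  set q := mollifiedDensity ε μ y
  have e : q * a * (q * b) / q = q * (a * b) := by field_simp
  rw [e, abs_mul, abs_of_pos hq, ← mul_add]
  have hab : |a * b| ≤ a ^ 2 + b ^ 2 := by
    rw [abs_le]
    constructor <;> nlinarith [sq_nonneg (a + b), sq_nonneg (a - b)]
  have hB0 : 0 ≤ B := (abs_nonneg _).trans (hB y)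
  have := hB y
  gcongr

theorem tendsto_integral_mul_noiseMoment_antisymm [IsProbabilityMeasure μ] (hμ : μ ≪ volume)
    {c : EuclideanSpace ℝ (Fin d) → ℝ} (hc : ContDiff ℝ 1 c) (hcc : HasCompactSupport c)
    (i j k : Fin d) :
    Tendsto (fun ε => ε⁻¹ * ∫ y, c y * ((noiseMoment₂ ε μ i k y * noiseMoment ε μ j y -
        noiseMoment ε μ i y * noiseMoment₂ ε μ j k y) / mollifiedDensity ε μ y)) (𝓝[>] 0)
      (𝓝 (∫ x, ((if i = k then 1 else 0) * partialDeriv j c x -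
        (if j = k then 1 else 0) * partialDeriv i c x) ∂μ)) := by
  have hb := fun i => (hasCompactSupport_partialDeriv hcc i).exists_bound_of_continuous
    (continuous_partialDeriv hc i)
  obtain ⟨B, hB⟩ := hb i
  obtain ⟨B', hB'⟩ := hb j
  have hD := fun i => continuous_partialDeriv hc i
  have h1 := tendsto_integral_mul_mollifiedDensity (μ := μ)
    (h := fun x => (if i = k then 1 else 0) * partialDeriv j c x -
        (if j = k then 1 else 0) * partialDeriv i c x) (B := B' + B)
    (by have := hD i; have := hD j; fun_prop) (fun y => by
      have hy := hB y
      have hy' := hB' y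
      rw [Real.norm_eq_abs] at hy hy'
      refine (abs_sub _ _).trans (add_le_add ?_ ?_)
      · split_ifs
        · simpa using hy'
        · simpa using (abs_nonneg _).trans hy'
      · split_ifs
        · simpa using hy
        · simpa using (abs_nonneg _).trans hy)
  have h2 := tendsto_integral_mul_noiseMoment_mul_noiseMoment hμ hB j k
  have h3 := tendsto_integral_mul_noiseMoment_mul_noiseMoment hμ hB' i k
  have h := h1.add (h2.sub h3)
  simp only [sub_zero, add_zero] at h
  refine h.congr' ?_
  filter_upwards [self_mem_nhdsWithin] with ε hε
  exact (integral_mul_noiseMoment_antisymm hε hc hcc i j k).symm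

end ScoreDivergence

/-! ### Taylor expansion of the velocity inside the entropy term -/

section EntropyExpansion

variable {d : ℕ} {μ : Measure (EuclideanSpace ℝ (Fin d))}

/-- A compactly supported C² field has a Lipschitz derivative, so the mean value inequality on the
segment gives a quadratic Taylor remainder. Summing all constants yields a single C for every bound.
-/
theorem exists_taylor_bound {v : EuclideanSpace ℝ (Fin d) → EuclideanSpace ℝ (Fin d)}
    (hv : ContDiff ℝ 2 v) (hvc : HasCompactSupport v) :
    ∃ C, 0 ≤ C ∧ (∀ y, ‖v y‖ ≤ C) ∧ (∀ y, ‖fderiv ℝ v y‖ ≤ C) ∧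
      (∀ x y, ‖v y - v x‖ ≤ C * ‖y - x‖) ∧
      ∀ x y, ‖v x - v y - fderiv ℝ v y (x - y)‖ ≤ C * ‖y - x‖ ^ 2 := by
  have hv1 : ContDiff ℝ 1 v := hv.of_le one_le_two
  have hf1 : ContDiff ℝ 1 (fderiv ℝ v) := hv.fderiv_right le_rfl
  obtain ⟨B, hB⟩ := hvc.exists_bound_of_continuous hv.continuous
  obtain ⟨B', hB'⟩ := (hvc.fderiv (𝕜 := ℝ)).exists_bound_of_continuous hf1.continuous
  obtain ⟨L, hL⟩ := hv1.lipschitzWith_of_hasCompactSupport hvc one_ne_zero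
  obtain ⟨L', hL'⟩ := hf1.lipschitzWith_of_hasCompactSupport (hvc.fderiv (𝕜 := ℝ)) one_ne_zero
  have h0 : 0 ≤ B := (norm_nonneg _).trans (hB 0)
  have h0' : 0 ≤ B' := (norm_nonneg _).trans (hB' 0)
  have hL0 : (0 : ℝ) ≤ L := L.2
  have hL0' : (0 : ℝ) ≤ L' := L'.2
  refine ⟨B + B' + L + L', by positivity, fun y => (hB y).trans (by linarith),
    fun y => (hB' y).trans (by linarith), fun x y => ?_, fun x y => ?_⟩
  · have h := hL.dist_le_mul y x
    rw [dist_eq_norm, dist_eq_norm] at h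
    exact h.trans (mul_le_mul_of_nonneg_right (by linarith) (norm_nonneg _))
  · have h := (convex_segment y x).norm_image_sub_le_of_norm_fderiv_le' (𝕜 := ℝ) (f := v)
      (φ := fderiv ℝ v y) (C := L' * ‖y - x‖) (fun z _ => hv1.differentiable one_ne_zero z)
      (fun z hz => by
        have h := hL'.dist_le_mul z y
        rw [dist_eq_norm, dist_eq_norm] at h
        refine h.trans (mul_le_mul_of_nonneg_left ?_ hL0')
        rw [norm_sub_rev y x]
        exact norm_sub_le_of_mem_segment hz) (left_mem_segment ℝ y x) (right_mem_segment ℝ y x)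
    rw [norm_sub_rev x y] at h
    refine h.trans ?_
    rw [mul_assoc, ← sq]
    exact mul_le_mul_of_nonneg_right (by linarith) (by positivity)

theorem apply_eq_sum_single (L : EuclideanSpace ℝ (Fin d) →L[ℝ] EuclideanSpace ℝ (Fin d))
    (z : EuclideanSpace ℝ (Fin d)) (j : Fin d) :
    L z j = ∑ k, L (EuclideanSpace.single k (1 : ℝ)) j * z k := by
  have hz : z = ∑ k, z k • (EuclideanSpace.single k (1 : ℝ) : EuclideanSpace ℝ (Fin d)) := by
    ext i
    simp [Finset.sum_apply, Pi.single_apply]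
  conv_lhs => rw [hz]
  simp [map_sum, mul_comm]

theorem abs_apply_single_le (L : EuclideanSpace ℝ (Fin d) →L[ℝ] EuclideanSpace ℝ (Fin d))
    (j k : Fin d) : |L (EuclideanSpace.single k (1 : ℝ)) j| ≤ ‖L‖ := by
  have h := (PiLp.norm_apply_le (L (EuclideanSpace.single k (1 : ℝ))) j).trans (L.le_opNorm _)
  simpa using h

theorem partialDeriv_apply {v : EuclideanSpace ℝ (Fin d) → EuclideanSpace ℝ (Fin d)}
    (hv : Differentiable ℝ v) (j k : Fin d) (y : EuclideanSpace ℝ (Fin d)) :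
    partialDeriv k (fun y => v y j) y = fderiv ℝ v y (EuclideanSpace.single k (1 : ℝ)) j := by
  have h : HasFDerivAt (fun y => v y j)
      ((EuclideanSpace.proj j : EuclideanSpace ℝ (Fin d) →L[ℝ] ℝ).comp (fderiv ℝ v y)) y :=
    (EuclideanSpace.proj j : EuclideanSpace ℝ (Fin d) →L[ℝ] ℝ).hasFDerivAt.comp y
      (hv y).hasFDerivAt
  rw [partialDeriv, h.fderiv]
  rfl

theorem integrable_one_add_norm_pow_posterior [IsProbabilityMeasure μ] {ε : ℝ} (hε : 0 < ε)
    (y : EuclideanSpace ℝ (Fin d)) (n : ℕ) :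
    Integrable (fun x => (1 + ‖ε⁻¹ • (y - x)‖) ^ n) (posterior ε μ y) :=
  integrable_posterior (C := 1) (n := n) hε (Continuous.aestronglyMeasurable (by fun_prop))
    fun x => by rw [abs_of_nonneg (by positivity), one_mul]

/-- Expansion of the integrand of the entropy part of the mollified Hessian. -/
theorem abs_posterior_expansion_le [IsProbabilityMeasure μ]
    {v : EuclideanSpace ℝ (Fin d) → EuclideanSpace ℝ (Fin d)} (hv : Continuous v) {C : ℝ}
    (hC : ∀ y, ‖v y‖ ≤ C) (hC1 : ∀ x y, ‖v y - v x‖ ≤ C * ‖y - x‖)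
    (hC2 : ∀ x y, ‖v x - v y - fderiv ℝ v y (x - y)‖ ≤ C * ‖y - x‖ ^ 2)
    {ε lam C' τ : ℝ} (hε : 0 < ε) (hl : 0 < lam) (hl1 : lam ≤ 1)
    (y : EuclideanSpace ℝ (Fin d)) (hτ : |τ| ≤ C') :
    |ε⁻¹ ^ 2 * ((∫ x, inner ℝ (ε⁻¹ • (y - x)) (v x) ∂(posterior ε μ y)) ^ 2 -
        ∫ x, inner ℝ (posteriorMean ε μ y) (v x) * inner ℝ (ε⁻¹ • (y - x)) (v x)
          ∂(posterior ε μ y)) - τ ^ 2 -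
        ε⁻¹ * ∫ x, (inner ℝ (v y) (ε⁻¹ • (y - x)) *
            inner ℝ (fderiv ℝ v y (ε⁻¹ • (y - x))) (posteriorMean ε μ y) -
          inner ℝ (v y) (posteriorMean ε μ y) *
            inner ℝ (fderiv ℝ v y (ε⁻¹ • (y - x))) (ε⁻¹ • (y - x))) ∂(posterior ε μ y)| ≤
      (7 * C ^ 2 + C' ^ 2 + 4) *
        (lam * (∫ x, (1 + ‖ε⁻¹ • (y - x)‖) ^ 6 ∂(posterior ε μ y)) +
        lam⁻¹ * (‖posteriorMean ε μ y‖ ^ 2 +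
          ((∫ x, inner ℝ (fderiv ℝ v y (ε⁻¹ • (y - x))) (ε⁻¹ • (y - x)) ∂(posterior ε μ y)) - τ) ^ 2
          + ε ^ 2 * ∫ x, (1 + ‖ε⁻¹ • (y - x)‖) ^ 6 ∂(posterior ε μ y))) := by
  have := isProbabilityMeasure_posterior (μ := μ) hε y
  have hei : 0 < ε⁻¹ := by positivity
  set A := fderiv ℝ v y
  -- Taylor's formula in noise coordinates Z = ε⁻¹(y - x): the remainder rescaled by ε⁻² is r, which
  -- is then bounded by C‖Z‖² independently of ε.
  have e : ∀ x, v y - ε • (A (ε⁻¹ • (y - x)) - ε • (ε⁻¹ ^ 2 • (v x - v y - A (x - y)))) = v x := by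
    intro x
    have h1 : ε * ε⁻¹ = 1 := mul_inv_cancel₀ hε.ne'
    have h2 : ε * (ε * ε⁻¹ ^ 2) = 1 := by field_simp
    rw [smul_sub, map_smul, smul_smul, h1, smul_smul, smul_smul, mul_assoc, h2, one_smul, one_smul,
      map_sub, map_sub]
    abel
  have h := abs_sq_integral_inner_sub_le (P := posterior ε μ y) (Z := fun x => ε⁻¹ • (y - x))
    (r := fun x => ε⁻¹ ^ 2 • (v x - v y - A (x - y))) (A := A) (b := v y)
    (s := posteriorMean ε μ y) (C := C) (C' := C') (τ := τ)
    (Continuous.aestronglyMeasurable (by fun_prop)) (Continuous.aestronglyMeasurable (by fun_prop))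
    (integrable_one_add_norm_pow_posterior hε y 6) (fun w => (inner_posteriorMean hε y w).symm)
    hε hl hl1 (fun x => by
      rw [norm_smul, norm_smul, Real.norm_of_nonneg (by positivity), Real.norm_of_nonneg hei.le]
      calc ε⁻¹ ^ 2 * ‖v x - v y - A (x - y)‖ ≤ ε⁻¹ ^ 2 * (C * ‖y - x‖ ^ 2) := by
            gcongr; exact hC2 x y
        _ = _ := by ring) (fun x => by
      have h1 : A (ε⁻¹ • (y - x)) - ε • (ε⁻¹ ^ 2 • (v x - v y - A (x - y))) =
          ε⁻¹ • (v y - v x) := by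
        rw [sub_eq_iff_eq_add.2 (sub_eq_iff_eq_add'.1 (e x)), inv_smul_smul₀ hε.ne']
      rw [h1, norm_smul, norm_smul, Real.norm_of_nonneg hei.le]
      calc ε⁻¹ * ‖v y - v x‖ ≤ ε⁻¹ * (C * ‖y - x‖) := by gcongr; exact hC1 x y
        _ = _ := by ring) (hC y) hτ
  simp only [e] at h
  simp only [mul_comm (inner ℝ (posteriorMean ε μ y) (v _))]
  exact h

/-- In coordinates the ε⁻¹ term is a combination of exactly the antisymmetric moment expressions
treated as divergences. For b = v(y) and L = Dv(y) the coefficients are the products v_i ∂_k v_j. -/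
theorem mollifiedDensity_mul_integral_antisymm [IsProbabilityMeasure μ] {ε : ℝ} (hε : 0 < ε)
    (L : EuclideanSpace ℝ (Fin d) →L[ℝ] EuclideanSpace ℝ (Fin d))
    (b y : EuclideanSpace ℝ (Fin d)) :
    mollifiedDensity ε μ y * ∫ x, (inner ℝ b (ε⁻¹ • (y - x)) *
            inner ℝ (L (ε⁻¹ • (y - x))) (posteriorMean ε μ y) -
          inner ℝ b (posteriorMean ε μ y) *
            inner ℝ (L (ε⁻¹ • (y - x))) (ε⁻¹ • (y - x))) ∂(posterior ε μ y) =
      ∑ i, ∑ j, ∑ k, (b i * L (EuclideanSpace.single k (1 : ℝ)) j) *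
        ((noiseMoment₂ ε μ i k y * noiseMoment ε μ j y -
        noiseMoment ε μ i y * noiseMoment₂ ε μ j k y) / mollifiedDensity ε μ y) := by
  have hq := mollifiedDensity_pos (μ := μ) hε y
  set a : Fin d → Fin d → ℝ := fun j k => L (EuclideanSpace.single k (1 : ℝ)) j
  set s := posteriorMean ε μ y with hs
  have hi2 : ∀ i k, Integrable (fun x => (ε⁻¹ • (y - x)) i * (ε⁻¹ • (y - x)) k)
      (posterior ε μ y) := fun i k =>
    integrable_posterior hε (Continuous.aestronglyMeasurable (by fun_prop))
      (fun x => abs_apply_mul_apply_le (ε⁻¹ • (y - x)) i k)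
  have e : ∀ x, (inner ℝ b (ε⁻¹ • (y - x)) * inner ℝ (L (ε⁻¹ • (y - x))) s -
      inner ℝ b s * inner ℝ (L (ε⁻¹ • (y - x))) (ε⁻¹ • (y - x)) : ℝ) =
      ∑ i, ∑ j, ∑ k, (b i * a j k) * (((ε⁻¹ • (y - x)) i * (ε⁻¹ • (y - x)) k) * s j -
        s i * ((ε⁻¹ • (y - x)) j * (ε⁻¹ • (y - x)) k)) := fun x => by
    generalize ε⁻¹ • (y - x) = z
    simp only [inner_eq_sum_apply, Finset.sum_mul_sum, ← Finset.sum_sub_distrib]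
    refine Finset.sum_congr rfl fun i _ => Finset.sum_congr rfl fun j _ => ?_
    rw [apply_eq_sum_single L z, Finset.sum_mul, Finset.sum_mul, Finset.mul_sum, Finset.mul_sum,
      ← Finset.sum_sub_distrib]
    refine Finset.sum_congr rfl fun k _ => ?_
    simp only [a]
    ring
  simp only [e]
  have hi3 : ∀ i j k, Integrable (fun x => (b i * a j k) *
      (((ε⁻¹ • (y - x)) i * (ε⁻¹ • (y - x)) k) * s j -
        s i * ((ε⁻¹ • (y - x)) j * (ε⁻¹ • (y - x)) k))) (posterior ε μ y) := fun i j k =>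
    (((hi2 i k).mul_const _).sub ((hi2 j k).const_mul _)).const_mul _
  rw [integral_finsetSum _ fun i _ => integrable_finsetSum _ fun j _ =>
    integrable_finsetSum _ fun k _ => hi3 i j k, Finset.mul_sum]
  refine Finset.sum_congr rfl fun i _ => ?_
  rw [integral_finsetSum _ fun j _ => integrable_finsetSum _ fun k _ => hi3 i j k, Finset.mul_sum]
  refine Finset.sum_congr rfl fun j _ => ?_
  rw [integral_finsetSum _ fun k _ => hi3 i j k, Finset.mul_sum]
  refine Finset.sum_congr rfl fun k _ => ?_
  rw [integral_const_mul, integral_sub ((hi2 i k).mul_const _) ((hi2 j k).const_mul _),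
    integral_mul_const, integral_const_mul, hs, posteriorMean_apply hε, posteriorMean_apply hε,
    noiseMoment₂_eq hε, noiseMoment₂_eq hε, noiseMoment_eq hε, noiseMoment_eq hε]
  have key : ∀ q c m n m' n' : ℝ, 0 < q →
      q * (c * (m * n - n' * m')) = c * ((q * m * (q * n) - q * n' * (q * m')) / q) :=
    fun q c m n m' n' hq => by field_simp
  exact key _ _ _ _ _ _ hq

/-- The difference is Σ L_jk (E[Z_j Z_k] - δ_jk); Cauchy–Schwarz over the d² index pairs reduces it
to posterior averages of functions with Gaussian mean zero. -/
theorem sq_integral_quadratic_sub_trace_le [IsProbabilityMeasure μ] {ε : ℝ} (hε : 0 < ε)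
    (L : EuclideanSpace ℝ (Fin d) →L[ℝ] EuclideanSpace ℝ (Fin d)) {C : ℝ} (hL : ‖L‖ ≤ C)
    (y : EuclideanSpace ℝ (Fin d)) :
    ((∫ x, inner ℝ (L (ε⁻¹ • (y - x))) (ε⁻¹ • (y - x)) ∂(posterior ε μ y)) -
      ∑ j, L (EuclideanSpace.single j (1 : ℝ)) j) ^ 2 ≤
    d ^ 2 * C ^ 2 * ∑ p : Fin d × Fin d, (∫ x, ((ε⁻¹ • (y - x)) p.1 * (ε⁻¹ • (y - x)) p.2 -
      if p.1 = p.2 then 1 else 0) ∂(posterior ε μ y)) ^ 2 := by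
  have := isProbabilityMeasure_posterior (μ := μ) hε y
  set a : Fin d → Fin d → ℝ := fun j k => L (EuclideanSpace.single k (1 : ℝ)) j
  have hi2 : ∀ i k, Integrable (fun x => (ε⁻¹ • (y - x)) i * (ε⁻¹ • (y - x)) k)
      (posterior ε μ y) := fun i k =>
    integrable_posterior hε (Continuous.aestronglyMeasurable (by fun_prop))
      (fun x => abs_apply_mul_apply_le (ε⁻¹ • (y - x)) i k)
  have e : ∀ x, (inner ℝ (L (ε⁻¹ • (y - x))) (ε⁻¹ • (y - x)) : ℝ) =
      ∑ p : Fin d × Fin d, a p.1 p.2 * ((ε⁻¹ • (y - x)) p.1 * (ε⁻¹ • (y - x)) p.2) := fun x => by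
    generalize ε⁻¹ • (y - x) = z
    simp only [inner_eq_sum_apply, apply_eq_sum_single L z, Finset.sum_mul, Fintype.sum_prod_type]
    refine Finset.sum_congr rfl fun j _ => Finset.sum_congr rfl fun k _ => ?_
    simp only [a]
    ring
  have e2 : ∑ j, L (EuclideanSpace.single j (1 : ℝ)) j =
      ∑ p : Fin d × Fin d, a p.1 p.2 * (if p.1 = p.2 then 1 else 0) := by
    simp [Fintype.sum_prod_type, a]
  simp only [e]
  rw [e2, integral_finsetSum _ fun p _ => (hi2 p.1 p.2).const_mul _, ← Finset.sum_sub_distrib]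
  refine (sq_sum_le_card_mul_sum_sq).trans ?_
  simp only [Finset.card_univ, Fintype.card_prod, Fintype.card_fin, Nat.cast_mul]
  rw [← sq, mul_assoc]
  refine mul_le_mul_of_nonneg_left ?_ (by positivity)
  rw [Finset.mul_sum]
  refine Finset.sum_le_sum fun p _ => ?_
  rw [integral_sub (hi2 _ _) (integrable_const _), integral_const_mul, ← mul_sub, mul_pow]
  simp only [integral_const, probReal_univ, smul_eq_mul, one_mul]
  refine mul_le_mul_of_nonneg_right ?_ (sq_nonneg _)
  rw [← sq_abs]
  exact pow_le_pow_left₀ (abs_nonneg _) ((abs_apply_single_le L p.1 p.2).trans hL) 2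

end EntropyExpansion

/-! ### The integrated estimate for the entropy term -/

section EntropyLimit

variable {d : ℕ} {μ : Measure (EuclideanSpace ℝ (Fin d))}

theorem integrable_log_add_one_mul_pathDensityDeriv₂ [IsProbabilityMeasure μ]
    (hμ2 : Integrable (fun x => ‖x‖ ^ 2) μ) {ε : ℝ} (hε : 0 < ε)
    {v : EuclideanSpace ℝ (Fin d) → EuclideanSpace ℝ (Fin d)} (hv : Continuous v) {M : ℝ}
    (hM : ∀ x, ‖v x‖ ≤ M) :
    Integrable (fun y => (Real.log (mollifiedDensity ε μ y) + 1) * pathDensityDeriv₂ ε μ v 0 y) ∧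
    Integrable fun y => pathDensityDeriv ε μ v 0 y ^ 2 / mollifiedDensity ε μ y := by
  have hε2 : ε < ε + 1 := by linarith
  -- Taking potential 0 frees the entropy terms from any integrability of V, so any wider scale will
  -- do.
  obtain ⟨bound, hbi, hb⟩ := integrable_mollifiedHessian_terms (V := fun _ => 0) hμ2 hε hε2
    (integrable_zero _ _ _) hv hM
  have hq := continuous_mollifiedDensity (μ := μ) hε
  have h1 := (stronglyMeasurable_pathDensityDeriv (μ := μ) ε 0 hv).aestronglyMeasurable
    (μ := volume)
  have h2 := (stronglyMeasurable_pathDensityDeriv₂ (μ := μ) ε 0 hv).aestronglyMeasurable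
    (μ := volume)
  have hlog : AEStronglyMeasurable (fun y => Real.log (mollifiedDensity ε μ y)) volume :=
    (hq.log fun y => (mollifiedDensity_pos hε y).ne').aestronglyMeasurable
  rw [mollifiedDensity_eq_pathDensity ε v] at hlog hq ⊢
  have h0 : (0 : ℝ) ∈ Metric.ball (0 : ℝ) 1 := by simp
  constructor
  · have e : (fun y => (Real.log (pathDensity ε μ v 0 y) + 1) * pathDensityDeriv₂ ε μ v 0 y) =
        fun y => Real.log (pathDensity ε μ v 0 y) * pathDensityDeriv₂ ε μ v 0 y +
          pathDensityDeriv₂ ε μ v 0 y := by ext y; ring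
    rw [e]
    exact (hbi.mono' (hlog.mul h2)
      (Eventually.of_forall fun y => (hb y 0 h0).2.2.2.2.2.1)).add
      (hbi.mono' h2 (Eventually.of_forall fun y => (hb y 0 h0).2.2.2.2.1))
  · exact hbi.mono' ((h1.pow 2).aemeasurable.div hq.measurable.aemeasurable).aestronglyMeasurable
      (Eventually.of_forall fun y => (hb y 0 h0).2.2.2.2.2.2.1)

/-- The products `v_i ∂_k v_j`. -/
noncomputable def convectionCoeff (v : EuclideanSpace ℝ (Fin d) → EuclideanSpace ℝ (Fin d))
    (i j k : Fin d) (y : EuclideanSpace ℝ (Fin d)) : ℝ :=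
  v y i * partialDeriv k (fun y => v y j) y

theorem contDiff_apply_euclidean {n : WithTop ℕ∞}
    {v : EuclideanSpace ℝ (Fin d) → EuclideanSpace ℝ (Fin d)} (hv : ContDiff ℝ n v) (i : Fin d) :
    ContDiff ℝ n fun y => v y i :=
  (EuclideanSpace.proj i : EuclideanSpace ℝ (Fin d) →L[ℝ] ℝ).contDiff.comp hv

theorem contDiff_partialDeriv {c : EuclideanSpace ℝ (Fin d) → ℝ} {m n : WithTop ℕ∞}
    (hc : ContDiff ℝ n c) (hmn : m + 1 ≤ n) (i : Fin d) : ContDiff ℝ m (partialDeriv i c) :=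
  (hc.fderiv_right hmn).clm_apply contDiff_const

theorem contDiff_convectionCoeff {v : EuclideanSpace ℝ (Fin d) → EuclideanSpace ℝ (Fin d)}
    (hv : ContDiff ℝ 2 v) (i j k : Fin d) : ContDiff ℝ 1 (convectionCoeff v i j k) :=
  (contDiff_apply_euclidean (hv.of_le one_le_two) i).mul
    (contDiff_partialDeriv (contDiff_apply_euclidean hv j) le_rfl k)

theorem hasCompactSupport_apply_euclidean
    {v : EuclideanSpace ℝ (Fin d) → EuclideanSpace ℝ (Fin d)} (hvc : HasCompactSupport v)
    (i : Fin d) : HasCompactSupport fun y => v y i :=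
  hvc.mono fun y hy h0 => hy (by simp only [h0, PiLp.zero_apply])

theorem hasCompactSupport_convectionCoeff
    {v : EuclideanSpace ℝ (Fin d) → EuclideanSpace ℝ (Fin d)} (hvc : HasCompactSupport v)
    (i j k : Fin d) : HasCompactSupport (convectionCoeff v i j k) :=
  (hasCompactSupport_apply_euclidean hvc i).mul_right

theorem abs_apply_mul_apply_sub_le (i j : Fin d) (z : EuclideanSpace ℝ (Fin d)) :
    |z i * z j - if i = j then 1 else 0| ≤ 2 * (1 + ‖z‖) ^ 2 := by
  have h1 := abs_apply_mul_apply_le z i j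
  have h2 : |(if i = j then (1 : ℝ) else 0)| ≤ 1 := by split_ifs <;> simp
  have h3 : (1 : ℝ) ≤ (1 + ‖z‖) ^ 2 := by nlinarith [norm_nonneg z]
  linarith [abs_sub (z i * z j) (if i = j then (1 : ℝ) else 0)]

theorem integral_apply_mul_apply_sub_mul_gaussianKernel (i j : Fin d) :
    ∫ z : EuclideanSpace ℝ (Fin d), (z i * z j - if i = j then 1 else 0) * gaussianKernel 1 z = 0 := by
  have hi := integrable_mul_gaussianKernel_one (φ := fun z : EuclideanSpace ℝ (Fin d) => z i * z j)
    (by fun_prop) (fun z => abs_apply_mul_apply_le z i j)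
  simp only [sub_mul]
  rw [integral_sub hi ((integrable_gaussianKernel one_pos).const_mul _),
    integral_apply_mul_apply_mul_gaussianKernel, integral_const_mul,
    integral_gaussianKernel one_pos, mul_one, sub_self]

theorem integral_mollifiedDensity_mul_norm_sq_posteriorMean [IsProbabilityMeasure μ] {ε : ℝ}
    (hε : 0 < ε) : ∫ y, mollifiedDensity ε μ y * ‖posteriorMean ε μ y‖ ^ 2 =
      ∑ i, ∫ y, mollifiedDensity ε μ y * (∫ x, (ε⁻¹ • (y - x)) i ∂(posterior ε μ y)) ^ 2 := by
  simp only [norm_sq_eq_sum_apply, Finset.mul_sum, posteriorMean_apply hε]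
  exact integral_finsetSum _ fun i _ =>
    integrable_mollifiedDensity_mul_sq_integral_posterior hε (φ := fun z => z i) (by fun_prop)
      (fun z => abs_apply_le_one_add_norm z i)

/-- The pointwise expansion multiplied by q and integrated over y. The posterior sixth moment then
averages to a fixed Gaussian moment, and the terms multiplied by lam⁻¹ become L²(q dy) norms that
vanish with ε, while K and C depend on neither ε nor lam. -/
theorem abs_entropy_sub_le [IsProbabilityMeasure μ]
    (hμ2 : Integrable (fun x => ‖x‖ ^ 2) μ)
    {v : EuclideanSpace ℝ (Fin d) → EuclideanSpace ℝ (Fin d)} (hv : ContDiff ℝ 2 v)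
    (hvc : HasCompactSupport v) :
    ∃ K C : ℝ, 0 ≤ K ∧ ∀ ε lam : ℝ, 0 < ε → 0 < lam → lam ≤ 1 →
    |(∫ y, ((Real.log (mollifiedDensity ε μ y) + 1) * pathDensityDeriv₂ ε μ v 0 y +
        pathDensityDeriv ε μ v 0 y ^ 2 / mollifiedDensity ε μ y)) -
      ((∫ y, (∑ j, partialDeriv j (fun y => v y j) y) ^ 2 * mollifiedDensity ε μ y) +
        ∑ i, ∑ j, ∑ k, ε⁻¹ * ∫ y, convectionCoeff v i j k y *
          ((noiseMoment₂ ε μ i k y * noiseMoment ε μ j y -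
          noiseMoment ε μ i y * noiseMoment₂ ε μ j k y) / mollifiedDensity ε μ y))| ≤
      K * (lam * (∫ z : EuclideanSpace ℝ (Fin d), (1 + ‖z‖) ^ 6 * gaussianKernel 1 z) + lam⁻¹ *
        ((∑ i, ∫ y, mollifiedDensity ε μ y * (∫ x, (ε⁻¹ • (y - x)) i ∂(posterior ε μ y)) ^ 2) +
        d ^ 2 * C ^ 2 * (∑ p : Fin d × Fin d, ∫ y, mollifiedDensity ε μ y *
          (∫ x, ((ε⁻¹ • (y - x)) p.1 * (ε⁻¹ • (y - x)) p.2 -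
            if p.1 = p.2 then 1 else 0) ∂(posterior ε μ y)) ^ 2) +
        ε ^ 2 * ∫ z : EuclideanSpace ℝ (Fin d), (1 + ‖z‖) ^ 6 * gaussianKernel 1 z)) := by
  obtain ⟨C, hC0, hC, hCA, hC1, hC2⟩ := exists_taylor_bound hv hvc
  -- The constant of the remainder lemma with C' = d C, the bound for the divergence of v.
  refine ⟨7 * C ^ 2 + (d * C) ^ 2 + 4, C, by positivity, fun ε lam hε hl hl1 => ?_⟩
  have hvd : Differentiable ℝ v := hv.differentiable two_ne_zero
  set q := mollifiedDensity ε μ with hqdef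
  have hq : Continuous q := continuous_mollifiedDensity hε
  have hqp : ∀ y, 0 < q y := fun y => mollifiedDensity_pos hε y
  set τ : EuclideanSpace ℝ (Fin d) → ℝ := fun y => ∑ j, partialDeriv j (fun y => v y j) y with hτ
  have hτe : ∀ y, τ y = ∑ j, fderiv ℝ v y (EuclideanSpace.single j (1 : ℝ)) j := fun y => by
    simp only [hτ, partialDeriv_apply hvd]
  have hτb : ∀ y, |τ y| ≤ d * C := fun y => by
    rw [hτe]
    refine (Finset.abs_sum_le_sum_abs _ _).trans ?_
    refine (Finset.sum_le_sum fun j _ => (abs_apply_single_le _ j j).trans (hCA y)).trans ?_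
    simp
  have hτc : Continuous τ := continuous_finsetSum _ fun j _ =>
    continuous_partialDeriv (contDiff_apply_euclidean (hv.of_le one_le_two) j) j
  have hqi : Integrable q := by
    have := (integral_integral_noise (μ := μ) hε (φ := fun _ => 1) (C := 1) (n := 0)
      (by fun_prop) (by simp)).1
    simp only [one_mul] at this
    exact this
  obtain ⟨i2, i1⟩ := integrable_log_add_one_mul_pathDensityDeriv₂ hμ2 hε hv.continuous hC
  obtain ⟨i3, e3⟩ := integral_log_mul_pathDensityDeriv₂ hμ2 hε hv.continuous hC
  have e1 := sq_pathDensityDeriv_div (μ := μ) hε v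
  have i4 : Integrable fun y => τ y ^ 2 * q y :=
    hqi.bdd_mul (c := (d * C) ^ 2) (by fun_prop) (Eventually.of_forall fun y => by
      rw [Real.norm_eq_abs, abs_pow]
      exact pow_le_pow_left₀ (abs_nonneg _) (hτb y) 2)
  have hm := fun i => continuous_noiseMoment (μ := μ) hε i
  have hm2 := fun i j => continuous_noiseMoment₂ (μ := μ) hε i j
  set R : Fin d → Fin d → Fin d → EuclideanSpace ℝ (Fin d) → ℝ := fun i j k y =>
    (noiseMoment₂ ε μ i k y * noiseMoment ε μ j y -
          noiseMoment ε μ i y * noiseMoment₂ ε μ j k y) / q y with hR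
  have i5 : ∀ i j k, Integrable fun y => convectionCoeff v i j k y * R i j k y := fun i j k =>
    integrable_mul_of_hasCompactSupport (contDiff_convectionCoeff hv i j k).continuous
      (hasCompactSupport_convectionCoeff hvc i j k)
      ((((hm2 i k).mul (hm j)).sub ((hm i).mul (hm2 j k))).div hq fun y => (hqp y).ne')
  set G := ∫ z : EuclideanSpace ℝ (Fin d), (1 + ‖z‖) ^ 6 * gaussianKernel 1 z
  obtain ⟨i6, e6⟩ := integral_integral_noise (μ := μ) hε (φ := fun z => (1 + ‖z‖) ^ 6) (C := 1)
    (n := 6) (by fun_prop) (fun z => by rw [abs_of_nonneg (by positivity), one_mul])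
  set J : EuclideanSpace ℝ (Fin d) → ℝ :=
    fun y => ∫ x, (1 + ‖ε⁻¹ • (y - x)‖) ^ 6 ∂(posterior ε μ y) with hJ
  have hqJ : ∀ y, q y * J y = ∫ x, (1 + ‖ε⁻¹ • (y - x)‖) ^ 6 * gaussianKernel ε (y - x) ∂μ :=
    fun y => mollifiedDensity_mul_integral_posterior hε y _
  have i7 : Integrable fun y => q y * J y := by simp only [hqJ]; exact i6
  have e7 : ∫ y, q y * J y = G := by simp only [hqJ]; exact e6
  have i8 := integrable_mollifiedDensity_mul_norm_sq_posteriorMean (μ := μ) hε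
  set N : Fin d × Fin d → EuclideanSpace ℝ (Fin d) → ℝ := fun p y =>
    ∫ x, ((ε⁻¹ • (y - x)) p.1 * (ε⁻¹ • (y - x)) p.2 -
            if p.1 = p.2 then 1 else 0) ∂(posterior ε μ y) with hN
  have i9 : ∀ p, Integrable fun y => q y * N p y ^ 2 := fun p =>
    integrable_mollifiedDensity_mul_sq_integral_posterior hε
      (φ := fun z => z p.1 * z p.2 - if p.1 = p.2 then 1 else 0) (by fun_prop)
      (fun z => abs_apply_mul_apply_sub_le p.1 p.2 z)
  set W : EuclideanSpace ℝ (Fin d) → ℝ := fun y => ∫ x, inner ℝ (posteriorMean ε μ y) (v x) *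
    inner ℝ (ε⁻¹ • (y - x)) (v x) ∂(posterior ε μ y) with hW
  set S : EuclideanSpace ℝ (Fin d) → ℝ := fun y =>
    ∫ x, inner ℝ (ε⁻¹ • (y - x)) (v x) ∂(posterior ε μ y) with hS
  set X : EuclideanSpace ℝ (Fin d) → ℝ := fun y => ∑ i, ∑ j, ∑ k,
    convectionCoeff v i j k y * R i j k y with hX
  have i10 : Integrable X := integrable_finsetSum _ fun i _ => integrable_finsetSum _ fun j _ =>
    integrable_finsetSum _ fun k _ => i5 i j k
  have e10 : ∑ i, ∑ j, ∑ k, ε⁻¹ * ∫ y, convectionCoeff v i j k y * R i j k y =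
      ε⁻¹ * ∫ y, X y := by
    simp only [← Finset.mul_sum, hX]
    rw [integral_finsetSum _ fun i _ => integrable_finsetSum _ fun j _ =>
      integrable_finsetSum _ fun k _ => i5 i j k]
    congr 1
    refine Finset.sum_congr rfl fun i _ => ?_
    rw [integral_finsetSum _ fun j _ => integrable_finsetSum _ fun k _ => i5 i j k]
    refine Finset.sum_congr rfl fun j _ => ?_
    rw [integral_finsetSum _ fun k _ => i5 i j k]
  have i11 : Integrable fun y => ε⁻¹ ^ 2 * (q y * S y ^ 2) := by simpa only [e1] using i1
  have i12 : Integrable fun y => ε⁻¹ ^ 2 * (q y * S y ^ 2) - ε⁻¹ ^ 2 * (q y * W y) :=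
    i11.sub (i3.const_mul _)
  have i13 : Integrable fun y => τ y ^ 2 * q y + ε⁻¹ * X y := i4.add (i10.const_mul _)
  have hT : (∫ y, ((Real.log (q y) + 1) * pathDensityDeriv₂ ε μ v 0 y +
        pathDensityDeriv ε μ v 0 y ^ 2 / q y)) -
      ((∫ y, τ y ^ 2 * q y) +
        ∑ i, ∑ j, ∑ k, ε⁻¹ * ∫ y, convectionCoeff v i j k y * R i j k y) =
      ∫ y, (ε⁻¹ ^ 2 * (q y * S y ^ 2) - ε⁻¹ ^ 2 * (q y * W y) -
        (τ y ^ 2 * q y + ε⁻¹ * X y)) := by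
    rw [integral_sub i12 i13, integral_sub i11 (i3.const_mul _), integral_add i4 (i10.const_mul _),
      integral_add i2 i1, e3, e10, integral_const_mul, integral_const_mul, integral_const_mul]
    simp only [e1]
    rw [integral_const_mul]
    ring
  rw [hT]
  have i14 : Integrable fun y => q y * ‖posteriorMean ε μ y‖ ^ 2 +
      d ^ 2 * C ^ 2 * (∑ p, q y * N p y ^ 2) := i8.add
    ((integrable_finsetSum _ fun p _ => i9 p).const_mul _)
  have i15 : Integrable fun y => q y * ‖posteriorMean ε μ y‖ ^ 2 +
      d ^ 2 * C ^ 2 * (∑ p, q y * N p y ^ 2) + ε ^ 2 * (q y * J y) := i14.add (i7.const_mul _)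
  have hbi : Integrable fun y => (7 * C ^ 2 + (d * C) ^ 2 + 4) * (lam * (q y * J y) + lam⁻¹ *
      (q y * ‖posteriorMean ε μ y‖ ^ 2 + d ^ 2 * C ^ 2 * (∑ p, q y * N p y ^ 2) +
        ε ^ 2 * (q y * J y))) := ((i7.const_mul lam).add (i15.const_mul lam⁻¹)).const_mul _
  refine (abs_integral_le_of_abs_le hbi fun y => ?_).trans (le_of_eq ?_)
  · have h := abs_posterior_expansion_le (μ := μ) hv.continuous hC hC1 hC2 hε hl hl1 y (hτb y)
    have hx : X y = q y * _ := ((mollifiedDensity_mul_integral_antisymm (μ := μ) hε (fderiv ℝ v y)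
      (v y) y).trans (by simp only [hX, convectionCoeff, partialDeriv_apply hvd, hR, hqdef])).symm
    have hN2 := sq_integral_quadratic_sub_trace_le (μ := μ) hε (fderiv ℝ v y) (hCA y) y
    rw [← hτe y] at hN2
    have hmul := mul_le_mul_of_nonneg_left h (hqp y).le
    rw [← abs_of_pos (hqp y), ← abs_mul, abs_of_pos (hqp y)] at hmul
    have eL : ε⁻¹ ^ 2 * (q y * S y ^ 2) - ε⁻¹ ^ 2 * (q y * W y) - (τ y ^ 2 * q y + ε⁻¹ * X y) =
        q y * (ε⁻¹ ^ 2 * (S y ^ 2 - W y) - τ y ^ 2 -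
        ε⁻¹ * ∫ x, (inner ℝ (v y) (ε⁻¹ • (y - x)) *
            inner ℝ (fderiv ℝ v y (ε⁻¹ • (y - x))) (posteriorMean ε μ y) -
          inner ℝ (v y) (posteriorMean ε μ y) *
            inner ℝ (fderiv ℝ v y (ε⁻¹ • (y - x))) (ε⁻¹ • (y - x))) ∂(posterior ε μ y)) := by
      rw [hx]; ring
    rw [eL]
    refine hmul.trans ?_
    rw [← Finset.mul_sum]
    have hli : 0 < lam⁻¹ := by positivity
    have hy := (hqp y).le
    calc _ ≤ q y * ((7 * C ^ 2 + (d * C) ^ 2 + 4) * (lam * J y + lam⁻¹ *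
          (‖posteriorMean ε μ y‖ ^ 2 + d ^ 2 * C ^ 2 * (∑ p, N p y ^ 2) + ε ^ 2 * J y))) := by
          gcongr
      _ = _ := by ring
  · have hs := integral_mollifiedDensity_mul_norm_sq_posteriorMean (μ := μ) hε
    rw [integral_const_mul, integral_add (i7.const_mul lam) (i15.const_mul lam⁻¹),
      integral_const_mul, integral_const_mul, integral_add i14 (i7.const_mul _),
      integral_add i8 ((integrable_finsetSum _ fun p _ => i9 p).const_mul _),
      integral_const_mul, integral_const_mul, integral_finsetSum _ fun p _ => i9 p, e7, hs]

end EntropyLimit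

/-! ### The limit of the entropy term and of the mollified Hessian -/

section EntropyHessian

variable {d : ℕ} {μ : Measure (EuclideanSpace ℝ (Fin d))}

theorem partialDeriv_mul {f g : EuclideanSpace ℝ (Fin d) → ℝ} (hf : ContDiff ℝ 1 f)
    (hg : ContDiff ℝ 1 g) (i : Fin d) (y : EuclideanSpace ℝ (Fin d)) :
    partialDeriv i (fun y => f y * g y) y = partialDeriv i f y * g y + f y * partialDeriv i g y := by
  unfold partialDeriv
  rw [fderiv_fun_mul (hf.differentiable one_ne_zero y) (hg.differentiable one_ne_zero y)]
  simp only [add_apply, smul_apply, smul_eq_mul]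
  ring

theorem partialDeriv_comm {f : EuclideanSpace ℝ (Fin d) → ℝ} (hf : ContDiff ℝ 2 f)
    (i j : Fin d) (y : EuclideanSpace ℝ (Fin d)) :
    partialDeriv i (partialDeriv j f) y = partialDeriv j (partialDeriv i f) y := by
  have hd : Differentiable ℝ (fderiv ℝ f) :=
    (hf.fderiv_right (m := 1) (by norm_num)).differentiable one_ne_zero
  have h : ∀ i j, partialDeriv i (partialDeriv j f) y = fderiv ℝ (fderiv ℝ f) y
      (EuclideanSpace.single i (1 : ℝ)) (EuclideanSpace.single j (1 : ℝ)) := fun i j => by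
    have : HasFDerivAt (partialDeriv j f) _ y :=
      (hd y).hasFDerivAt.clm_apply (hasFDerivAt_const (EuclideanSpace.single j (1 : ℝ)) y)
    rw [partialDeriv, this.fderiv]
    simp
  rw [h, h]
  exact (hf.contDiffAt.isSymmSndFDerivAt (by simp)) _ _

/-- The sum of the partial derivatives of the convection coefficients. -/
theorem sum_partialDeriv_convectionCoeff
    {v : EuclideanSpace ℝ (Fin d) → EuclideanSpace ℝ (Fin d)} (hv : ContDiff ℝ 2 v)
    (y : EuclideanSpace ℝ (Fin d)) :
    (∑ j, partialDeriv j (fun y => v y j) y) ^ 2 +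
      ∑ i, ∑ j, ∑ k, ((if i = k then 1 else 0) * partialDeriv j (convectionCoeff v i j k) y -
        (if j = k then 1 else 0) * partialDeriv i (convectionCoeff v i j k) y) =
    ∑ i, ∑ j, partialDeriv j (fun y => v y i) y * partialDeriv i (fun y => v y j) y := by
  have hc := fun i => contDiff_apply_euclidean hv i
  have hD : ∀ l i j k, partialDeriv l (convectionCoeff v i j k) y =
      partialDeriv l (fun y => v y i) y * partialDeriv k (fun y => v y j) y +
        v y i * partialDeriv l (partialDeriv k fun y => v y j) y := fun l i j k =>
    partialDeriv_mul ((hc i).of_le one_le_two) (contDiff_partialDeriv (hc j) le_rfl k) l y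
  simp only [hD, Finset.sum_sub_distrib, ite_mul, one_mul, zero_mul, Finset.sum_ite_eq,
    Finset.mem_univ, if_true]
  simp only [← Finset.sum_sub_distrib, sq, Finset.sum_mul_sum, ← Finset.sum_add_distrib]
  refine Finset.sum_congr rfl fun i _ => Finset.sum_congr rfl fun j _ => ?_
  -- Equality of mixed derivatives cancels the v_i ∂_i ∂_j v_j terms; the squared divergence cancels
  -- the product of diagonal derivatives.
  rw [partialDeriv_comm (hc j) i j]
  ring

/-- The order of choices matters: lam is fixed first to make lam·K·G small, and only then does ε → 0
kill lam⁻¹ times the error. -/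
theorem tendsto_of_forall_abs_sub_le {F R Err : ℝ → ℝ} {K G L : ℝ}
    (hR : Tendsto R (𝓝[>] 0) (𝓝 L)) (hE : Tendsto Err (𝓝[>] 0) (𝓝 0))
    (h : ∀ ε lam : ℝ, 0 < ε → 0 < lam → lam ≤ 1 →
      |F ε - R ε| ≤ K * (lam * G + lam⁻¹ * Err ε)) :
    Tendsto F (𝓝[>] 0) (𝓝 L) := by
  have hd : Tendsto (fun ε => F ε - R ε) (𝓝[>] 0) (𝓝 0) := by
    rw [Metric.tendsto_nhds]
    intro δ hδ
    set lam := min 1 (δ / (2 * (|K * G| + 1))) with hlam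
    have hp : 0 < 2 * (|K * G| + 1) := by positivity
    have hl : 0 < lam := lt_min one_pos (by positivity)
    have hl2 : lam * |K * G| < δ / 2 := by
      have h1 : lam * (2 * (|K * G| + 1)) ≤ δ := by
        rw [← le_div_iff₀ hp]; exact min_le_right _ _
      nlinarith
    have hE2 : Tendsto (fun ε => K * (lam⁻¹ * Err ε)) (𝓝[>] 0) (𝓝 0) := by
      simpa using (hE.const_mul lam⁻¹).const_mul K
    filter_upwards [hE2.eventually_lt_const (by positivity : 0 < δ / 2), self_mem_nhdsWithin]
      with ε h1 hε
    have h2 := h ε lam hε hl (min_le_left _ _)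
    have h3 : K * (lam * G) ≤ lam * |K * G| := by
      have := mul_le_mul_of_nonneg_left (le_abs_self (K * G)) hl.le
      linarith
    rw [dist_zero_right, Real.norm_eq_abs]
    rw [mul_add] at h2
    linarith
  have := hd.add hR
  simpa using this

/-- Convergence of the entropy part of the mollified Hessian. -/
theorem tendsto_integral_entropy [IsProbabilityMeasure μ] (hμ : μ ≪ volume)
    (hμ2 : Integrable (fun x => ‖x‖ ^ 2) μ)
    {v : EuclideanSpace ℝ (Fin d) → EuclideanSpace ℝ (Fin d)} (hv : ContDiff ℝ 2 v)
    (hvc : HasCompactSupport v) :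
    Tendsto (fun ε =>
      ∫ y, ((Real.log (mollifiedDensity ε μ y) + 1) * pathDensityDeriv₂ ε μ v 0 y +
        pathDensityDeriv ε μ v 0 y ^ 2 / mollifiedDensity ε μ y)) (𝓝[>] 0)
      (𝓝 (∫ x, ∑ i, ∑ j, partialDeriv j (fun y => v y i) x *
        partialDeriv i (fun y => v y j) x ∂μ)) := by
  obtain ⟨K, C, -, h⟩ := abs_entropy_sub_le hμ2 hv hvc
  have hv1 : ContDiff ℝ 1 v := hv.of_le one_le_two
  have hpc := fun i j => continuous_partialDeriv (contDiff_apply_euclidean hv1 j) i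
  have hτc : Continuous fun y => (∑ j, partialDeriv j (fun y => v y j) y) ^ 2 :=
    (continuous_finsetSum _ fun j _ => hpc j j).pow 2
  have hτs : HasCompactSupport fun y => (∑ j, partialDeriv j (fun y => v y j) y) ^ 2 := by
    refine (hvc.fderiv (𝕜 := ℝ)).mono fun y hy h0 => hy ?_
    simp only [partialDeriv_apply (hv1.differentiable one_ne_zero), h0]
    simp
  obtain ⟨B, hB⟩ := hτs.exists_bound_of_continuous hτc
  have hR0 := tendsto_integral_mul_mollifiedDensity (μ := μ) hτc hB
  have hR1 := tendsto_finsetSum Finset.univ fun i _ => tendsto_finsetSum Finset.univ fun j _ =>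
    tendsto_finsetSum Finset.univ fun k _ => tendsto_integral_mul_noiseMoment_antisymm hμ
      (contDiff_convectionCoeff hv i j k) (hasCompactSupport_convectionCoeff hvc i j k) i j k
  have hR := hR0.add hR1
  have hi : ∀ i j k, Integrable (fun x =>
      (if i = k then 1 else 0) * partialDeriv j (convectionCoeff v i j k) x -
        (if j = k then 1 else 0) * partialDeriv i (convectionCoeff v i j k) x) μ := fun i j k => by
    have hp := fun l => (continuous_partialDeriv (contDiff_convectionCoeff hv i j k)
      l).integrable_of_hasCompactSupport (μ := μ)
      (hasCompactSupport_partialDeriv (hasCompactSupport_convectionCoeff hvc i j k) l)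
    exact ((hp j).const_mul _).sub ((hp i).const_mul _)
  have hL : (∫ x, (∑ j, partialDeriv j (fun y => v y j) x) ^ 2 ∂μ) +
      ∑ i, ∑ j, ∑ k, ∫ x, ((if i = k then 1 else 0) * partialDeriv j (convectionCoeff v i j k) x -
        (if j = k then 1 else 0) * partialDeriv i (convectionCoeff v i j k) x) ∂μ =
      ∫ x, ∑ i, ∑ j, partialDeriv j (fun y => v y i) x * partialDeriv i (fun y => v y j) x ∂μ := by
    simp only [← sum_partialDeriv_convectionCoeff hv]
    rw [integral_add (hτc.integrable_of_hasCompactSupport hτs) (integrable_finsetSum _ fun i _ =>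
      integrable_finsetSum _ fun j _ => integrable_finsetSum _ fun k _ => hi i j k),
      integral_finsetSum _ fun i _ =>
        integrable_finsetSum _ fun j _ => integrable_finsetSum _ fun k _ => hi i j k]
    congr 1
    refine Finset.sum_congr rfl fun i _ => ?_
    rw [integral_finsetSum _ fun j _ => integrable_finsetSum _ fun k _ => hi i j k]
    refine Finset.sum_congr rfl fun j _ => ?_
    rw [integral_finsetSum _ fun k _ => hi i j k]
  rw [hL] at hR
  have hE1 := tendsto_finsetSum Finset.univ fun (i : Fin d) _ =>
    tendsto_integral_sq_posterior hμ (φ := fun z => z i) (by fun_prop)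
    (fun z => abs_apply_le_one_add_norm z i) (integral_apply_mul_gaussianKernel i)
  have hE2 := tendsto_finsetSum Finset.univ fun (p : Fin d × Fin d) _ =>
    tendsto_integral_sq_posterior hμ (φ := fun z => z p.1 * z p.2 - if p.1 = p.2 then 1 else 0)
      (by fun_prop) (fun z => abs_apply_mul_apply_sub_le p.1 p.2 z)
      (integral_apply_mul_apply_sub_mul_gaussianKernel p.1 p.2)
  have hE3 : Tendsto (fun ε : ℝ => ε ^ 2 *
      ∫ z : EuclideanSpace ℝ (Fin d), (1 + ‖z‖) ^ 6 * gaussianKernel 1 z) (𝓝[>] 0) (𝓝 0) := by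
    have : Continuous fun ε : ℝ => ε ^ 2 *
      ∫ z : EuclideanSpace ℝ (Fin d), (1 + ‖z‖) ^ 6 * gaussianKernel 1 z := by fun_prop
    simpa using (this.tendsto 0).mono_left nhdsWithin_le_nhds
  have hE := (hE1.add (hE2.const_mul ((d : ℝ) ^ 2 * C ^ 2))).add hE3
  simp only [Finset.sum_const_zero, mul_zero, add_zero] at hE
  exact tendsto_of_forall_abs_sub_le hR hE h

theorem inner_hessianOp_comm {f : EuclideanSpace ℝ (Fin d) → ℝ} (hf : ContDiff ℝ 2 f)
    (x u w : EuclideanSpace ℝ (Fin d)) :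
    (inner ℝ (hessianOp f x u) w : ℝ) = inner ℝ u (hessianOp f x w) := by
  have hd : Differentiable ℝ (fderiv ℝ f) :=
    (hf.fderiv_right (m := 1) (by norm_num)).differentiable one_ne_zero
  have h : ∀ u w, (inner ℝ (hessianOp f x u) w : ℝ) = fderiv ℝ (fderiv ℝ f) x u w := fun u w => by
    have hg : HasFDerivAt (gradient f) (hessianOp f x) x :=
      ((contDiff_gradient (m := 1) hf (by norm_num)).differentiable one_ne_zero x).hasFDerivAt
    have h1 := hg.inner ℝ (hasFDerivAt_const w x)
    have h2 := (hd x).hasFDerivAt.clm_apply (hasFDerivAt_const w x)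
    have e : (fun y => (inner ℝ (gradient f y) w : ℝ)) = fun y => fderiv ℝ f y w := by
      ext y
      exact InnerProductSpace.toDual_symm_apply
    rw [e] at h1
    have h3 := congrArg (fun L : EuclideanSpace ℝ (Fin d) →L[ℝ] ℝ => L u) (h1.unique h2)
    simpa using h3
  rw [h, real_inner_comm, h]
  exact (hf.contDiffAt.isSymmSndFDerivAt (by simp)) _ _

/-- The entropy limit is Σ ∂_j v_i ∂_i v_j for an arbitrary field v; it becomes a sum of squares
because the Jacobian of a gradient is symmetric. -/
theorem hsNormSq_hessianOp {f : EuclideanSpace ℝ (Fin d) → ℝ} (hf : ContDiff ℝ 2 f)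
    (x : EuclideanSpace ℝ (Fin d)) :
    hsNormSq (hessianOp f x) = ∑ i, ∑ j, partialDeriv j (fun y => gradient f y i) x *
        partialDeriv i (fun y => gradient f y j) x := by
  have hd : Differentiable ℝ (gradient f) :=
    (contDiff_gradient (m := 1) hf (by norm_num)).differentiable one_ne_zero
  have hsym : ∀ i j, fderiv ℝ (gradient f) x (EuclideanSpace.single j (1 : ℝ)) i =
      fderiv ℝ (gradient f) x (EuclideanSpace.single i (1 : ℝ)) j := fun i j => by
    rw [← inner_single_one_right, ← inner_single_one_right,
      real_inner_comm _ (fderiv ℝ (gradient f) x (EuclideanSpace.single i (1 : ℝ)))]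
    exact inner_hessianOp_comm hf x _ _
  simp only [hsNormSq, norm_sq_eq_sum_apply, partialDeriv_apply hd,
    EuclideanSpace.basisFun_apply]
  refine Finset.sum_congr rfl fun i _ => Finset.sum_congr rfl fun j _ => ?_
  rw [hsym i j, sq]
  rfl

theorem continuous_hsNormSq : Continuous (hsNormSq (d := d)) := by
  unfold hsNormSq
  fun_prop

theorem tendsto_mollifiedHessian [IsProbabilityMeasure μ] (hμ : μ ≪ volume)
    (hμ2 : Integrable (fun x => ‖x‖ ^ 2) μ) {V ψ : EuclideanSpace ℝ (Fin d) → ℝ}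
    (hV : ContDiff ℝ 2 V) {ε₀ : ℝ} (hε₀ : 0 < ε₀) (hVε₀ : Integrable V (mollify ε₀ μ))
    (hψ : ContDiff ℝ 3 ψ) (hψc : HasCompactSupport ψ) :
    Tendsto (fun ε => mollifiedHessian V ε μ (gradient ψ)) (𝓝[>] 0)
      (𝓝 (limitHessian V μ ψ)) := by
  have hv : ContDiff ℝ 2 (gradient ψ) := contDiff_gradient hψ (by norm_num)
  have hvc := hasCompactSupport_gradient hψc
  have hψ2 : ContDiff ℝ 2 ψ := hψ.of_le (by norm_num)
  obtain ⟨M, hM⟩ := hvc.exists_bound_of_continuous hv.continuous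
  have h1 := tendsto_integral_potential_mul_pathDensityDeriv₂ hV hε₀ hVε₀ hv.continuous hvc
  have h2 := tendsto_integral_entropy hμ hμ2 hv hvc
  have hL : limitHessian V μ ψ = (∫ x, inner ℝ (hessianOp V x (gradient ψ x)) (gradient ψ x) ∂μ) +
      ∫ x, ∑ i, ∑ j, partialDeriv j (fun y => gradient ψ y i) x *
        partialDeriv i (fun y => gradient ψ y j) x ∂μ := by
    simp only [← hsNormSq_hessianOp hψ2]
    refine integral_add ?_ ?_
    · refine Continuous.integrable_of_hasCompactSupport ?_ (hvc.mono fun y hy h0 => hy ?_)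
      · exact (((continuous_hessianOp hV).clm_apply hv.continuous)).inner hv.continuous
      · simp only [h0, inner_zero_right]
    · refine Continuous.integrable_of_hasCompactSupport
        (continuous_hsNormSq.comp (continuous_hessianOp hψ2))
        ((hasCompactSupport_hessianOp hψc).mono fun y hy h0 => hy ?_)
      simp [hsNormSq, h0]
  rw [hL]
  refine (h1.add h2).congr' ?_
  filter_upwards [Ioo_mem_nhdsGT hε₀] with ε hε
  obtain ⟨bound, hbi, hb⟩ :=
    integrable_mollifiedHessian_terms hμ2 hε.1 hε.2 hVε₀ hv.continuous hM
  have i1 : Integrable fun y => V y * pathDensityDeriv₂ ε μ (gradient ψ) 0 y :=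
    hbi.mono' (hV.continuous.aestronglyMeasurable.mul
      (stronglyMeasurable_pathDensityDeriv₂ ε 0 hv.continuous).aestronglyMeasurable)
      (Eventually.of_forall fun y => (hb y 0 (by simp)).2.2.2.1)
  obtain ⟨i2, i3⟩ := integrable_log_add_one_mul_pathDensityDeriv₂ hμ2 hε.1 hv.continuous hM
  have i23 : Integrable fun y =>
      (Real.log (mollifiedDensity ε μ y) + 1) * pathDensityDeriv₂ ε μ (gradient ψ) 0 y +
        pathDensityDeriv ε μ (gradient ψ) 0 y ^ 2 / mollifiedDensity ε μ y := i2.add i3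
  rw [← integral_add i1 i23, mollifiedHessian, mollifiedDensity_eq_pathDensity ε (gradient ψ)]
  refine integral_congr_ae (Eventually.of_forall fun y => ?_)
  ring

end EntropyHessian

/-! ### Spectral description of symmetric operators -/

section SymmetricOperator

variable {d : ℕ}

/-- For symmetric L both sides are the trace of L², which does not depend on the basis. -/
theorem hsNormSq_eq_sum_orthonormalBasis
    {L : EuclideanSpace ℝ (Fin d) →L[ℝ] EuclideanSpace ℝ (Fin d)}
    (hL : ∀ u w, (inner ℝ (L u) w : ℝ) = inner ℝ u (L w))
    (b : OrthonormalBasis (Fin d) ℝ (EuclideanSpace ℝ (Fin d))) :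
    hsNormSq L = ∑ i, ‖L (b i)‖ ^ 2 := by
  have h : ∀ b : OrthonormalBasis (Fin d) ℝ (EuclideanSpace ℝ (Fin d)),
      LinearMap.trace ℝ _ ((L ∘L L : EuclideanSpace ℝ (Fin d) →L[ℝ] EuclideanSpace ℝ (Fin d)) :
        EuclideanSpace ℝ (Fin d) →ₗ[ℝ] EuclideanSpace ℝ (Fin d)) = ∑ i, ‖L (b i)‖ ^ 2 := fun b => by
    rw [LinearMap.trace_eq_sum_inner _ b]
    refine Finset.sum_congr rfl fun i _ => ?_
    rw [← real_inner_self_eq_norm_sq, hL]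
    rfl
  rw [← h b, h (EuclideanSpace.basisFun (Fin d) ℝ)]
  rfl

theorem exists_eigenvalues_of_symmetric
    {L : EuclideanSpace ℝ (Fin d) →L[ℝ] EuclideanSpace ℝ (Fin d)}
    (hL : ∀ u w, (inner ℝ (L u) w : ℝ) = inner ℝ u (L w)) :
    ∃ l : Fin d → ℝ, (∀ i, |l i| ≤ ‖L‖) ∧
      (∀ t : ℝ, (ContinuousLinearMap.id ℝ (EuclideanSpace ℝ (Fin d)) + t • L).det =
        ∏ i, (1 + t * l i)) ∧ hsNormSq L = ∑ i, l i ^ 2 := by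
  have hS : (L : EuclideanSpace ℝ (Fin d) →ₗ[ℝ] EuclideanSpace ℝ (Fin d)).IsSymmetric := hL
  have hn : Module.finrank ℝ (EuclideanSpace ℝ (Fin d)) = d := by simp
  set b := hS.eigenvectorBasis hn
  set l := hS.eigenvalues hn
  have hb : ∀ i, L (b i) = l i • b i := fun i => hS.apply_eigenvectorBasis hn i
  have hbn : ∀ i, ‖L (b i)‖ = |l i| := fun i => by
    rw [hb, norm_smul, b.orthonormal.1 i, mul_one, Real.norm_eq_abs]
  refine ⟨l, fun i => ?_, fun t => ?_, ?_⟩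
  · rw [← hbn]
    have := L.le_opNorm (b i)
    rwa [b.orthonormal.1 i, mul_one] at this
  · have hm : LinearMap.toMatrix b.toBasis b.toBasis
        ((ContinuousLinearMap.id ℝ (EuclideanSpace ℝ (Fin d)) + t • L :
          EuclideanSpace ℝ (Fin d) →L[ℝ] EuclideanSpace ℝ (Fin d)) :
          EuclideanSpace ℝ (Fin d) →ₗ[ℝ] EuclideanSpace ℝ (Fin d)) =
        Matrix.diagonal fun i => 1 + t * l i := by
      ext i j
      have : b j + t • l j • b j = (1 + t * l j) • b j := by
        rw [add_smul, one_smul, smul_smul]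
      rw [LinearMap.toMatrix_apply, Matrix.diagonal_apply]
      simp only [OrthonormalBasis.coe_toBasis, ContinuousLinearMap.coe_coe, add_apply, smul_apply,
        ContinuousLinearMap.id_apply, hb, this, map_smul]
      split_ifs with h <;> simp [h]
    rw [ContinuousLinearMap.det, ← LinearMap.det_toMatrix b.toBasis, hm, Matrix.det_diagonal]
  · rw [hsNormSq_eq_sum_orthonormalBasis hL b]
    simp only [hbn, sq_abs]

end SymmetricOperator

/-! ### Relative entropy under a change of variables -/

section ChangeOfVariables

open InformationTheory

/-- The data processing inequality applied to the map and to its inverse. -/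
theorem klDiv_map_measurableEquiv {α β : Type*} [MeasurableSpace α] [MeasurableSpace β]
    (e : α ≃ᵐ β) (μ : Measure α) (ν : Measure β) [IsFiniteMeasure μ] [IsFiniteMeasure ν] :
    klDiv (μ.map e) ν = klDiv μ (ν.map e.symm) := by
  have h1 : (ν.map e.symm).map e = ν := e.map_map_symm
  have h2 : (μ.map e).map e.symm = μ := e.map_symm_map
  apply le_antisymm
  · have h := klDiv_map_le μ (ν.map e.symm) e.measurable
    rwa [h1] at h
  · have h := klDiv_map_le (μ.map e) ν e.symm.measurable
    rwa [h2] at h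

/-- Tilting the reference by a normalized e^g subtracts g from the log-likelihood ratio. -/
theorem toReal_klDiv_tilted_right {α : Type*} [MeasurableSpace α] {μ ν : Measure α}
    [IsProbabilityMeasure μ] [IsProbabilityMeasure ν] (h : klDiv μ ν ≠ ⊤) {g : α → ℝ}
    (hg : Integrable g μ) (hgν : Integrable (fun x => Real.exp (g x)) ν)
    (h1 : ∫ x, Real.exp (g x) ∂ν = 1) :
    klDiv μ (ν.tilted g) ≠ ⊤ ∧
      (klDiv μ (ν.tilted g)).toReal = (klDiv μ ν).toReal - ∫ x, g x ∂μ := by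
  obtain ⟨hac, hint⟩ := klDiv_ne_top_iff.1 h
  have := isProbabilityMeasure_tilted hgν
  have hac' : μ ≪ ν.tilted g := hac.trans (absolutelyContinuous_tilted hgν)
  refine ⟨klDiv_ne_top hac' (integrable_llr_tilted_right hac hg hint hgν), ?_⟩
  rw [toReal_klDiv_of_measure_eq hac' (by simp), toReal_klDiv_of_measure_eq hac (by simp),
    integral_llr_tilted_right hac hg hgν hint, h1, Real.log_one, add_zero]

variable {E : Type*} [NormedAddCommGroup E] [NormedSpace ℝ E] [FiniteDimensional ℝ E]
  [MeasurableSpace E] [BorelSpace E] {m : Measure E} [m.IsAddHaarMeasure]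

theorem integral_exp_comp_add_log_det (e : E ≃ₜ E) {T' : E → E →L[ℝ] E}
    (hT : ∀ x, HasFDerivAt e (T' x) x) (hdet : ∀ x, (T' x).det ≠ 0) (f : E → ℝ) :
    ∫ x, Real.exp (f (e x) + Real.log |(T' x).det|) ∂m = ∫ x, Real.exp (f x) ∂m := by
  have h := integral_image_eq_integral_abs_det_fderiv_smul m MeasurableSet.univ
    (fun x _ => (hT x).hasFDerivWithinAt) e.injective.injOn (fun x => Real.exp (f x))
  rw [image_univ, e.surjective.range_eq, setIntegral_univ, setIntegral_univ] at h
  rw [h]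
  refine integral_congr_ae (Eventually.of_forall fun x => ?_)
  simp only [Real.exp_add, Real.exp_log (abs_pos.2 (hdet x)), smul_eq_mul]
  ring

/-- The pullback of a Gibbs measure is again a Gibbs measure, with the log Jacobian added to the
exponent. So moving μ forward amounts to tilting the target. -/
theorem tilted_map_homeomorph_symm (e : E ≃ₜ E) {T' : E → E →L[ℝ] E}
    (hT : ∀ x, HasFDerivAt e (T' x) x) (hdet : ∀ x, (T' x).det ≠ 0) (f : E → ℝ) :
    (m.tilted f).map e.symm = m.tilted fun x => f (e x) + Real.log |(T' x).det| := by
  ext s hs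
  have hpre : e.symm ⁻¹' s = e '' s := (e.toEquiv.image_eq_preimage_symm s).symm
  rw [Measure.map_apply e.symm.measurable hs, hpre, tilted_apply, tilted_apply,
    lintegral_image_eq_lintegral_abs_det_fderiv_mul m hs
      (fun x _ => (hT x).hasFDerivWithinAt) e.injective.injOn,
    integral_exp_comp_add_log_det e hT hdet f]
  refine lintegral_congr fun x => ?_
  rw [← ENNReal.ofReal_mul (abs_nonneg _), Real.exp_add, Real.exp_log (abs_pos.2 (hdet x))]
  congr 1
  ring

/-- The relative entropy along a diffeomorphism, with respect to a Gibbs measure. -/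
theorem toReal_klDiv_map_tilted (e : E ≃ₜ E) {T' : E → E →L[ℝ] E}
    (hT : ∀ x, HasFDerivAt e (T' x) x) (hdet : ∀ x, (T' x).det ≠ 0) {f : E → ℝ}
    (hf : Integrable (fun x => Real.exp (f x)) m) {μ : Measure E} [IsProbabilityMeasure μ]
    (h : klDiv μ (m.tilted f) ≠ ⊤)
    (hg : Integrable (fun x => f (e x) + Real.log |(T' x).det| - f x) μ) :
    klDiv (μ.map e) (m.tilted f) ≠ ⊤ ∧ (klDiv (μ.map e) (m.tilted f)).toReal =
      (klDiv μ (m.tilted f)).toReal - ∫ x, (f (e x) + Real.log |(T' x).det| - f x) ∂μ := by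
  have : IsProbabilityMeasure (m.tilted f) := isProbabilityMeasure_tilted hf
  set g : E → ℝ := fun x => f (e x) + Real.log |(T' x).det| - f x with hgdef
  have e1 : (f + g) = fun x => f (e x) + Real.log |(T' x).det| := by
    ext x; simp only [Pi.add_apply, hgdef]; ring
  have hpos : 0 < ∫ x, Real.exp (f x) ∂m := integral_exp_pos hf
  have hfg := integral_exp_comp_add_log_det (m := m) e hT hdet f
  have hν : (m.tilted f).map e.symm = (m.tilted f).tilted g := by
    rw [tilted_tilted hf, e1, tilted_map_homeomorph_symm e hT hdet]
  have h1 : ∫ x, Real.exp (g x) ∂(m.tilted f) = 1 := by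
    rw [integral_exp_tilted, e1, hfg, div_self hpos.ne']
  -- The integral equals 1, so it cannot be the default value 0 of a non-integrable function.
  have hint : Integrable (fun x => Real.exp (g x)) (m.tilted f) := by
    by_contra hn
    rw [integral_undef hn] at h1
    exact zero_ne_one h1
  have hmap : klDiv (μ.map e) (m.tilted f) = klDiv μ ((m.tilted f).tilted g) := by
    rw [← hν]
    exact klDiv_map_measurableEquiv e.toMeasurableEquiv μ (m.tilted f)
  rw [hmap]
  exact toReal_klDiv_tilted_right h hg hint h1

end ChangeOfVariables

/-! ### The Wasserstein Hessian of the relative entropy -/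

section RelEntropyHessian

variable {d : ℕ}

/-- A perturbation of the identity with Lipschitz constant at most 1/2 is a global homeomorphism, by
the quantitative inverse function theorem. -/
theorem exists_homeomorph_id_add_smul
    {v : EuclideanSpace ℝ (Fin d) → EuclideanSpace ℝ (Fin d)} {C t : ℝ}
    (hv : ∀ x y, ‖v y - v x‖ ≤ C * ‖y - x‖) (ht : |t| * C ≤ 1 / 2) :
    ∃ e : EuclideanSpace ℝ (Fin d) ≃ₜ EuclideanSpace ℝ (Fin d), ∀ x, e x = x + t • v x := by
  have happ : ApproximatesLinearOn (fun x => x + t • v x)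
      (ContinuousLinearEquiv.refl ℝ (EuclideanSpace ℝ (Fin d)) :
        EuclideanSpace ℝ (Fin d) →L[ℝ] EuclideanSpace ℝ (Fin d)) univ (1 / 2) := by
    intro x _ y _
    beta_reduce
    have e : x + t • v x - (y + t • v y) - (ContinuousLinearEquiv.refl ℝ (EuclideanSpace ℝ (Fin d)) :
        EuclideanSpace ℝ (Fin d) →L[ℝ] EuclideanSpace ℝ (Fin d)) (x - y) = t • (v x - v y) := by
      simp only [ContinuousLinearEquiv.coe_coe, ContinuousLinearEquiv.coe_refl', id_eq, smul_sub]
      abel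
    rw [e, norm_smul, Real.norm_eq_abs]
    calc |t| * ‖v x - v y‖ ≤ |t| * (C * ‖x - y‖) := by gcongr; exact hv y x
      _ = |t| * C * ‖x - y‖ := by ring
      _ ≤ 1 / 2 * ‖x - y‖ := by gcongr
      _ = _ := by simp
  -- In dimension 0 the identity has norm 0, so that case is separate.
  have hN : Subsingleton (EuclideanSpace ℝ (Fin d)) ∨ (1 / 2 : NNReal) <
      ‖((ContinuousLinearEquiv.refl ℝ (EuclideanSpace ℝ (Fin d))).symm :
        EuclideanSpace ℝ (Fin d) →L[ℝ] EuclideanSpace ℝ (Fin d))‖₊⁻¹ := by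
    rcases subsingleton_or_nontrivial (EuclideanSpace ℝ (Fin d)) with h | h
    · exact Or.inl h
    · right
      have : ‖((ContinuousLinearEquiv.refl ℝ (EuclideanSpace ℝ (Fin d))).symm :
        EuclideanSpace ℝ (Fin d) →L[ℝ] EuclideanSpace ℝ (Fin d))‖₊ = 1 :=
        NNReal.eq ContinuousLinearMap.norm_id
      rw [this, inv_one]
      exact NNReal.half_lt_self one_ne_zero
  exact ⟨happ.toHomeomorph _ hN, fun x => rfl⟩

theorem hasDerivAt_sum_log_one_add_mul {l : Fin d → ℝ} {t : ℝ} (h : ∀ i, 1 + t * l i ≠ 0) :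
    HasDerivAt (fun t => ∑ i, Real.log (1 + t * l i)) (∑ i, l i / (1 + t * l i)) t := by
  refine HasDerivAt.fun_sum fun i _ => ?_
  have h1 : HasDerivAt (fun t => 1 + t * l i) (l i) t := by
    simpa using ((hasDerivAt_id t).mul_const (l i)).const_add 1
  exact h1.log (h i)

theorem hasDerivAt_sum_div_one_add_mul {l : Fin d → ℝ} {t : ℝ} (h : ∀ i, 1 + t * l i ≠ 0) :
    HasDerivAt (fun t => ∑ i, l i / (1 + t * l i)) (∑ i, -(l i / (1 + t * l i)) ^ 2) t := by
  refine HasDerivAt.fun_sum fun i _ => ?_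
  have h1 : HasDerivAt (fun t => 1 + t * l i) (l i) t := by
    simpa using ((hasDerivAt_id t).mul_const (l i)).const_add 1
  refine ((hasDerivAt_const t (l i)).div h1 (h i)).congr_deriv ?_
  have := h i
  field_simp
  ring

variable {μ : Measure (EuclideanSpace ℝ (Fin d))}

/-- The Wasserstein Hessian of the relative entropy. -/
theorem hasWassersteinHessian_relEntropy [IsProbabilityMeasure μ]
    {V ψ : EuclideanSpace ℝ (Fin d) → ℝ} (hV : ContDiff ℝ 2 V)
    (hZ : Integrable (fun x => Real.exp (-V x)) volume) (hψ : ContDiff ℝ 3 ψ)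
    (hψc : HasCompactSupport ψ) (hKL : relEntropy V μ ≠ ⊤) :
    HasWassersteinHessian (relEntropy V) μ ψ (limitHessian V μ ψ) := by
  have hv : ContDiff ℝ 2 (gradient ψ) := contDiff_gradient hψ (by norm_num)
  have hvc := hasCompactSupport_gradient hψc
  have hψ2 : ContDiff ℝ 2 ψ := hψ.of_le (by norm_num)
  have hV1 : ContDiff ℝ 1 V := hV.of_le one_le_two
  obtain ⟨C, hC0, hC, hCA, hC1, -⟩ := exists_taylor_bound hv hvc
  set v := gradient ψ with hvdef
  choose l hlb hldet hlhs using fun x => exists_eigenvalues_of_symmetric (inner_hessianOp_comm hψ2 x)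
  have hlC : ∀ x i, |l x i| ≤ C := fun x i => (hlb x i).trans (hCA x)
  -- For |t| < r both |t| C ≤ 1/2 and |t| ≤ 1 hold: the map is invertible and every 1 + t l_i is at
  -- least 1/2.
  set r : ℝ := 1 / (2 * (C + 1)) with hr
  have hr0 : 0 < r := by positivity
  have hrt : ∀ t ∈ Metric.ball (0 : ℝ) r, |t| * C ≤ 1 / 2 ∧ |t| ≤ 1 := fun t ht => by
    rw [Metric.mem_ball, dist_zero_right, Real.norm_eq_abs, hr, lt_div_iff₀ (by positivity)] at ht
    constructor <;> nlinarith [abs_nonneg t, mul_nonneg (abs_nonneg t) hC0]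
  have hlow : ∀ t ∈ Metric.ball (0 : ℝ) r, ∀ x i, 1 / 2 ≤ 1 + t * l x i := fun t ht x i => by
    have h : |t * l x i| ≤ 1 / 2 := by
      rw [abs_mul]
      exact (mul_le_mul_of_nonneg_left (hlC x i) (abs_nonneg t)).trans (hrt t ht).1
    linarith [neg_abs_le (t * l x i)]
  have hne : ∀ t ∈ Metric.ball (0 : ℝ) r, ∀ x i, 1 + t * l x i ≠ 0 := fun t ht x i => by
    have := hlow t ht x i
    positivity
  set T' : ℝ → EuclideanSpace ℝ (Fin d) →
      EuclideanSpace ℝ (Fin d) →L[ℝ] EuclideanSpace ℝ (Fin d) := fun t x =>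
    ContinuousLinearMap.id ℝ (EuclideanSpace ℝ (Fin d)) + t • hessianOp ψ x with hT'
  have hdet0 : ∀ t ∈ Metric.ball (0 : ℝ) r, ∀ x, (T' t x).det ≠ 0 := fun t ht x => by
    rw [hT', hldet]
    exact Finset.prod_ne_zero_iff.2 fun i _ => hne t ht x i
  have hlogdet : ∀ t ∈ Metric.ball (0 : ℝ) r, ∀ x,
      Real.log |(T' t x).det| = ∑ i, Real.log (1 + t * l x i) := fun t ht x => by
    rw [Real.log_abs, hT', hldet, Real.log_prod fun i _ => hne t ht x i]
  set F : ℝ → EuclideanSpace ℝ (Fin d) → ℝ := fun t x =>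
    V (x + t • v x) - V x - ∑ i, Real.log (1 + t * l x i) with hF
  set F' : ℝ → EuclideanSpace ℝ (Fin d) → ℝ := fun t x =>
    inner ℝ (gradient V (x + t • v x)) (v x) - ∑ i, l x i / (1 + t * l x i) with hF'
  set F'' : ℝ → EuclideanSpace ℝ (Fin d) → ℝ := fun t x =>
    inner ℝ (hessianOp V (x + t • v x) (v x)) (v x) - ∑ i, -(l x i / (1 + t * l x i)) ^ 2 with hF''
  have hgF : ∀ t ∈ Metric.ball (0 : ℝ) r, ∀ x,
      -V (x + t • v x) + Real.log |(T' t x).det| - -V x = -F t x := fun t ht x => by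
    rw [hlogdet t ht]; simp only [hF]; ring
  have hAc : Continuous (hessianOp ψ) := continuous_hessianOp hψ2
  have hvcont := hv.continuous
  have hVcont := hV.continuous
  -- The eigenvalues were chosen pointwise, with no measurability in x. Integrability is seen
  -- through log |det|, which is continuous and vanishes off the support of Hψ.
  have hFi : ∀ t ∈ Metric.ball (0 : ℝ) r, Integrable (F t) μ := fun t ht => by
    have h1 : Integrable (fun x => V (x + t • v x) - V x) μ := by
      refine Continuous.integrable_of_hasCompactSupport (by fun_prop)
        (hvc.mono fun y hy h0 => hy ?_)
      simp only [h0, smul_zero, add_zero, sub_self]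
    have h2 : Integrable (fun x => Real.log |(T' t x).det|) μ := by
      refine Continuous.integrable_of_hasCompactSupport ?_
        ((hasCompactSupport_hessianOp hψc).mono fun y hy h0 => hy ?_)
      · refine Continuous.log ?_ fun x => (abs_pos.2 (hdet0 t ht x)).ne'
        have : Continuous (T' t) := by fun_prop
        exact (ContinuousLinearMap.continuous_det.comp this).abs
      · simp [hT', h0, ContinuousLinearMap.det]
    refine (h1.sub h2).congr (Eventually.of_forall fun x => ?_)
    simp only [Pi.sub_apply, hlogdet t ht, hF]
  obtain ⟨R, hR⟩ : ∃ R : ℝ, ∀ x, v x ≠ 0 → ‖x‖ ≤ R := by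
    obtain ⟨R, hR⟩ := hvc.isCompact.isBounded.exists_norm_le
    exact ⟨R, fun x hx => hR x (subset_tsupport _ hx)⟩
  -- Points where v ≠ 0 have norm at most R and move by at most C, so only the derivatives of V on
  -- this ball matter.
  have hK : IsCompact (Metric.closedBall (0 : EuclideanSpace ℝ (Fin d)) (R + C)) :=
    isCompact_closedBall _ _
  obtain ⟨B1, hB1⟩ := hK.exists_bound_of_continuousOn
    (contDiff_gradient (m := 1) hV (by norm_num)).continuous.continuousOn
  obtain ⟨B2, hB2⟩ := hK.exists_bound_of_continuousOn (continuous_hessianOp hV).continuousOn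
  have hmem : ∀ t ∈ Metric.ball (0 : ℝ) r, ∀ x, v x ≠ 0 →
      x + t • v x ∈ Metric.closedBall (0 : EuclideanSpace ℝ (Fin d)) (R + C) := fun t ht x hx => by
    rw [mem_closedBall_zero_iff]
    refine (norm_add_le _ _).trans (add_le_add (hR x hx) ?_)
    rw [norm_smul, Real.norm_eq_abs]
    calc |t| * ‖v x‖ ≤ 1 * C := by
          gcongr
          · exact (hrt t ht).2
          · exact hC x
      _ = C := one_mul C
  have hq : ∀ t ∈ Metric.ball (0 : ℝ) r, ∀ x i, |l x i / (1 + t * l x i)| ≤ 2 * C :=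
    fun t ht x i => by
      have h := hlow t ht x i
      rw [abs_div, abs_of_pos (by linarith : 0 < 1 + t * l x i), div_le_iff₀ (by linarith)]
      nlinarith [hlC x i]
  have hbV : ∀ t ∈ Metric.ball (0 : ℝ) r, ∀ x,
      |(inner ℝ (gradient V (x + t • v x)) (v x) : ℝ)| ≤ |B1| * C := fun t ht x => by
    rcases eq_or_ne (v x) 0 with h0 | h0
    · rw [h0, inner_zero_right, abs_zero]; positivity
    · refine (abs_real_inner_le_norm _ _).trans ?_
      gcongr
      · exact (hB1 _ (hmem t ht x h0)).trans (le_abs_self _)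
      · exact hC x
  have hbV' : ∀ t ∈ Metric.ball (0 : ℝ) r, ∀ x,
      |(inner ℝ (hessianOp V (x + t • v x) (v x)) (v x) : ℝ)| ≤ |B2| * C * C := fun t ht x => by
    rcases eq_or_ne (v x) 0 with h0 | h0
    · rw [h0, inner_zero_right, abs_zero]; positivity
    · refine (abs_real_inner_le_norm _ _).trans ?_
      gcongr
      · refine (ContinuousLinearMap.le_opNorm _ _).trans ?_
        gcongr
        · exact (hB2 _ (hmem t ht x h0)).trans (le_abs_self _)
        · exact hC x
      · exact hC x
  have hsum : ∀ {g : Fin d → ℝ} {B : ℝ}, (∀ i, |g i| ≤ B) → |∑ i, g i| ≤ d * B := fun {g B} hg =>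
    (Finset.abs_sum_le_sum_abs _ _).trans ((Finset.sum_le_sum fun i _ => hg i).trans (by simp))
  obtain ⟨hd, hd2⟩ := hasDerivAt_integral_twice (μ := μ) (F := F) (F' := F') (F'' := F'')
    (bound := fun _ => (|B1| * C + d * (2 * C)) + (|B2| * C * C + d * (2 * C) ^ 2)) hr0 hFi
    (Eventually.of_forall fun x t ht =>
      ((hasDerivAt_comp_line hV1 x (v x) t).sub_const (V x)).sub
        (hasDerivAt_sum_log_one_add_mul (hne t ht x)))
    (Eventually.of_forall fun x t ht =>
      (hasDerivAt_inner_gradient_comp_line hV x (v x) t).sub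
        (hasDerivAt_sum_div_one_add_mul (hne t ht x)))
    (Eventually.of_forall fun x t ht => by
      have h1 := (abs_sub (inner ℝ (gradient V (x + t • v x)) (v x))
        (∑ i, l x i / (1 + t * l x i))).trans (add_le_add (hbV t ht x) (hsum (hq t ht x)))
      have h2 : 0 ≤ |B2| * C * C + d * (2 * C) ^ 2 := by positivity
      exact h1.trans (by linarith))
    (Eventually.of_forall fun x t ht => by
      have h1 := (abs_sub (inner ℝ (hessianOp V (x + t • v x) (v x)) (v x) : ℝ)
        (∑ i, -(l x i / (1 + t * l x i)) ^ 2)).trans (add_le_add (hbV' t ht x)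
          (hsum (B := (2 * C) ^ 2) fun i => by
            rw [abs_neg, abs_pow]
            exact pow_le_pow_left₀ (abs_nonneg _) (hq t ht x i) 2))
      have h2 : 0 ≤ |B1| * C + d * (2 * C) := by positivity
      exact h1.trans (by linarith))
    (integrable_const _)
  have hKL' : InformationTheory.klDiv μ (targetMeasure V) ≠ ⊤ := by
    simpa [relEntropy] using hKL
  set K0 := (InformationTheory.klDiv μ (targetMeasure V)).toReal with hK0
  refine ⟨fun t => K0 + ∫ x, F t x ∂μ, ?_, ?_, ?_⟩
  · filter_upwards [Metric.ball_mem_nhds (0 : ℝ) hr0] with t ht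
    obtain ⟨e, he⟩ := exists_homeomorph_id_add_smul hC1 (hrt t ht).1
    have hTd : ∀ x, HasFDerivAt e (T' t x) x := fun x => by
      have h : HasFDerivAt (fun x => x + t • v x) (T' t x) x :=
        (hasFDerivAt_id x).add
          ((hv.differentiable two_ne_zero x).hasFDerivAt.const_smul t)
      exact h.congr_of_eventuallyEq (Eventually.of_forall he)
    have hmap : transportPath μ ψ t = μ.map e := by
      rw [transportPath]
      congr 1
      ext1 x
      exact (he x).symm
    have hfg : ∀ x, -V (e x) + Real.log |(T' t x).det| - -V x = -F t x := fun x => by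
      rw [he x]; exact hgF t ht x
    have h := toReal_klDiv_map_tilted e hTd (hdet0 t ht) hZ (μ := μ) hKL' (by
      simp only [hfg]; exact (hFi t ht).neg)
    simp only [hfg, integral_neg, sub_neg_eq_add] at h
    rw [hmap, relEntropy, targetMeasure, ← EReal.coe_ennreal_toReal h.1]
    exact congrArg _ h.2
  · filter_upwards [Metric.ball_mem_nhds (0 : ℝ) hr0] with t ht
    exact ((hd t ht).2.2.1.const_add K0).differentiableAt
  · have e : (deriv fun t => K0 + ∫ x, F t x ∂μ) = deriv fun t => ∫ x, F t x ∂μ := by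
      ext t
      exact deriv_const_add _
    rw [e]
    refine hd2.congr_deriv ?_
    rw [limitHessian]
    refine integral_congr_ae (Eventually.of_forall fun x => ?_)
    simp only [hF'', zero_smul, add_zero, zero_mul, div_one, Finset.sum_neg_distrib, hlhs,
      sub_neg_eq_add]
    rfl

end RelEntropyHessian

/-! ### The main theorem -/

theorem mainTheorem4 {d : ℕ} (V : EuclideanSpace ℝ (Fin d) → ℝ)
    (hV : ContDiff ℝ 2 V)
    (hZ : Integrable (fun x => Real.exp (-V x)) volume)
    (μ : Measure (EuclideanSpace ℝ (Fin d))) [IsProbabilityMeasure μ]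
    (hμ2 : Integrable (fun x => ‖x‖ ^ 2) μ)
    (hμac : μ ≪ volume)
    (ε₀ : ℝ) (hε₀ : 0 < ε₀) (hVε₀ : Integrable V (mollify ε₀ μ))
    (ψ : EuclideanSpace ℝ (Fin d) → ℝ) (hψ : ContDiff ℝ ∞ ψ) (hψc : HasCompactSupport ψ) :
    ∃ H : ℝ → ℝ,
      (∀ ε ∈ Ioo 0 ε₀, HasWassersteinHessian (mollifiedRelEntropy V ε) μ ψ (H ε)) ∧
      Tendsto H (𝓝[>] 0) (𝓝 (limitHessian V μ ψ)) ∧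
      (relEntropy V μ ≠ ⊤ →
        HasWassersteinHessian (relEntropy V) μ ψ (limitHessian V μ ψ)) := by
  -- Three derivatives of ψ suffice, the entropy expansion requiring ∇ψ of class C².
  have hψ3 : ContDiff ℝ 3 ψ := hψ.of_le (WithTop.coe_le_coe.2 le_top)
  have hv := (contDiff_gradient (m := 2) hψ3 (by norm_num)).continuous
  obtain ⟨M, hM⟩ := (hasCompactSupport_gradient hψc).exists_bound_of_continuous hv
  exact ⟨fun ε => mollifiedHessian V ε μ (gradient ψ),
    fun ε hε => hasWassersteinHessian_mollifiedRelEntropy hμ2 hV.continuous hε.1 hε.2 hVε₀ hv hM,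
    tendsto_mollifiedHessian hμac hμ2 hV hε₀ hVε₀ hψ3 hψc,
    hasWassersteinHessian_relEntropy hV hZ hψ3 hψc⟩
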